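/- **Corollary (revocable timed-release encryption).** *Conventions.* $\lambda$ is the security parameter. A non-uniform QPT adversary is a family of polynomial-size quantum circuits (gates are unitaries on at most three qubits) with polynomial-size pure advice states; its parallel time is the total circuit depth. For $T:\mathbb N\to\mathbb N$ it is a *$T(\lambda)$-parallel-time adversary* if its parallel time is at most $T(\lambda)+O(\lambda)$. A (classical) timed-release encryption scheme $\mathsf{TRE}=(\mathsf{Enc},\mathsf{Dec})$ for $n(\lambda)$-bit messages consists of probabilistic polynomial-time algorithms $\mathsf{Enc}(1^\lambda,m)\to\mathsf{ct}$ and $\mathsf{Dec}(\mathsf{ct})\to m$; it is *$T$-hiding* if for all families of messages $m_0,m_1\in\{0,1\}^{n(\lambda)}$ and every non-uniform QPT $T(\lambda)$-parallel-time adversary $\mathcal A$, $$\bigl|\Pr[\mathcal A_\lambda(\mathsf{Enc}(1^\lambda,m_0))=1]-\Pr[\mathcal A_\lambda(\mathsf{Enc}(1^\lambda,m_1))=1]\bigr|=\mathrm{negl}(\lambda).$$ For $x,\theta\in\{0,1\}^\lambda$, $|x\rangle_\theta$ is the $\lambda$-qubit state whose $i$-th qubit is $x_i$ encoded in the computational basis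 if $\theta_i=0$ and in the Hadamard basis if $\theta_i=1$. *Statement.* Let $T:\mathbb N\to\mathbb N$ and let $\mathsf{TRE}$ be a $T$-hiding timed-release encryption scheme for messages of $\lambda+1$ bits. Define a scheme for one-bit messages as follows. - $\mathsf{Enc}'(1^\lambda,b)$: sample $x,\theta\leftarrow\{0,1\}^\lambda$ and output $\mathsf{ct}=\bigl(|x\rangle_\theta,\ \mathsf{TRE.Enc}(1^\lambda,(\theta,\,b\oplus\bigoplus_{i:\theta_i=0}x_i))\bigr)$ and the verification key $\mathsf{vk}=(x,\theta)$. - $\mathsf{Dec}'(\mathsf{ct})$: compute $(\theta,b')\leftarrow\mathsf{TRE.Dec}$ of the classical part, measure the quantum part in the $\theta$-basis to obtain $x$, output $b'\oplus\bigoplus_{i:\theta_i=0}x_i$. - $\mathsf{Del}(\mathsf{ct})$: measure the quantum part in the Hadamard basis and output the resulting string as the classical certificate $\mathsf{cert}=x'$. - $\mathsf{Ver}((x,\theta),x')$: accept ($\top$) if and only if $x_i=x_i'$ for all $i$ with $\theta_i=1$. Then all four algorithms run in (uniform) polynomial time; if $\mathsf{TRE}$ decrypts correctly except with negligible probability, so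 does the new scheme; and the new scheme is a secure revocable timed-release encryption scheme against $T(\lambda)$-parallel-time adversaries, that is: 1. *(Hiding)* Ciphertexts (without $\mathsf{vk}$) of $0$ and $1$ are indistinguishable, up to negligible advantage, for every non-uniform QPT $T(\lambda)$-parallel-time adversary. 2. *(Correctness of deletion)* For $b\in\{0,1\}$, $(\mathsf{ct},\mathsf{vk})\leftarrow\mathsf{Enc}'(1^\lambda,b)$ and $\mathsf{cert}\leftarrow\mathsf{Del}(\mathsf{ct})$, $\Pr[\mathsf{Ver}(\mathsf{vk},\mathsf{cert})=\top]\ge 1-\mathrm{negl}(\lambda)$. 3. *(Revocable hiding)* Let $\mathcal A$ be a non-uniform QPT $T(\lambda)$-parallel-time adversary which, given $\mathsf{ct}$ for $(\mathsf{ct},\mathsf{vk})\leftarrow\mathsf{Enc}'(1^\lambda,b)$, outputs a certificate $\mathsf{cert}$ and a residual register $\mathsf A'$. Let $\mathsf{EV\text{-}EXP}^{\mathcal A}_\lambda(b)$ output $\mathsf A'$ if $\mathsf{Ver}(\mathsf{vk},\mathsf{cert})=\top$ and the symbol $\bot$ otherwise, and let $\mathsf{C\text{-}EXP}^{\mathcal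 A}_\lambda(b)$ output the bit $\mathcal A_\lambda(\mathsf A',\mathsf{Ver}(\mathsf{vk},\mathsf{cert}))$. Then, with $\mathsf{TD}$ the trace distance, $$\mathsf{TD}\bigl(\mathsf{EV\text{-}EXP}^{\mathcal A}_\lambda(0),\mathsf{EV\text{-}EXP}^{\mathcal A}_\lambda(1)\bigr)=\mathrm{negl}(\lambda),\qquad \bigl|\Pr[\mathsf{C\text{-}EXP}^{\mathcal A}_\lambda(0)=1]-\Pr[\mathsf{C\text{-}EXP}^{\mathcal A}_\lambda(1)=1]\bigr|=\mathrm{negl}(\lambda).$$ -/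

import Mathlib

/-!
Revocable timed-release encryption: quantum circuits with bounded parallel time, negligible
functions, trace distance, polynomial time for honest algorithms, timed-release encryption,
revocable timed-release encryption, and the BB84 compiler.
The security parameter is called `κ`.
-/

namespace RevTRE

/-- Bit strings of length `n`. -/
abbrev Bits (n : ℕ) : Type := Fin n → Bool

/-- `f` is negligible: eventually smaller than every inverse polynomial. -/
def Negl (f : ℕ → ℝ) : Prop :=
  ∀ c : ℕ, ∃ N : ℕ, ∀ n : ℕ, N < n → f n < ((n : ℝ) ^ c)⁻¹

/-- `f` is bounded by a polynomial. -/
def PolyBounded (f : ℕ → ℕ) : Prop :=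
  ∃ p : Polynomial ℕ, ∀ n : ℕ, f n ≤ p.eval n

/-- Expectation of `f` over a uniformly random string of `n` bits. -/
noncomputable def avg {n : ℕ} (f : Bits n → ℝ) : ℝ :=
  (∑ r : Bits n, f r) / 2 ^ n

/-! ### Pure states, trace distance -/

/-- Vectors on a register whose qubits are labelled by `W`; the computational basis of this
register is indexed by `W → Bool`. -/
abbrev Vec (W : Type) : Type := (W → Bool) → ℂ

/-- The computational basis state `|y⟩`. -/
def ket {W : Type} [Fintype W] (y : W → Bool) : Vec W :=
  fun z => if z = y then 1 else 0

/-- The product state `φ ⊗ ψ`. -/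
def tensor {V W : Type} (φ : Vec V) (ψ : Vec W) : Vec (V ⊕ W) :=
  fun z => φ (fun v => z (Sum.inl v)) * ψ (fun w => z (Sum.inr w))

/-- Squared norm. -/
noncomputable def normSq {W : Type} [Fintype W] [DecidableEq W] (φ : Vec W) : ℝ :=
  ∑ z : W → Bool, ‖φ z‖ ^ 2

/-- The trace norm `Tr √(Mᴴ M)`, the sum of the square roots of the eigenvalues of `Mᴴ M`. -/
noncomputable def traceNorm {X : Type} [Fintype X] [DecidableEq X] (M : Matrix X X ℂ) : ℝ :=
  ∑ i : X, √((Matrix.isHermitian_conjTranspose_mul_self M).eigenvalues i)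

/-- Trace distance. -/
noncomputable def traceDist {X : Type} [Fintype X] [DecidableEq X] (ρ σ : Matrix X X ℂ) : ℝ :=
  traceNorm (ρ - σ) / 2

/-! ### Quantum circuits, size and depth -/

/-- A gate: an arbitrary unitary on at most three of the wires `W`. -/
structure Gate (W : Type) [DecidableEq W] where
  wires : Finset W
  card_le : wires.card ≤ 3
  mat : Matrix (wires → Bool) (wires → Bool) ℂ
  unitary : mat ∈ Matrix.unitaryGroup (wires → Bool) ℂ

/-- The operator of a gate on the whole register (identity on the other wires). -/
def Gate.op {W : Type} [Fintype W] [DecidableEq W] (g : Gate W) :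
    Matrix (W → Bool) (W → Bool) ℂ :=
  fun y z => if ∀ w, w ∉ g.wires → y w = z w
    then g.mat (fun w => y w) (fun w => z w) else 0

/-- Gates on pairwise disjoint wires, executed in one unit of parallel time. -/
structure Layer (W : Type) [DecidableEq W] where
  gates : List (Gate W)
  disjoint : gates.Pairwise (fun g h => Disjoint g.wires h.wires)

def Layer.op {W : Type} [Fintype W] [DecidableEq W] (L : Layer W) :
    Matrix (W → Bool) (W → Bool) ℂ :=
  (L.gates.map Gate.op).prod

/-- A circuit is a sequence of layers; the first layer acts first. -/
abbrev Circuit (W : Type) [DecidableEq W] : Type := List (Layer W)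

def Circuit.op {W : Type} [Fintype W] [DecidableEq W] :
    Circuit W → Matrix (W → Bool) (W → Bool) ℂ
  | [] => 1
  | L :: C => Circuit.op C * L.op

/-- Total number of gates. -/
def Circuit.size {W : Type} [DecidableEq W] (C : Circuit W) : ℕ :=
  (C.map (fun L => L.gates.length)).sum

/-- Parallel time: number of layers. -/
def Circuit.depth {W : Type} [DecidableEq W] (C : Circuit W) : ℕ := C.length

/-- The parallel times `d κ` are at most `T κ`, up to an additive term linear in `κ`: the class of
`T`-parallel-time adversaries is closed under adding linear-time work, so that it does not depend
on details of the gate set. -/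
def ParallelTime (T d : ℕ → ℕ) : Prop :=
  ∃ c : ℕ, ∀ κ : ℕ, d κ ≤ T κ + c * (κ + 1)

/-! ### Distinguishers -/

/-- A family of quantum machines `𝒜_κ` with advice states `|ψ_κ⟩`, which receive a register with
wires `I κ` and output one bit. The advice register also provides the work qubits. -/
structure Distinguisher (I : ℕ → Type) [∀ κ, Fintype (I κ)] [∀ κ, DecidableEq (I κ)] where
  adviceLen : ℕ → ℕ
  advice : ∀ κ, Vec (Fin (adviceLen κ))
  advice_norm : ∀ κ, normSq (advice κ) = 1
  circ : ∀ κ, Circuit (I κ ⊕ Fin (adviceLen κ))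
  out : ∀ κ, I κ ⊕ Fin (adviceLen κ)

section
variable {I : ℕ → Type} [∀ κ, Fintype (I κ)] [∀ κ, DecidableEq (I κ)]

/-- Polynomial size, polynomial-size advice. -/
def Distinguisher.QPT (A : Distinguisher I) : Prop :=
  PolyBounded A.adviceLen ∧ PolyBounded (fun κ => (A.circ κ).size)

/-- The distinguisher runs in parallel time `T`. -/
def Distinguisher.InTime (A : Distinguisher I) (T : ℕ → ℕ) : Prop :=
  ParallelTime T (fun κ => (A.circ κ).depth)

/-- `Pr[𝒜_κ(φ) = 1]`: run the circuit on `φ ⊗ ψ_κ`, measure the output wire. -/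
noncomputable def Distinguisher.prob (A : Distinguisher I) (κ : ℕ) (φ : Vec (I κ)) : ℝ :=
  ∑ z : I κ ⊕ Fin (A.adviceLen κ) → Bool,
    if z (A.out κ) = true
    then ‖Matrix.mulVec (Circuit.op (A.circ κ)) (tensor φ (A.advice κ)) z‖ ^ 2 else 0

end

/-! ### Polynomial time for classical algorithms -/

/-- Programs over a memory of stacks of bits. -/
inductive Cmd : Type
  | skip : Cmd
  | push (r : ℕ) (b : Bool) : Cmd
  | pop (r : ℕ) : Cmd
  | seq (p q : Cmd) : Cmd
  /-- branch on the top of stack `r`: `true`, `false`, or empty stack -/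
  | cond (r : ℕ) (p q e : Cmd) : Cmd
  /-- while stack `r` is not empty do `p` -/
  | loop (r : ℕ) (p : Cmd) : Cmd

abbrev Store : Type := ℕ → List Bool

/-- `Runs p s t s'`: started in memory `s`, the program `p` halts after `t` steps in `s'`. -/
inductive Runs : Cmd → Store → ℕ → Store → Prop
  | skip (s : Store) : Runs Cmd.skip s 1 s
  | push (r : ℕ) (b : Bool) (s : Store) :
      Runs (Cmd.push r b) s 1 (Function.update s r (b :: s r))
  | pop (r : ℕ) (s : Store) :
      Runs (Cmd.pop r) s 1 (Function.update s r (s r).tail)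
  | seq {p q : Cmd} {s s' s'' : Store} {t t' : ℕ} :
      Runs p s t s' → Runs q s' t' s'' → Runs (Cmd.seq p q) s (t + t') s''
  | cond_true {r : ℕ} {p q e : Cmd} {s s' : Store} {t : ℕ} :
      (s r).head? = some true → Runs p s t s' → Runs (Cmd.cond r p q e) s (t + 1) s'
  | cond_false {r : ℕ} {p q e : Cmd} {s s' : Store} {t : ℕ} :
      (s r).head? = some false → Runs q s t s' → Runs (Cmd.cond r p q e) s (t + 1) s'
  | cond_empty {r : ℕ} {p q e : Cmd} {s s' : Store} {t : ℕ} :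
      s r = [] → Runs e s t s' → Runs (Cmd.cond r p q e) s (t + 1) s'
  | loop_empty {r : ℕ} {p : Cmd} {s : Store} :
      s r = [] → Runs (Cmd.loop r p) s 1 s
  | loop_step {r : ℕ} {p : Cmd} {s s' s'' : Store} {t t' : ℕ} :
      s r ≠ [] → Runs p s t s' → Runs (Cmd.loop r p) s' t' s'' →
      Runs (Cmd.loop r p) s (t + t' + 1) s''

/-- One program turns `input i` into `output i` for all `i`, in time polynomial in the total
length of the input. Input strings are given on stacks `0, 1, …`, the other stacks being empty;
output strings are left on stacks `0, 1, …`. -/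
def PolyTime {ι : Type} (input output : ι → List (List Bool)) : Prop :=
  ∃ (p : Cmd) (q : Polynomial ℕ), ∀ i : ι, ∃ (t : ℕ) (s : Store),
    Runs p (fun j => (input i).getD j []) t s ∧
    t ≤ q.eval ((input i).map List.length).sum ∧
    ∀ j, j < (output i).length → s j = (output i).getD j []

/-- The string `1^κ`. -/
def unary (κ : ℕ) : List Bool := List.replicate κ true

/-! ### Instructions for honest quantum devices -/

/-- Instructions for a line of qubits with a head: move the head, or apply a gate to the qubit
under the head (`cnot`: with the next qubit as its target). -/
inductive QInstr : Type
  | left | right | x | h | t | cnot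

/-- Binary code of an instruction. -/
def QInstr.code : QInstr → List Bool
  | .left => [false, false, false]
  | .right => [false, false, true]
  | .x => [false, true, false]
  | .h => [false, true, true]
  | .t => [true, false, false]
  | .cnot => [true, false, true]

/-- The Hadamard matrix. -/
noncomputable def hadamard : Matrix Bool Bool ℂ :=
  fun a b => (if a = true ∧ b = true then -1 else 1) / (√2 : ℝ)

/-- The one-qubit matrix `M` on qubit `p` of `q` qubits (identity if `p` is out of range). -/
def oneQubit (q p : ℕ) (M : Matrix Bool Bool ℂ) : Matrix (Bits q) (Bits q) ℂ :=
  if hp : p < q then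
    fun y z => if ∀ j, j ≠ (⟨p, hp⟩ : Fin q) → y j = z j then M (y ⟨p, hp⟩) (z ⟨p, hp⟩) else 0
  else 1

/-- CNOT with control `p` and target `p + 1` (identity if out of range). -/
def cnotNext (q p : ℕ) : Matrix (Bits q) (Bits q) ℂ :=
  if hp : p + 1 < q then
    fun y z => if y = Function.update z ⟨p + 1, hp⟩ (z ⟨p + 1, hp⟩ ^^ z ⟨p, by omega⟩)
      then 1 else 0
  else 1

/-- The operator on `q` qubits of a list of instructions, the head starting at qubit `p`. -/
noncomputable def runInstr (q : ℕ) : ℕ → List QInstr → Matrix (Bits q) (Bits q) ℂ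
  | _, [] => 1
  | p, .left :: l => runInstr q (p - 1) l
  | p, .right :: l => runInstr q (p + 1) l
  | p, .x :: l => runInstr q p l * oneQubit q p (fun a b => if a = b then 0 else 1)
  | p, .h :: l => runInstr q p l * oneQubit q p hadamard
  | p, .t :: l => runInstr q p l * oneQubit q p
      (fun a b => if a = b then (if a = true then Complex.exp (Real.pi / 4 * Complex.I) else 1)
        else 0)
  | p, .cnot :: l => runInstr q p l * cnotNext q p

/-! ### Timed-release encryption -/

/-- A (classical) timed-release encryption scheme for messages of `msgLen κ` bits. The last
argument of `enc` and of `dec` is the string of random coins. -/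
structure TRE (msgLen : ℕ → ℕ) where
  coinLen : ℕ → ℕ
  decCoinLen : ℕ → ℕ
  ctLen : ℕ → ℕ
  enc : ∀ κ, Bits (msgLen κ) → Bits (coinLen κ) → Bits (ctLen κ)
  dec : ∀ κ, Bits (ctLen κ) → Bits (decCoinLen κ) → Bits (msgLen κ)

namespace TRE

variable {msgLen : ℕ → ℕ}

/-- Encryption and decryption are (uniform, probabilistic) polynomial-time algorithms. -/
def Efficient (S : TRE msgLen) : Prop :=
  PolyBounded S.coinLen ∧ PolyBounded S.decCoinLen ∧
  PolyTime (ι := Σ κ, Bits (msgLen κ) × Bits (S.coinLen κ))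
    (fun i => [unary i.1, List.ofFn i.2.1, List.ofFn i.2.2])
    (fun i => [List.ofFn (S.enc i.1 i.2.1 i.2.2)]) ∧
  PolyTime (ι := Σ κ, Bits (S.ctLen κ) × Bits (S.decCoinLen κ))
    (fun i => [unary i.1, List.ofFn i.2.1, List.ofFn i.2.2])
    (fun i => [List.ofFn (S.dec i.1 i.2.1 i.2.2)])

/-- Decryption succeeds except with negligible probability, for all messages. -/
def Correct (S : TRE msgLen) : Prop :=
  ∀ m : ∀ κ, Bits (msgLen κ),
    Negl (fun κ => avg (fun r => avg (fun r' =>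
      if S.dec κ (S.enc κ (m κ) r) r' = m κ then 0 else 1)))

/-- `T`-hiding: encryptions of any two messages are indistinguishable for non-uniform QPT
adversaries with parallel time `T`. -/
def Hiding (S : TRE msgLen) (T : ℕ → ℕ) : Prop :=
  ∀ (m₀ m₁ : ∀ κ, Bits (msgLen κ)) (A : Distinguisher (fun κ => Fin (S.ctLen κ))),
    A.QPT → A.InTime T →
    Negl (fun κ => |avg (fun r => A.prob κ (ket (S.enc κ (m₀ κ) r))) -
      avg (fun r => A.prob κ (ket (S.enc κ (m₁ κ) r)))|)

end TRE

/-! ### Revocable timed-release encryption -/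

/-- A timed-release encryption scheme for bits with quantum ciphertexts, and with classical
verification keys and deletion certificates. A ciphertext consists of a register of `qLen κ`
qubits and of `ctLen κ` classical bits. -/
structure RTRE where
  qLen : ℕ → ℕ
  ctLen : ℕ → ℕ
  vkLen : ℕ → ℕ
  certLen : ℕ → ℕ
  coinLen : ℕ → ℕ
  decCoinLen : ℕ → ℕ
  /-- encryption of a bit with given coins: quantum part, classical part, verification key -/
  encState : ∀ κ, Bool → Bits (coinLen κ) → Vec (Fin (qLen κ))
  encState_norm : ∀ κ b r, normSq (encState κ b r) = 1
  encCt : ∀ κ, Bool → Bits (coinLen κ) → Bits (ctLen κ)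
  encVk : ∀ κ, Bool → Bits (coinLen κ) → Bits (vkLen κ)
  /-- decryption: the quantum part is measured in the orthonormal basis formed by the columns
  of a unitary matrix, and the message is computed from the outcome -/
  decMeas : ∀ κ, Bits (ctLen κ) → Bits (decCoinLen κ) → Matrix.unitaryGroup (Bits (qLen κ)) ℂ
  decOut : ∀ κ, Bits (ctLen κ) → Bits (decCoinLen κ) → Bits (qLen κ) → Bool
  /-- deletion, in the same form -/
  delMeas : ∀ κ, Bits (ctLen κ) → Matrix.unitaryGroup (Bits (qLen κ)) ℂ
  delOut : ∀ κ, Bits (ctLen κ) → Bits (qLen κ) → Bits (certLen κ)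
  ver : ∀ κ, Bits (vkLen κ) → Bits (certLen κ) → Bool

/-- Probability of outcome `y` when `φ` is measured in the basis of the columns of `U`. -/
noncomputable def measProb {q : ℕ} (U : Matrix.unitaryGroup (Bits q) ℂ) (φ : Vec (Fin q))
    (y : Bits q) : ℝ :=
  ‖∑ z : Bits q, star ((U : Matrix (Bits q) (Bits q) ℂ) z y) * φ z‖ ^ 2

namespace RTRE

/-- The wires of the ciphertext register. -/
abbrev CtWires (R : RTRE) (κ : ℕ) : Type := Fin (R.qLen κ) ⊕ Fin (R.ctLen κ)

/-- The ciphertext, as a state on the ciphertext register. -/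
def ct (R : RTRE) (κ : ℕ) (b : Bool) (r : Bits (R.coinLen κ)) : Vec (R.CtWires κ) :=
  tensor (R.encState κ b r) (ket (R.encCt κ b r))

/-- All algorithms run in (uniform) polynomial time: classical polynomial-time computations that
output the sequence of elementary instructions by which quantum states are prepared from
`|0…0⟩`, or which precede a measurement in the computational basis. -/
def Efficient (R : RTRE) : Prop :=
  PolyBounded R.qLen ∧ PolyBounded R.coinLen ∧ PolyBounded R.decCoinLen ∧
  (∃ prep : ∀ κ, Bool → Bits (R.coinLen κ) → List QInstr,
    (∀ κ b r, Matrix.mulVec (runInstr (R.qLen κ) 0 (prep κ b r)) (ket (fun _ => false)) =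
      R.encState κ b r) ∧
    PolyTime (ι := Σ κ, Bool × Bits (R.coinLen κ))
      (fun i => [unary i.1, [i.2.1], List.ofFn i.2.2])
      (fun i => [(prep i.1 i.2.1 i.2.2).flatMap QInstr.code,
        List.ofFn (R.encCt i.1 i.2.1 i.2.2), List.ofFn (R.encVk i.1 i.2.1 i.2.2)])) ∧
  (∃ rot : ∀ κ, Bits (R.ctLen κ) → Bits (R.decCoinLen κ) → List QInstr,
    (∀ κ c r, runInstr (R.qLen κ) 0 (rot κ c r) =
      (R.decMeas κ c r : Matrix (Bits (R.qLen κ)) (Bits (R.qLen κ)) ℂ).conjTranspose) ∧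
    PolyTime (ι := Σ κ, Bits (R.ctLen κ) × Bits (R.decCoinLen κ))
      (fun i => [unary i.1, List.ofFn i.2.1, List.ofFn i.2.2])
      (fun i => [(rot i.1 i.2.1 i.2.2).flatMap QInstr.code])) ∧
  PolyTime (ι := Σ κ, Bits (R.ctLen κ) × Bits (R.decCoinLen κ) × Bits (R.qLen κ))
    (fun i => [unary i.1, List.ofFn i.2.1, List.ofFn i.2.2.1, List.ofFn i.2.2.2])
    (fun i => [[R.decOut i.1 i.2.1 i.2.2.1 i.2.2.2]]) ∧
  (∃ rot : ∀ κ, Bits (R.ctLen κ) → List QInstr,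
    (∀ κ c, runInstr (R.qLen κ) 0 (rot κ c) =
      (R.delMeas κ c : Matrix (Bits (R.qLen κ)) (Bits (R.qLen κ)) ℂ).conjTranspose) ∧
    PolyTime (ι := Σ κ, Bits (R.ctLen κ))
      (fun i => [unary i.1, List.ofFn i.2])
      (fun i => [(rot i.1 i.2).flatMap QInstr.code])) ∧
  PolyTime (ι := Σ κ, Bits (R.ctLen κ) × Bits (R.qLen κ))
    (fun i => [unary i.1, List.ofFn i.2.1, List.ofFn i.2.2])
    (fun i => [List.ofFn (R.delOut i.1 i.2.1 i.2.2)]) ∧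
  PolyTime (ι := Σ κ, Bits (R.vkLen κ) × Bits (R.certLen κ))
    (fun i => [unary i.1, List.ofFn i.2.1, List.ofFn i.2.2])
    (fun i => [[R.ver i.1 i.2.1 i.2.2]])

/-- Decryption succeeds except with negligible probability. -/
def Correct (R : RTRE) : Prop :=
  ∀ b : Bool, Negl (fun κ => avg (fun r => avg (fun r' =>
    ∑ y : Bits (R.qLen κ), if R.decOut κ (R.encCt κ b r) r' y = b then 0
      else measProb (R.decMeas κ (R.encCt κ b r) r') (R.encState κ b r) y)))

/-- Correctness of deletion: honestly produced certificates are rejected with negligible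
probability only. -/
def DeletionCorrect (R : RTRE) : Prop :=
  ∀ b : Bool, Negl (fun κ => avg (fun r =>
    ∑ y : Bits (R.qLen κ),
      if R.ver κ (R.encVk κ b r) (R.delOut κ (R.encCt κ b r) y) = true then 0
      else measProb (R.delMeas κ (R.encCt κ b r)) (R.encState κ b r) y))

/-- `T`-hiding. -/
def Hiding (R : RTRE) (T : ℕ → ℕ) : Prop :=
  ∀ A : Distinguisher R.CtWires, A.QPT → A.InTime T →
    Negl (fun κ => |avg (fun r => A.prob κ (R.ct κ false r)) -
      avg (fun r => A.prob κ (R.ct κ true r))|)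

/-- An adversary in the deletion experiments. It runs `circ₁` on the ciphertext and the advice;
`split` divides its wires into those which, measured in the computational basis, form the
certificate, and those of the residual register. In the second experiment it then runs `circ₂`
on the residual register and the verification result. -/
structure Adversary (R : RTRE) where
  adviceLen : ℕ → ℕ
  restLen : ℕ → ℕ
  advice : ∀ κ, Vec (Fin (adviceLen κ))
  advice_norm : ∀ κ, normSq (advice κ) = 1
  circ₁ : ∀ κ, Circuit (R.CtWires κ ⊕ Fin (adviceLen κ))
  split : ∀ κ, R.CtWires κ ⊕ Fin (adviceLen κ) ≃ Fin (R.certLen κ) ⊕ Fin (restLen κ)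
  circ₂ : ∀ κ, Circuit (Fin (restLen κ) ⊕ Unit)
  out : ∀ κ, Fin (restLen κ) ⊕ Unit

namespace Adversary

variable {R : RTRE}

def QPT (A : Adversary R) : Prop :=
  PolyBounded A.adviceLen ∧ PolyBounded (fun κ => (A.circ₁ κ).size + (A.circ₂ κ).size)

/-- The whole computation of the adversary takes parallel time `T`. -/
def InTime (A : Adversary R) (T : ℕ → ℕ) : Prop :=
  ParallelTime T (fun κ => (A.circ₁ κ).depth + (A.circ₂ κ).depth)

/-- The residual state that comes with certificate `x'` when bit `b` was encrypted with coins
`r`; its squared norm is the probability of this certificate. -/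
noncomputable def residual (A : Adversary R) (κ : ℕ) (b : Bool) (r : Bits (R.coinLen κ))
    (x' : Bits (R.certLen κ)) : Vec (Fin (A.restLen κ)) :=
  fun u => Matrix.mulVec (Circuit.op (A.circ₁ κ)) (tensor (R.ct κ b r) (A.advice κ))
    (fun w => Sum.elim x' u (A.split κ w))

/-- The output of `EV-EXP(b)`, a density matrix: the residual register if the certificate is
accepted, the extra basis state `none` (the symbol `⊥`) otherwise. -/
noncomputable def evExp (A : Adversary R) (κ : ℕ) (b : Bool) :
    Matrix (Option (Bits (A.restLen κ))) (Option (Bits (A.restLen κ))) ℂ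
  | some u, some v =>
      (∑ r : Bits (R.coinLen κ), ∑ x' : Bits (R.certLen κ),
        if R.ver κ (R.encVk κ b r) x' = true
        then A.residual κ b r x' u * star (A.residual κ b r x' v) else 0) / 2 ^ R.coinLen κ
  | none, none =>
      ((avg (fun r => ∑ x' : Bits (R.certLen κ),
        if R.ver κ (R.encVk κ b r) x' = true then 0
        else normSq (A.residual κ b r x')) : ℝ) : ℂ)
  | some _, none => 0
  | none, some _ => 0

/-- `Pr[C-EXP(b) = 1]`. -/
noncomputable def cExp (A : Adversary R) (κ : ℕ) (b : Bool) : ℝ :=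
  avg (fun r => ∑ x' : Bits (R.certLen κ), ∑ z : Fin (A.restLen κ) ⊕ Unit → Bool,
    if z (A.out κ) = true
    then ‖Matrix.mulVec (Circuit.op (A.circ₂ κ))
      (tensor (A.residual κ b r x') (ket (fun _ => R.ver κ (R.encVk κ b r) x'))) z‖ ^ 2
    else 0)

end Adversary

/-- `T`-revocable hiding: after an accepted certificate the residual states are statistically
close, and the verification result does not help a `T`-parallel-time adversary. -/
def RevocablyHiding (R : RTRE) (T : ℕ → ℕ) : Prop :=
  ∀ A : Adversary R, A.QPT → A.InTime T →
    Negl (fun κ => traceDist (A.evExp κ false) (A.evExp κ true)) ∧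
    Negl (fun κ => |A.cExp κ false - A.cExp κ true|)

end RTRE

/-! ### The compiler -/

/-- The matrix whose column `x` is `|x⟩_θ`: qubit `i` holds `x i` in the computational basis if
`θ i = 0`, and in the Hadamard basis if `θ i = 1`. -/
noncomputable def bb84 {n : ℕ} (θ : Bits n) : Matrix (Bits n) (Bits n) ℂ :=
  fun y x => ∏ i, (if θ i = true then hadamard else 1) (y i) (x i)

theorem bb84_qubit (c : Bool) (a b : Bool) :
    ∑ y : Bool, star ((if c = true then hadamard else 1) y a) *
      (if c = true then hadamard else (1 : Matrix Bool Bool ℂ)) y b = if a = b then 1 else 0 := by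
  have h : ((√2 : ℝ) : ℂ) * ((√2 : ℝ) : ℂ) = 2 := by
    rw [← Complex.ofReal_mul, Real.mul_self_sqrt (by norm_num)]; norm_num
  have h0 : ((√2 : ℝ) : ℂ) ≠ 0 := by
    intro h'; rw [h'] at h; norm_num at h
  have hi : (((√2 : ℝ) : ℂ))⁻¹ * (((√2 : ℝ) : ℂ))⁻¹ = 1 / 2 := by
    rw [← mul_inv, h]; norm_num
  cases c <;> cases a <;> cases b <;>
    simp [hadamard, Matrix.one_apply, div_eq_mul_inv, hi] <;> norm_num

theorem bb84_mem {n : ℕ} (θ : Bits n) : bb84 θ ∈ Matrix.unitaryGroup (Bits n) ℂ := by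
  rw [Matrix.mem_unitaryGroup_iff']
  ext x x'
  rw [Matrix.mul_apply]
  have h : ∀ y : Bits n, (star (bb84 θ)) x y * bb84 θ y x' =
      ∏ i, (star ((if θ i = true then hadamard else 1) (y i) (x i)) *
        (if θ i = true then hadamard else (1 : Matrix Bool Bool ℂ)) (y i) (x' i)) := by
    intro y
    rw [Finset.prod_mul_distrib, Matrix.star_apply]
    simp only [bb84, star_prod]
  simp only [h]
  rw [← Fintype.piFinset_univ, ← Finset.prod_univ_sum (fun _ => Finset.univ)
    (fun i a => star ((if θ i = true then hadamard else 1) a (x i)) *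
        (if θ i = true then hadamard else (1 : Matrix Bool Bool ℂ)) a (x' i))]
  simp only [bb84_qubit, Matrix.one_apply]
  by_cases hx : x = x'
  · subst hx; simp
  · obtain ⟨i, hi⟩ := Function.ne_iff.mp hx
    rw [if_neg hx]
    exact Finset.prod_eq_zero (Finset.mem_univ i) (if_neg hi)

/-- The state `|x⟩_θ`. -/
noncomputable def bb84State {n : ℕ} (x θ : Bits n) : Vec (Fin n) := fun y => bb84 θ y x

theorem bb84State_norm {n : ℕ} (x θ : Bits n) : normSq (bb84State x θ) = 1 := by
  have h := congrFun (congrFun (Matrix.mem_unitaryGroup_iff'.mp (bb84_mem θ)) x) x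
  rw [Matrix.mul_apply, Matrix.one_apply_eq] at h
  have h2 : ((normSq (bb84State x θ) : ℝ) : ℂ) = 1 := by
    rw [← h, normSq, Complex.ofReal_sum]
    refine Finset.sum_congr rfl fun y _ => ?_
    rw [Matrix.star_apply, bb84State, Complex.star_def, ← Complex.normSq_eq_conj_mul_self,
      Complex.normSq_eq_norm_sq]
  exact_mod_cast h2

/-- `⊕_{i : θ i = 0} x i`. -/
def maskBit {n : ℕ} (x θ : Bits n) : Bool :=
  decide (Odd (Finset.univ.filter (fun i => θ i = false ∧ x i = true)).card)

/-- The three parts of the coins of the compiled encryption. -/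
def coinX {n m : ℕ} (r : Bits (n + n + m)) : Bits n :=
  fun i => r (Fin.castAdd m (Fin.castAdd n i))

def coinTheta {n m : ℕ} (r : Bits (n + n + m)) : Bits n :=
  fun i => r (Fin.castAdd m (Fin.natAdd n i))

def coinRest {n m : ℕ} (r : Bits (n + n + m)) : Bits m :=
  fun i => r (Fin.natAdd (n + n) i)

/-- The compiled scheme. Encryption of `b` samples `x, θ ← {0,1}^κ`; the ciphertext is
`|x⟩_θ` with an encryption of `(θ, b ⊕ ⊕_{i : θ i = 0} x i)`, the verification key is `(x, θ)`. -/
noncomputable def compile (S : TRE (fun κ => κ + 1)) : RTRE where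
  qLen κ := κ
  ctLen := S.ctLen
  vkLen κ := κ + κ
  certLen κ := κ
  coinLen κ := κ + κ + S.coinLen κ
  decCoinLen := S.decCoinLen
  encState _ _ r := bb84State (coinX r) (coinTheta r)
  encState_norm _ _ r := bb84State_norm (coinX r) (coinTheta r)
  encCt κ b r := S.enc κ (Fin.snoc (coinTheta r) (b ^^ maskBit (coinX r) (coinTheta r)))
    (coinRest r)
  encVk _ _ r := Fin.append (coinX r) (coinTheta r)
  decMeas κ c r := ⟨bb84 (fun i => S.dec κ c r (Fin.castSucc i)), bb84_mem _⟩
  decOut κ c r y := S.dec κ c r (Fin.last κ) ^^ maskBit y (fun i => S.dec κ c r (Fin.castSucc i))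
  delMeas _ _ := ⟨bb84 (fun _ => true), bb84_mem _⟩
  delOut _ _ y := y
  ver κ v x' := decide (∀ i : Fin κ, v (Fin.natAdd κ i) = true → v (Fin.castAdd κ i) = x' i)

end RevTRE

set_option linter.unusedSectionVars false


/-! ### Negligible functions, polynomial bounds, averages -/

namespace RevTRE

/-! ### Negligible functions -/

/-! Plain hiding is a direct reduction: for fixed `x` and `θ` the state `|x⟩_θ` can be put into the
advice, and only the encrypted message depends on `b`. Hiding against all non-uniform choices of a
parameter gives a bound uniform in it (`negl_uniform`), so averaging over `x` and `θ` costs nothing.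

For revocable hiding, fix the encrypted pair `(θ, b')`, the coins and the certificate `x'`. Since `b
= b' ⊕ mask`, the accepted parts of the two experiments differ by a sum over `x` with sign `(-1)^b'
(-1)^mask`. On a qubit with `θ i = 0` the sign produces `|0⟩⟨0| - |1⟩⟨1| = |+⟩⟨-| + |-⟩⟨+|`. Hence
the difference is a sum of terms `L |y⟩⟨ȳ| Lᴴ` in the Hadamard basis, where `ȳ` is `y` negated
wherever `θ` is zero (`sum_sgn_bb84State`, `ExpOps.sum_accept_sub`). Its trace norm is at most
`cross`, a sum of products of norms (`traceNorm_sum_vecMulVec_le`). The strings `y` and `ȳ` cannot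
both be close to `x'`: one of them is bad, i.e. differs from `x'` on at least half of the zeros of
`θ`. Weighted AM-GM bounds `cross` by the probability `badProb` of a bad certificate
(`ExpOps.Isometric.cross_le`). This last quantity concerns only a classical certificate produced in
bounded time. That is how computational hiding yields a statistical conclusion about the residual
register.

A certificate independent of `θ` at distance `d` from `y` agrees with `y` on the ones of a random
`θ` with probability `2^{-d}`, so bad certificates would be rare. To transfer this to encryptions of
`(θ, b')`, only parities of certificate bits are tested: a parity takes at most `κ` additional CNOT
layers, within the linear slack of the parallel time (`exists_negl_parity`). Conjunctions are
averages of parities, and the `s`-th power of the Hamming distance is a sum of `κ^s` conjunctions,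
so a Markov bound with the `s`-th moment gives `badProb = O(κ^{-s})` up to a negligible term, for
every `s` (`ExpOps.Isometric.badProb_le`).

In the experiment that reveals the verdict, a rejected run is a run with the verdict fixed to false
minus an accepted run with that verdict (`cExp_eq`). The full run is a distinguisher covered by
plain hiding, and the accepted terms are controlled by `cross`.

Correctness follows from orthonormality of the BB84 bases. Efficiency is shown by explicit stack
programs that call the programs of the given scheme on shifted stacks. -/

theorem Negl.mono {f g : ℕ → ℝ} (hg : Negl g) (h : ∀ n, 1 ≤ n → f n ≤ g n) : Negl f := by
  intro c
  obtain ⟨N, hN⟩ := hg c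
  exact ⟨N, fun n hn => (h n (by omega)).trans_lt (hN n hn)⟩

theorem Negl.const_mul {f : ℕ → ℝ} (hf : Negl f) {C : ℝ} (hC : 0 ≤ C) :
    Negl (fun n => C * f n) := by
  intro c
  obtain ⟨N, hN⟩ := hf (c + 1)
  obtain ⟨M, hM⟩ := exists_nat_gt C
  refine ⟨max N M, fun n hn => ?_⟩
  have h1 := hN n (lt_of_le_of_lt (le_max_left _ _) hn)
  have h2 : C < n := hM.trans (by exact_mod_cast lt_of_le_of_lt (le_max_right _ _) hn)
  have hn0 : (0 : ℝ) < n := hC.trans_lt h2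
  calc C * f n ≤ C * ((n : ℝ) ^ (c + 1))⁻¹ := mul_le_mul_of_nonneg_left h1.le hC
    _ < n * ((n : ℝ) ^ (c + 1))⁻¹ := mul_lt_mul_of_pos_right h2 (by positivity)
    _ = ((n : ℝ) ^ c)⁻¹ := by rw [pow_succ]; field_simp

theorem Negl.add {f g : ℕ → ℝ} (hf : Negl f) (hg : Negl g) : Negl (fun n => f n + g n) := by
  intro c
  obtain ⟨N, hN⟩ := (hf.const_mul zero_le_two) c
  obtain ⟨M, hM⟩ := (hg.const_mul zero_le_two) c
  refine ⟨max N M, fun n hn => ?_⟩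
  have h1 := hN n (lt_of_le_of_lt (le_max_left _ _) hn)
  have h2 := hM n (lt_of_le_of_lt (le_max_right _ _) hn)
  linarith

theorem Negl.pow_mul {f : ℕ → ℝ} (hf : Negl f) (s : ℕ) : Negl (fun n => (n : ℝ) ^ s * f n) := by
  intro c
  obtain ⟨N, hN⟩ := hf (s + c)
  refine ⟨N, fun n hn => ?_⟩
  have hn0 : (0 : ℝ) < n := by exact_mod_cast (by omega : 0 < n)
  calc (n : ℝ) ^ s * f n < (n : ℝ) ^ s * ((n : ℝ) ^ (s + c))⁻¹ :=
        mul_lt_mul_of_pos_left (hN n hn) (by positivity)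
    _ = ((n : ℝ) ^ c)⁻¹ := by rw [pow_add]; field_simp

/-- It suffices to bound `f` by arbitrary inverse powers up to negligible functions. -/
theorem negl_of_forall_pow {f : ℕ → ℝ}
    (h : ∀ s : ℕ, ∃ (C : ℝ) (g : ℕ → ℝ), Negl g ∧
      ∀ n : ℕ, 1 ≤ n → f n ≤ C * ((n : ℝ) ^ s)⁻¹ + g n) : Negl f := by
  intro c
  -- The extra power of `n` absorbs the constant, once `n` exceeds `2 * C`.
  obtain ⟨C, g, hg, hf⟩ := h (c + 1)
  obtain ⟨N, hN⟩ := (hg.const_mul zero_le_two) c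
  obtain ⟨M, hM⟩ := exists_nat_gt (2 * C)
  refine ⟨max N M, fun n hn => ?_⟩
  have h1 := hN n (lt_of_le_of_lt (le_max_left _ _) hn)
  have h2 : 2 * C < n := hM.trans (by exact_mod_cast lt_of_le_of_lt (le_max_right _ _) hn)
  have hn1 : 1 ≤ n := by omega
  have hn0 : (0 : ℝ) < n := by exact_mod_cast hn1
  have h3 : 2 * C * ((n : ℝ) ^ (c + 1))⁻¹ < n * ((n : ℝ) ^ (c + 1))⁻¹ :=
    mul_lt_mul_of_pos_right h2 (by positivity)
  have h4 : n * ((n : ℝ) ^ (c + 1))⁻¹ = ((n : ℝ) ^ c)⁻¹ := by rw [pow_succ]; field_simp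
  have h5 := hf n hn1
  linarith

/-- Choosing `C = n ^ s` keeps the first term negligible and makes the second an arbitrary inverse
power. -/
theorem negl_of_amgm {f P : ℕ → ℝ} {D E : ℝ} (hP : Negl P) (hE : 0 ≤ E)
    (h : ∀ n, ∀ C : ℝ, 0 < C → f n ≤ E * (C * P n) + D / C) : Negl f := by
  refine negl_of_forall_pow fun s => ⟨D, _, (hP.pow_mul s).const_mul hE, fun n hn => ?_⟩
  have hn0 : (0 : ℝ) < n := by exact_mod_cast hn
  have h1 := h n ((n : ℝ) ^ s) (by positivity)
  rw [div_eq_mul_inv] at h1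
  linarith

theorem negl_geometric {a : ℝ} (h0 : 0 ≤ a) (h1 : a < 1) : Negl (fun n => a ^ n) := by
  intro c
  have h := tendsto_pow_const_mul_const_pow_of_abs_lt_one c (r := a) (by rwa [abs_of_nonneg h0])
  obtain ⟨N, hN⟩ := Filter.eventually_atTop.mp (h.eventually (gt_mem_nhds zero_lt_one))
  refine ⟨N, fun n hn => ?_⟩
  have h2 := hN n hn.le
  have hn0 : (0 : ℝ) < n := by exact_mod_cast (by omega : 0 < n)
  rw [← one_div, lt_div_iff₀ (by positivity), mul_comm]
  exact h2

theorem negl_zero : Negl (fun _ => 0) := by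
  intro c
  refine ⟨0, fun n hn => ?_⟩
  have hn0 : (0 : ℝ) < n := by exact_mod_cast hn
  positivity

/-- A quantity that is negligible for every choice of a parameter is bounded by a negligible
function uniformly in the parameter. -/
theorem negl_uniform {Ω : ℕ → Type} [∀ κ, Fintype (Ω κ)] [∀ κ, Nonempty (Ω κ)]
    (f : ∀ κ, Ω κ → ℝ) (h : ∀ ω : ∀ κ, Ω κ, Negl (fun κ => f κ (ω κ))) :
    ∃ g : ℕ → ℝ, Negl g ∧ ∀ κ ω, f κ ω ≤ g κ := by
  -- The worst parameter at each `κ` forms a family to which `h` itself applies.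
  choose ω hω using fun κ => Finite.exists_max (f κ)
  exact ⟨_, h ω, hω⟩

/-! ### Polynomial bounds -/

theorem PolyBounded.mono {f g : ℕ → ℕ} (hg : PolyBounded g) (h : ∀ n, f n ≤ g n) :
    PolyBounded f := by
  obtain ⟨p, hp⟩ := hg
  exact ⟨p, fun n => (h n).trans (hp n)⟩

theorem PolyBounded.add {f g : ℕ → ℕ} (hf : PolyBounded f) (hg : PolyBounded g) :
    PolyBounded (fun n => f n + g n) := by
  obtain ⟨p, hp⟩ := hf
  obtain ⟨q, hq⟩ := hg
  exact ⟨p + q, fun n => by rw [Polynomial.eval_add]; exact add_le_add (hp n) (hq n)⟩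

theorem polyBounded_id : PolyBounded (fun n => n) := ⟨Polynomial.X, fun n => by simp⟩

theorem polyBounded_const (c : ℕ) : PolyBounded (fun _ => c) :=
  ⟨Polynomial.C c, fun n => by simp⟩

/-! ### Averages -/

theorem avg_mono {n : ℕ} {f g : Bits n → ℝ} (h : ∀ r, f r ≤ g r) : avg f ≤ avg g :=
  div_le_div_of_nonneg_right (Finset.sum_le_sum fun r _ => h r) (by positivity)

theorem avg_const {n : ℕ} (c : ℝ) : avg (fun _ : Bits n => c) = c := by
  simp [avg]

theorem avg_nonneg {n : ℕ} {f : Bits n → ℝ} (h : ∀ r, 0 ≤ f r) : 0 ≤ avg f :=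
  div_nonneg (Finset.sum_nonneg fun r _ => h r) (by positivity)

theorem avg_add {n : ℕ} (f g : Bits n → ℝ) :
    avg (fun r => f r + g r) = avg f + avg g := by
  simp [avg, Finset.sum_add_distrib, add_div]

theorem avg_sub {n : ℕ} (f g : Bits n → ℝ) :
    avg (fun r => f r - g r) = avg f - avg g := by
  simp [avg, Finset.sum_sub_distrib, sub_div]

theorem avg_mul_left {n : ℕ} (c : ℝ) (f : Bits n → ℝ) :
    avg (fun r => c * f r) = c * avg f := by
  simp [avg, ← Finset.mul_sum, mul_div_assoc]

theorem avg_mul_right {n : ℕ} (c : ℝ) (f : Bits n → ℝ) :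
    avg (fun r => f r * c) = avg f * c := by
  simp [avg, ← Finset.sum_mul, mul_div_right_comm]

theorem avg_sum {n : ℕ} {ι : Type*} (s : Finset ι) (f : Bits n → ι → ℝ) :
    avg (fun r => ∑ i ∈ s, f r i) = ∑ i ∈ s, avg (fun r => f r i) := by
  simp only [avg]
  rw [Finset.sum_comm, Finset.sum_div]

theorem abs_avg_le {n : ℕ} (f : Bits n → ℝ) : |avg f| ≤ avg (fun r => |f r|) := by
  rw [avg, abs_div, abs_of_nonneg (by positivity : (0 : ℝ) ≤ 2 ^ n)]
  exact div_le_div_of_nonneg_right (Finset.abs_sum_le_sum_abs _ _) (by positivity)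

/-- Sums over the coins of the compiled scheme. -/
theorem sum_coins {n m : ℕ} {M : Type*} [AddCommMonoid M] (f : Bits n → Bits n → Bits m → M) :
    ∑ r : Bits (n + n + m), f (coinX r) (coinTheta r) (coinRest r) =
      ∑ x, ∑ θ, ∑ r, f x θ r := by
  rw [← (Fin.appendEquiv (n + n) m).sum_comp, Fintype.sum_prod_type,
    ← (Fin.appendEquiv n n).sum_comp, Fintype.sum_prod_type]
  refine Finset.sum_congr rfl fun x _ => Finset.sum_congr rfl fun θ _ =>
    Finset.sum_congr rfl fun r _ => ?_
  congr 1 <;> ext i <;> simp [coinX, coinTheta, coinRest, Fin.appendEquiv, -Fin.natAdd_eq_addNat]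

theorem avg_coins {n m : ℕ} (f : Bits n → Bits n → Bits m → ℝ) :
    avg (fun r : Bits (n + n + m) => f (coinX r) (coinTheta r) (coinRest r)) =
      avg (fun x => avg (fun θ => avg (fun r => f x θ r))) := by
  simp only [avg, sum_coins, ← Finset.sum_div]
  rw [div_div, div_div, ← pow_add, ← pow_add]
  congr 2
  ring

end RevTRE

/-! ### Circuits as unitaries: embedding, relabelling, output probabilities, parities -/

namespace RevTRE

open Matrix Kronecker

/-! ### Operators on a part of a register -/

section Extend
variable {W V W' : Type} [Fintype W] [DecidableEq W] [Fintype V] [DecidableEq V]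
  [Fintype W'] [DecidableEq W']

/-- Basis states of a register divided into two parts. -/
def splitBits (e : W ⊕ V ≃ W') : (W' → Bool) ≃ (W → Bool) × (V → Bool) where
  toFun z := (fun w => z (e (Sum.inl w)), fun v => z (e (Sum.inr v)))
  invFun p := fun w' => Sum.elim p.1 p.2 (e.symm w')
  left_inv z := by
    funext w'
    obtain ⟨w | w, rfl⟩ := e.surjective w' <;> simp
  right_inv p := by simp

/-- The operator `M ⊗ 1`. -/
def extend (e : W ⊕ V ≃ W') (M : Matrix (W → Bool) (W → Bool) ℂ) :
    Matrix (W' → Bool) (W' → Bool) ℂ :=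
  (M ⊗ₖ (1 : Matrix (V → Bool) (V → Bool) ℂ)).submatrix (splitBits e) (splitBits e)

theorem extend_apply (e : W ⊕ V ≃ W') (M : Matrix (W → Bool) (W → Bool) ℂ) (y z : W' → Bool) :
    extend e M y z = if (splitBits e y).2 = (splitBits e z).2
      then M (splitBits e y).1 (splitBits e z).1 else 0 := by
  simp [extend, kroneckerMap_apply, one_apply]

theorem extend_mul (e : W ⊕ V ≃ W') (M N : Matrix (W → Bool) (W → Bool) ℂ) :
    extend e (M * N) = extend e M * extend e N := by
  rw [extend, extend, extend, submatrix_mul_equiv, ← mul_kronecker_mul, one_mul]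

theorem extend_one (e : W ⊕ V ≃ W') :
    extend e (1 : Matrix (W → Bool) (W → Bool) ℂ) = 1 := by
  rw [extend, one_kronecker_one, submatrix_one_equiv]

theorem extend_mem_unitaryGroup (e : W ⊕ V ≃ W') {M : Matrix (W → Bool) (W → Bool) ℂ}
    (hM : M ∈ unitaryGroup (W → Bool) ℂ) : extend e M ∈ unitaryGroup (W' → Bool) ℂ := by
  have h : star (extend e M) = extend e (star M) := by
    rw [star_eq_conjTranspose, star_eq_conjTranspose, extend, extend, conjTranspose_submatrix,
      conjTranspose_kronecker, conjTranspose_one]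
  rw [mem_unitaryGroup_iff, h, ← extend_mul, mem_unitaryGroup_iff.mp hM, extend_one]

/-- `M ⊗ 1` acts on each slice with fixed `V`-bits separately. This makes it possible to treat
untouched wires as classical. -/
theorem extend_mulVec (e : W ⊕ V ≃ W') (M : Matrix (W → Bool) (W → Bool) ℂ) (φ : Vec W')
    (u : W → Bool) (v : V → Bool) :
    (extend e M *ᵥ φ) ((splitBits e).symm (u, v)) =
      (M *ᵥ fun u' => φ ((splitBits e).symm (u', v))) u := by
  simp only [mulVec, dotProduct]
  rw [← (splitBits e).symm.sum_comp, Fintype.sum_prod_type]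
  refine Finset.sum_congr rfl fun u' _ => ?_
  simp [extend_apply, ite_mul]

end Extend

/-! ### Relabelling of circuits -/

section Map
variable {W V W' : Type} [Fintype W] [DecidableEq W] [Fintype V] [DecidableEq V]
  [Fintype W'] [DecidableEq W']

theorem submatrix_mem_unitaryGroup {X Y : Type} [Fintype X] [DecidableEq X] [Fintype Y]
    [DecidableEq Y] (e : Y ≃ X) {M : Matrix X X ℂ} (hM : M ∈ unitaryGroup X ℂ) :
    M.submatrix e e ∈ unitaryGroup Y ℂ := by
  rw [mem_unitaryGroup_iff, star_eq_conjTranspose, conjTranspose_submatrix, submatrix_mul_equiv,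
    ← star_eq_conjTranspose, mem_unitaryGroup_iff.mp hM, submatrix_one_equiv]

/-- The wires of a gate and their complement divide the register, so unitarity of the small matrix
passes to the whole operator. -/
theorem Gate.op_eq_extend (g : Gate W) :
    g.op = extend (Equiv.sumCompl (fun w => w ∈ g.wires)) g.mat := by
  ext y z
  rw [extend_apply, Gate.op]
  congr 1
  simp [splitBits, funext_iff]

theorem Gate.op_mem_unitaryGroup (g : Gate W) : g.op ∈ unitaryGroup (W → Bool) ℂ := by
  rw [g.op_eq_extend]
  exact extend_mem_unitaryGroup _ g.unitary

theorem Layer.op_mem_unitaryGroup (L : Layer W) : L.op ∈ unitaryGroup (W → Bool) ℂ := by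
  refine Submonoid.list_prod_mem _ fun M hM => ?_
  obtain ⟨g, -, rfl⟩ := List.mem_map.mp hM
  exact g.op_mem_unitaryGroup

theorem Circuit.op_mem_unitaryGroup (C : Circuit W) :
    Circuit.op C ∈ unitaryGroup (W → Bool) ℂ := by
  induction C with
  | nil => exact one_mem _
  | cons L C ih => exact mul_mem ih L.op_mem_unitaryGroup

theorem Circuit.op_append (C D : Circuit W) :
    Circuit.op (C ++ D) = Circuit.op D * Circuit.op C := by
  induction C with
  | nil => simp [Circuit.op]
  | cons L C ih =>
    change Circuit.op (C ++ D) * L.op = Circuit.op D * (Circuit.op C * L.op)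
    rw [ih, mul_assoc]

/-- The embedding of the first part of a divided register. -/
def inlEmb (e : W ⊕ V ≃ W') : W ↪ W' := ⟨fun w => e (Sum.inl w), fun a b h => by simpa using h⟩

/-- The assignments to the wires of a relabelled gate. -/
noncomputable def mapWires (e : W ⊕ V ≃ W') (s : Finset W) :
    (s.map (inlEmb e) → Bool) ≃ (s → Bool) :=
  Equiv.ofBijective (fun y w => y ⟨inlEmb e w.1, Finset.mem_map_of_mem _ w.2⟩) <| by
    constructor
    · intro y z h
      funext w
      obtain ⟨w, hw⟩ := w
      obtain ⟨v, hv, rfl⟩ := Finset.mem_map.mp hw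
      exact congrFun h ⟨v, hv⟩
    · intro y
      refine ⟨fun w => y ⟨(Finset.mem_map.mp w.2).choose,
        (Finset.mem_map.mp w.2).choose_spec.1⟩, funext fun w => congrArg y (Subtype.ext ?_)⟩
      have hw := Finset.mem_map_of_mem (inlEmb e) w.2
      exact (inlEmb e).injective (Finset.mem_map.mp hw).choose_spec.2

theorem inl_mem_map (e : W ⊕ V ≃ W') (s : Finset W) (w : W) :
    e (Sum.inl w) ∈ s.map (inlEmb e) ↔ w ∈ s := Finset.mem_map' (inlEmb e)

theorem inr_notMem_map (e : W ⊕ V ≃ W') (s : Finset W) (v : V) :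
    e (Sum.inr v) ∉ s.map (inlEmb e) := by
  rw [Finset.mem_map]
  rintro ⟨w, -, h⟩
  exact Sum.inl_ne_inr (e.injective h)

/-- A gate on a part of a register, as a gate on the whole register. -/
noncomputable def Gate.map (e : W ⊕ V ≃ W') (g : Gate W) : Gate W' where
  wires := g.wires.map (inlEmb e)
  card_le := by rw [Finset.card_map]; exact g.card_le
  mat := g.mat.submatrix (mapWires e g.wires) (mapWires e g.wires)
  unitary := by
    have h := submatrix_mem_unitaryGroup (mapWires e g.wires) g.unitary
    exact h

theorem Gate.op_map (e : W ⊕ V ≃ W') (g : Gate W) : (g.map e).op = extend e g.op := by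
  ext y z
  rw [extend_apply]
  by_cases h : (splitBits e y).2 = (splitBits e z).2
  · rw [if_pos h, Gate.op, Gate.op]
    refine if_congr ?_ rfl rfl
    constructor
    · intro h' w hw
      exact h' (e (Sum.inl w)) (mt (inl_mem_map e _ w).mp hw)
    · intro h' w' hw'
      obtain ⟨w | v, rfl⟩ := e.surjective w'
      · exact h' w (mt (inl_mem_map e _ w).mpr hw')
      · exact congrFun h v
  · rw [if_neg h, Gate.op, if_neg]
    intro h'
    refine h (funext fun v => h' (e (Sum.inr v)) (inr_notMem_map e _ v))

noncomputable def Layer.map (e : W ⊕ V ≃ W') (L : Layer W) : Layer W' where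
  gates := L.gates.map (Gate.map e)
  disjoint := by
    rw [List.pairwise_map]
    exact L.disjoint.imp fun h => (Finset.disjoint_map _).mpr h

theorem Layer.op_map (e : W ⊕ V ≃ W') (L : Layer W) : (L.map e).op = extend e L.op := by
  simp only [Layer.op, Layer.map, List.map_map]
  induction L.gates with
  | nil => simp [extend_one]
  | cons g l ih => simp [ih, extend_mul, Gate.op_map]

noncomputable def Circuit.map (e : W ⊕ V ≃ W') (C : Circuit W) : Circuit W' :=
  List.map (Layer.map e) C

theorem Circuit.op_map (e : W ⊕ V ≃ W') (C : Circuit W) :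
    Circuit.op (Circuit.map e C) = extend e (Circuit.op C) := by
  induction C with
  | nil => exact (extend_one e).symm
  | cons L C ih =>
    change Circuit.op (Circuit.map e C) * (L.map e).op = extend e (Circuit.op C * L.op)
    rw [ih, extend_mul, Layer.op_map]

theorem Circuit.size_map (e : W ⊕ V ≃ W') (C : Circuit W) : (Circuit.map e C).size = C.size := by
  simp [Circuit.size, Circuit.map, Layer.map, Function.comp_def]

theorem Circuit.depth_map (e : W ⊕ V ≃ W') (C : Circuit W) :
    (Circuit.map e C).depth = C.depth := by
  simp [Circuit.depth, Circuit.map]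

theorem Circuit.size_append (C D : Circuit W) : Circuit.size (C ++ D) = C.size + D.size := by
  simp [Circuit.size]

theorem Circuit.depth_append (C D : Circuit W) : Circuit.depth (C ++ D) = C.depth + D.depth := by
  simp [Circuit.depth]

/-! ### Norms and output probabilities -/

theorem normSq_nonneg (φ : Vec W) : 0 ≤ normSq φ := Finset.sum_nonneg fun _ _ => by positivity

theorem normSq_eq_dotProduct (φ : Vec W) : ((normSq φ : ℝ) : ℂ) = star φ ⬝ᵥ φ := by
  rw [normSq, Complex.ofReal_sum, dotProduct]
  refine Finset.sum_congr rfl fun z _ => ?_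
  rw [Pi.star_apply, Complex.star_def, ← Complex.normSq_eq_conj_mul_self,
    Complex.normSq_eq_norm_sq]

theorem normSq_mulVec {U : Matrix (W → Bool) (W → Bool) ℂ} (hU : U ∈ unitaryGroup (W → Bool) ℂ)
    (φ : Vec W) : normSq (U *ᵥ φ) = normSq φ := by
  have h : ((normSq (U *ᵥ φ) : ℝ) : ℂ) = ((normSq φ : ℝ) : ℂ) := by
    rw [normSq_eq_dotProduct, normSq_eq_dotProduct, star_mulVec, ← dotProduct_mulVec,
      mulVec_mulVec, ← star_eq_conjTranspose, mem_unitaryGroup_iff'.mp hU, one_mulVec]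
  exact_mod_cast h

theorem normSq_tensor (φ : Vec W) (ψ : Vec V) :
    normSq (tensor φ ψ) = normSq φ * normSq ψ := by
  simp only [normSq, tensor]
  rw [← (Equiv.sumArrowEquivProdArrow W V Bool).symm.sum_comp, Fintype.sum_prod_type,
    Finset.sum_mul_sum]
  simp [mul_pow, Equiv.sumArrowEquivProdArrow]

theorem normSq_ket (y : W → Bool) : normSq (ket y) = 1 := by
  simp [normSq, ket, apply_ite]

/-- The probability that wire `o` is `1` after the circuit `C` has been run on `φ`. -/
noncomputable def outProb (C : Circuit W) (o : W) (φ : Vec W) : ℝ :=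
  ∑ z : W → Bool, if z o = true then ‖(Circuit.op C *ᵥ φ) z‖ ^ 2 else 0

/-- Deferred measurement: wires that the circuit never touches may be measured beforehand, so the
probability is a sum over their values. -/
theorem outProb_map (e : W ⊕ V ≃ W') (C : Circuit W) (o : W) (φ : Vec W') :
    outProb (Circuit.map e C) (e (Sum.inl o)) φ =
      ∑ v : V → Bool, outProb C o (fun u => φ ((splitBits e).symm (u, v))) := by
  simp only [outProb, Circuit.op_map]
  rw [← (splitBits e).symm.sum_comp, Fintype.sum_prod_type, Finset.sum_comm]
  simp only [extend_mulVec]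
  simp [splitBits]

end Map

/-! ### Parity of a set of wires -/

section Parity
variable {W : Type} [Fintype W] [DecidableEq W]

/-- The permutation matrix of an involution is real, symmetric and its own inverse. -/
theorem involutive_mem_unitaryGroup {X : Type} [Fintype X] [DecidableEq X] {σ : X → X}
    (hσ : Function.Involutive σ) :
    Matrix.of (fun y z => if y = σ z then (1 : ℂ) else 0) ∈ unitaryGroup X ℂ := by
  rw [mem_unitaryGroup_iff]
  ext y z
  have h : ∀ a w : X, a = σ w ↔ w = σ a := fun a w =>
    ⟨fun h => by rw [h, hσ], fun h => by rw [h, hσ]⟩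
  rw [mul_apply, one_apply]
  rw [Finset.sum_congr rfl fun w _ => by
    rw [star_apply, of_apply, of_apply, if_congr (h y w) rfl rfl]]
  simp only [ite_mul, one_mul, zero_mul, Finset.sum_ite_eq', Finset.mem_univ, if_true, hσ y]
  simp [apply_ite star, eq_comm]

theorem xorUpdate_involutive {X : Type} [DecidableEq X] {c o : X} (h : c ≠ o) :
    Function.Involutive (fun z : X → Bool => Function.update z o (z o ^^ z c)) := by
  intro z
  simp [Function.update_of_ne h]

/-- Controlled negation of wire `o`. -/
def cnotGate (o : W) (c : {w : W // w ≠ o}) : Gate W where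
  wires := {c.1, o}
  card_le := Finset.card_le_two.trans (by norm_num)
  mat := Matrix.of fun y z =>
    if y = Function.update z ⟨o, by simp⟩ (z ⟨o, by simp⟩ ^^ z ⟨c.1, by simp⟩) then 1 else 0
  unitary := by
    have h : (⟨c.1, by simp⟩ : ({c.1, o} : Finset W)) ≠ ⟨o, by simp⟩ := by
      simpa [Subtype.ext_iff] using c.2
    have h2 := involutive_mem_unitaryGroup (xorUpdate_involutive h)
    exact h2

theorem cnotGate_mulVec (o : W) (c : {w : W // w ≠ o}) (φ : Vec W) (z : W → Bool) :
    ((cnotGate o c).op *ᵥ φ) z = φ (Function.update z o (z o ^^ z c)) := by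
  have h : ∀ y, (cnotGate o c).op z y =
      if y = Function.update z o (z o ^^ z c) then 1 else 0 := by
    intro y
    have hi := xorUpdate_involutive c.2
    have h1 : y = Function.update z o (z o ^^ z c) ↔ z = Function.update y o (y o ^^ y c) :=
      ⟨fun h => by rw [h]; exact (hi z).symm, fun h => by rw [h]; exact (hi y).symm⟩
    -- The condition on the wires of the gate and the identity on all others combine into one update
    -- of the whole string.
    have key : ((∀ w, w ∉ (cnotGate o c).wires → z w = y w) ∧
        (fun w : (cnotGate o c).wires => z w) =
          Function.update (fun w : (cnotGate o c).wires => y w)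
            ⟨o, by simp [cnotGate]⟩ (y o ^^ y c)) ↔ z = Function.update y o (y o ^^ y c) := by
      refine ⟨fun ⟨h2, h3⟩ => funext fun w => ?_, fun h2 => ⟨fun w hw => ?_, ?_⟩⟩
      · by_cases hw : w ∈ (cnotGate o c).wires
        · have h4 := congrFun h3 ⟨w, hw⟩
          simp only [Function.update_apply, Subtype.ext_iff] at h4 ⊢
          exact h4
        · rw [h2 w hw, Function.update_of_ne]
          rintro rfl
          simp [cnotGate] at hw
      · rw [h2, Function.update_of_ne]
        rintro rfl
        simp [cnotGate] at hw
      · funext w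
        rw [h2]
        simp [Function.update_apply, Subtype.ext_iff]
    rw [if_congr h1 rfl rfl, Gate.op]
    by_cases hR : z = Function.update y o (y o ^^ y c)
    · rw [if_pos hR, if_pos (key.mpr hR).1]
      exact if_pos (key.mpr hR).2
    · rw [if_neg hR]
      split_ifs with ha
      · exact if_neg fun hb => hR (key.mp ⟨ha, hb⟩)
      · rfl
  simp [mulVec, dotProduct, h]

/-- Adds the parity of a list of wires to wire `o`. -/
def parityCircuit (o : W) (l : List {w : W // w ≠ o}) : Circuit W :=
  l.map fun c => ⟨[cnotGate o c], List.pairwise_singleton _ _⟩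

def listParity {W : Type} (z : W → Bool) (l : List W) : Bool :=
  l.foldr (fun w a => z w ^^ a) false

/-- All gates have the same target and no control equals it. The controls therefore never change,
and their bits accumulate on `o`. -/
theorem parityCircuit_mulVec (o : W) (l : List {w : W // w ≠ o}) (φ : Vec W) (z : W → Bool) :
    (Circuit.op (parityCircuit o l) *ᵥ φ) z =
      φ (Function.update z o (z o ^^ listParity z (l.map Subtype.val))) := by
  induction l generalizing φ z with
  | nil => simp [parityCircuit, Circuit.op, listParity]
  | cons c l ih =>
    have h : Circuit.op (parityCircuit o (c :: l)) =
        Circuit.op (parityCircuit o l) * (cnotGate o c).op := by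
      simp [parityCircuit, Circuit.op, Layer.op]
    rw [h, ← mulVec_mulVec, ih, cnotGate_mulVec]
    simp only [Function.update_self, Function.update_of_ne c.2, Function.update_idem,
      listParity, List.map_cons, List.foldr_cons]
    congr 2
    rw [Bool.xor_assoc, Bool.xor_comm (z c.1)]

theorem parityCircuit_size (o : W) (l : List {w : W // w ≠ o}) :
    (parityCircuit o l).size = l.length := by
  simp [parityCircuit, Circuit.size, Function.comp_def]

theorem parityCircuit_depth (o : W) (l : List {w : W // w ≠ o}) :
    (parityCircuit o l).depth = l.length := by
  simp [parityCircuit, Circuit.depth]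

end Parity

end RevTRE

/-! ### Trace norm -/

namespace RevTRE

open Matrix
open scoped ComplexOrder

/-! ### Trace norm of sums of rank-one matrices -/

section TraceNorm
variable {X : Type} [Fintype X] [DecidableEq X]

/-- Cauchy-Schwarz followed by Bessel's inequality for each family. Orthonormality is demanded on
`s` only, because singular vectors can be normalised only at nonzero singular values. -/
theorem sum_inner_mul_inner_le {E ι : Type*} [NormedAddCommGroup E] [InnerProductSpace ℂ E]
    (s : Finset ι) (f w : ι → E) (hf : Orthonormal ℂ (fun i : s => f i))
    (hw : Orthonormal ℂ (fun i : s => w i)) (u v : E) :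
    ∑ i ∈ s, ‖inner ℂ (f i) u‖ * ‖inner ℂ (w i) v‖ ≤ ‖u‖ * ‖v‖ := by
  have h : ∀ (g : ι → E) (_ : Orthonormal ℂ (fun i : s => g i)) (x : E),
      ∑ i ∈ s, ‖inner ℂ (g i) x‖ ^ 2 ≤ ‖x‖ ^ 2 := by
    intro g hg x
    have h := hg.sum_inner_products_le x (s := Finset.univ)
    rwa [Finset.sum_coe_sort s (fun i => ‖inner ℂ (g i) x‖ ^ 2)] at h
  refine (Real.sum_mul_le_sqrt_mul_sqrt s _ _).trans ?_
  exact mul_le_mul ((Real.sqrt_le_left (norm_nonneg _)).mpr (h f hf u))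
    ((Real.sqrt_le_left (norm_nonneg _)).mpr (h w hw v)) (Real.sqrt_nonneg _) (norm_nonneg _)

/-- Singular value decomposition: with unit eigenvectors `w i` of `Mᴴ * M` and the normalised images
`f i` of `w i` under `M`, each nonzero singular value is `⟨f i, M (w i)⟩`. Expanding `M` into
rank-one terms leaves, for each `k`, a sum over `i` of products of coefficients of `u k` and `v k`.
-/
theorem traceNorm_sum_vecMulVec_le {ι : Type*} (s : Finset ι) (u v : ι → X → ℂ) :
    traceNorm (∑ k ∈ s, vecMulVec (u k) (star (v k))) ≤
      ∑ k ∈ s, ‖WithLp.toLp 2 (u k)‖ * ‖WithLp.toLp 2 (v k)‖ := by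
  set M : Matrix X X ℂ := ∑ k ∈ s, vecMulVec (u k) (star (v k)) with hM
  set hH := isHermitian_conjTranspose_mul_self M
  set w : X → EuclideanSpace ℂ X := fun i => hH.eigenvectorBasis i with hw
  have hwo : Orthonormal ℂ w := hH.eigenvectorBasis.orthonormal
  set lam : X → ℝ := hH.eigenvalues
  have hlam : ∀ i, 0 ≤ lam i := (posSemidef_conjTranspose_mul_self M).eigenvalues_nonneg
  set T : X → EuclideanSpace ℂ X := fun i => WithLp.toLp 2 (M *ᵥ (w i).ofLp) with hT
  -- The images of the eigenvectors remain orthogonal, with squared norms the eigenvalues.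
  have hin : ∀ i j, inner ℂ (T i) (T j) = if i = j then (lam i : ℂ) else 0 := by
    intro i j
    have h1 : inner ℂ (T i) (T j) = inner ℂ (w i) (WithLp.toLp 2 ((Mᴴ * M) *ᵥ (w j).ofLp)) := by
      simp only [hT, EuclideanSpace.inner_eq_star_dotProduct]
      rw [star_mulVec, ← mulVec_mulVec, dotProduct_comm, ← dotProduct_mulVec, dotProduct_comm]
    have h2 : (Mᴴ * M) *ᵥ (w j).ofLp = (lam j : ℂ) • (w j).ofLp := hH.mulVec_eigenvectorBasis j
    rw [h1, h2, WithLp.toLp_smul, inner_smul_right, orthonormal_iff_ite.mp hwo]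
    split_ifs with h
    · simp [h]
    · simp
  -- Zero eigenvalues do not contribute to the trace norm, and their images cannot be normalised.
  set P : Finset X := Finset.univ.filter (fun i => 0 < lam i)
  have hP : traceNorm M = ∑ i ∈ P, √(lam i) := by
    rw [traceNorm]
    refine (Finset.sum_filter_of_ne fun i _ hi => ?_).symm
    by_contra h
    exact hi (Real.sqrt_eq_zero'.mpr (not_lt.mp h))
  set f : X → EuclideanSpace ℂ X := fun i => ((√(lam i) : ℝ) : ℂ)⁻¹ • T i with hf
  have hfo : Orthonormal ℂ (fun i : P => f i) := by
    rw [orthonormal_iff_ite]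
    intro i j
    have hi : 0 < lam i := (Finset.mem_filter.mp i.2).2
    simp only [hf, inner_smul_left, inner_smul_right, hin, Subtype.ext_iff]
    split_ifs with h
    · rw [← h, map_inv₀, Complex.conj_ofReal, ← mul_assoc, ← mul_inv, ← Complex.ofReal_mul,
        Real.mul_self_sqrt hi.le, inv_mul_cancel₀]
      exact_mod_cast hi.ne'
    · simp
  have hval : ∀ i ∈ P, √(lam i) ≤ ∑ k ∈ s, ‖inner ℂ (f i) (WithLp.toLp 2 (u k))‖ *
      ‖inner ℂ (w i) (WithLp.toLp 2 (v k))‖ := by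
    intro i hi
    have hi : 0 < lam i := (Finset.mem_filter.mp hi).2
    have h1 : ((√(lam i) : ℝ) : ℂ) = inner ℂ (f i) (T i) := by
      rw [hf, inner_smul_left, hin, if_pos rfl, map_inv₀, Complex.conj_ofReal]
      have h2 : (lam i : ℂ) = ((√(lam i) : ℝ) : ℂ) * ((√(lam i) : ℝ) : ℂ) := by
        rw [← Complex.ofReal_mul, Real.mul_self_sqrt hi.le]
      have h3 : ((√(lam i) : ℝ) : ℂ) ≠ 0 := by exact_mod_cast (Real.sqrt_pos.mpr hi).ne'
      rw [h2, inv_mul_cancel_left₀ h3]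
    have h2 : T i = ∑ k ∈ s, inner ℂ (WithLp.toLp 2 (v k)) (w i) • WithLp.toLp 2 (u k) := by
      simp only [hT]
      rw [hM, Matrix.sum_mulVec, WithLp.toLp_sum]
      refine Finset.sum_congr rfl fun k _ => ?_
      rw [vecMulVec_mulVec, ← WithLp.toLp_smul]
      congr 1
      ext x
      simp [EuclideanSpace.inner_eq_star_dotProduct, dotProduct_comm, mul_comm]
    have h3 : ‖((√(lam i) : ℝ) : ℂ)‖ = √(lam i) := by
      rw [Complex.norm_real, Real.norm_of_nonneg (Real.sqrt_nonneg _)]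
    rw [← h3, h1, h2, inner_sum]
    refine (norm_sum_le _ _).trans (Finset.sum_le_sum fun k _ => ?_)
    rw [inner_smul_right, norm_mul, mul_comm, norm_inner_symm (WithLp.toLp 2 (v k))]
  rw [hP]
  refine (Finset.sum_le_sum hval).trans ?_
  rw [Finset.sum_comm]
  refine Finset.sum_le_sum fun k _ => ?_
  exact sum_inner_mul_inner_le P f w hfo (hwo.comp _ Subtype.val_injective) _ _

end TraceNorm

end RevTRE

/-! ### The deletion experiment: from residual states to bad certificates -/

namespace RevTRE

open Matrix

/-! ### Signs, masks, and flipped strings -/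

/-- `(-1)^b`. -/
def sgn (b : Bool) : ℝ := if b = true then -1 else 1

theorem sgn_xor (a b : Bool) : sgn (a ^^ b) = sgn a * sgn b := by
  cases a <;> cases b <;> simp [sgn]

theorem abs_sgn (a : Bool) : |sgn a| = 1 := by
  cases a <;> simp [sgn]

theorem sum_prod_bits {n : ℕ} {R : Type*} [CommSemiring R] (g : Fin n → Bool → R) :
    ∑ x : Bits n, ∏ i, g i (x i) = ∏ i, ∑ a, g i a := by
  rw [Finset.prod_univ_sum, Fintype.piFinset_univ]

/-- The product form lets sums over `x` factor over the qubits. -/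
theorem sgn_maskBit {n : ℕ} (x θ : Bits n) :
    sgn (maskBit x θ) = ∏ i, if θ i = false ∧ x i = true then -1 else 1 := by
  rw [Finset.prod_ite, Finset.prod_const, Finset.prod_const_one, mul_one, sgn, maskBit]
  by_cases h : Odd (Finset.univ.filter (fun i => θ i = false ∧ x i = true)).card
  · simp [h, h.neg_one_pow]
  · simp [h, (Nat.not_odd_iff_even.mp h).neg_one_pow]

/-- The strings that agree with `x'` at the positions `i` with `θ i = 1`. -/
def agreeSet {n : ℕ} (θ x' : Bits n) : Finset (Bits n) :=
  Finset.univ.filter fun y => ∀ i, θ i = true → y i = x' i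

theorem mem_agreeSet {n : ℕ} {θ x' y : Bits n} :
    y ∈ agreeSet θ x' ↔ ∀ i, θ i = true → y i = x' i := by
  simp [agreeSet]

/-- Negates the bits of `y` at the positions `i` with `θ i = 0`. -/
def flipBits {n : ℕ} (θ y : Bits n) : Bits n := fun i => y i ^^ !θ i

theorem flipBits_flipBits {n : ℕ} (θ y : Bits n) : flipBits θ (flipBits θ y) = y := by
  funext i
  simp [flipBits]

theorem flipBits_mem_agreeSet {n : ℕ} {θ x' y : Bits n} (h : y ∈ agreeSet θ x') :
    flipBits θ y ∈ agreeSet θ x' := by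
  rw [mem_agreeSet] at h ⊢
  intro i hi
  simp [flipBits, hi, h i hi]

theorem sum_agreeSet_flipBits {n : ℕ} {M : Type*} [AddCommMonoid M] (θ x' : Bits n)
    (f : Bits n → M) :
    ∑ y ∈ agreeSet θ x', f (flipBits θ y) = ∑ y ∈ agreeSet θ x', f y :=
  Finset.sum_nbij' (flipBits θ) (flipBits θ) (fun _ h => flipBits_mem_agreeSet h)
    (fun _ h => flipBits_mem_agreeSet h) (fun _ _ => flipBits_flipBits _ _)
    (fun _ _ => flipBits_flipBits _ _) (fun _ _ => rfl)

/-- The state of a string in the Hadamard basis. -/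
noncomputable def hadState {n : ℕ} (y : Bits n) : Vec (Fin n) := bb84State y (fun _ => true)

/-- For `c = false` this is the identity `|0⟩⟨0| - |1⟩⟨1| = |+⟩⟨-| + |-⟩⟨+|`. For `c = true` both
sides are the projector onto the Hadamard state of `x'`. -/
theorem bb84_flip_qubit (c x' z z' : Bool) :
    (∑ a : Bool, (if c = true → a = x' then (1 : ℂ) else 0) *
      ((if c = false ∧ a = true then -1 else 1) * ((if c = true then hadamard else 1) z a *
        star ((if c = true then hadamard else (1 : Matrix Bool Bool ℂ)) z' a)))) =
    ∑ a : Bool, (if c = true → a = x' then (1 : ℂ) else 0) *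
      (hadamard z a * star (hadamard z' (a ^^ !c))) := by
  have h : ((√2 : ℝ) : ℂ) * ((√2 : ℝ) : ℂ) = 2 := by
    rw [← Complex.ofReal_mul, Real.mul_self_sqrt (by norm_num)]; norm_num
  have h0 : ((√2 : ℝ) : ℂ) ≠ 0 := by
    intro h'; rw [h'] at h; norm_num at h
  have hi : (((√2 : ℝ) : ℂ))⁻¹ * (((√2 : ℝ) : ℂ))⁻¹ = 1 / 2 := by
    rw [← mul_inv, h]; norm_num
  cases c
  · cases z <;> cases z' <;>
      simp [hadamard, Matrix.one_apply, div_eq_mul_inv, hi] <;> norm_num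
  · cases x' <;> simp

/-- With the phase `(-1)^⊕x`, the mixture of the states `|x⟩⟨x|_θ` compatible with a certificate
is off-diagonal in the Hadamard basis. -/
theorem sum_sgn_bb84State {n : ℕ} (θ x' : Bits n) :
    ∑ x ∈ agreeSet θ x', ((sgn (maskBit x θ) : ℝ) : ℂ) •
      vecMulVec (bb84State x θ) (star (bb84State x θ)) =
    ∑ y ∈ agreeSet θ x', vecMulVec (hadState y) (star (hadState (flipBits θ y))) := by
  ext z z'
  have ind : ∀ x : Bits n, (∏ i, if θ i = true → x i = x' i then (1 : ℂ) else 0) =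
      if ∀ i, θ i = true → x i = x' i then 1 else 0 := fun x => by
    rw [Finset.prod_ite_zero]
    simp
  simp only [Matrix.sum_apply, Matrix.smul_apply, vecMulVec_apply, smul_eq_mul, Pi.star_apply,
    agreeSet, Finset.sum_filter, hadState, bb84State, bb84, star_prod, sgn_maskBit,
    Complex.ofReal_prod, ← Finset.prod_mul_distrib]
  -- The product over all qubits of the one-qubit identity, expanded on both sides into sums over
  -- strings.
  have h := Finset.prod_congr (rfl : (Finset.univ : Finset (Fin n)) = _)
    fun i _ => bb84_flip_qubit (θ i) (x' i) (z i) (z' i)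
  rw [← sum_prod_bits (fun i a => (if θ i = true → a = x' i then (1 : ℂ) else 0) *
      ((if θ i = false ∧ a = true then -1 else 1) * ((if θ i = true then hadamard else 1) (z i) a *
        star ((if θ i = true then hadamard else (1 : Matrix Bool Bool ℂ)) (z' i) a)))),
    ← sum_prod_bits (fun i a => (if θ i = true → a = x' i then (1 : ℂ) else 0) *
      (hadamard (z i) a * star (hadamard (z' i) (a ^^ !θ i))))] at h
  simp only [Finset.prod_mul_distrib] at h
  simp only [ind, ite_mul, one_mul, zero_mul] at h
  simp only [Finset.prod_mul_distrib, if_true, flipBits]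
  refine Eq.trans (Finset.sum_congr rfl fun x _ => ?_) h
  refine if_congr Iff.rfl ?_ rfl
  congr 1
  refine Finset.prod_congr rfl fun i _ => ?_
  split_ifs <;> simp

theorem normSq_hadState {n : ℕ} (y : Bits n) : normSq (hadState y) = 1 := bb84State_norm _ _

/-! ### The deletion experiment for a fixed security parameter -/

/-- The Euclidean norm. -/
noncomputable def nrm {W : Type} [Fintype W] [DecidableEq W] (φ : Vec W) : ℝ := √(normSq φ)

theorem nrm_nonneg {W : Type} [Fintype W] [DecidableEq W] (φ : Vec W) : 0 ≤ nrm φ :=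
  Real.sqrt_nonneg _

theorem nrm_sq {W : Type} [Fintype W] [DecidableEq W] (φ : Vec W) : nrm φ ^ 2 = normSq φ :=
  Real.sq_sqrt (normSq_nonneg φ)

theorem norm_toLp {X : Type} [Fintype X] (φ : X → ℂ) :
    ‖WithLp.toLp 2 φ‖ = √(∑ z, ‖φ z‖ ^ 2) := by
  rw [EuclideanSpace.norm_eq]

section Experiment
variable {n m ρ : ℕ}

/-- The experiment is described by the operators `L θ b' r x'` that map the state of the quantum
part of the ciphertext to the residual state with certificate `x'`, when the classical part is an
encryption of `(θ, b')` with coins `r`. -/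
abbrev ExpOps (n m ρ : ℕ) : Type :=
  Bits n → Bool → Bits m → Bits n → Matrix (Bits ρ) (Bits n) ℂ

namespace ExpOps
variable (L : ExpOps n m ρ)

/-- The residual state with certificate `x'` for the bit `b` and coins `r`. -/
noncomputable def state (b : Bool) (r : Bits (n + n + m)) (x' : Bits n) : Vec (Fin ρ) :=
  L (coinTheta r) (b ^^ maskBit (coinX r) (coinTheta r)) (coinRest r) x' *ᵥ
    bb84State (coinX r) (coinTheta r)

/-- The sum of the norms of the off-diagonal terms. -/
noncomputable def cross : ℝ :=
  (∑ b, ∑ θ, ∑ r, ∑ x', ∑ y ∈ agreeSet θ x',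
    nrm (L θ b r x' *ᵥ hadState y) * nrm (L θ b r x' *ᵥ hadState (flipBits θ y))) /
    2 ^ (n + n + m)

theorem vecMulVec_mulVec_mulVec (K : Matrix (Bits ρ) (Bits n) ℂ) (φ ψ : Vec (Fin n)) :
    vecMulVec (K *ᵥ φ) (star (K *ᵥ ψ)) = K * vecMulVec φ (star ψ) * Kᴴ := by
  rw [mul_vecMulVec, vecMulVec_mul, star_mulVec]

/-- The difference of the accepted parts of the two experiments. -/
theorem sum_accept_sub :
    (∑ r, ∑ x', if x' ∈ agreeSet (coinTheta r) (coinX r) then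
      vecMulVec (L.state false r x') (star (L.state false r x')) else 0) -
    (∑ r, ∑ x', if x' ∈ agreeSet (coinTheta r) (coinX r) then
      vecMulVec (L.state true r x') (star (L.state true r x')) else 0) =
    ∑ b, ∑ θ, ∑ r, ∑ x', ∑ y ∈ agreeSet θ x', ((sgn b : ℝ) : ℂ) •
      vecMulVec (L θ b r x' *ᵥ hadState y) (star (L θ b r x' *ᵥ hadState (flipBits θ y))) := by
  -- Conjugation by `L θ b r x'` is linear, so the identity for BB84 mixtures can be applied inside
  -- it. Agreement of `x` and `x'` where `θ` is one is symmetric, so acceptance restricts `x` to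
  -- `agreeSet θ x'`.
  have h1 : ∀ b θ r x', ∑ y ∈ agreeSet θ x', ((sgn b : ℝ) : ℂ) •
      vecMulVec (L θ b r x' *ᵥ hadState y) (star (L θ b r x' *ᵥ hadState (flipBits θ y))) =
      ∑ x, if x' ∈ agreeSet θ x then ((sgn b : ℝ) : ℂ) • ((sgn (maskBit x θ) : ℝ) : ℂ) •
        vecMulVec (L θ b r x' *ᵥ bb84State x θ) (star (L θ b r x' *ᵥ bb84State x θ)) else 0 := by
    intro b θ r x'
    have h2 : ∀ x : Bits n, x' ∈ agreeSet θ x ↔ x ∈ agreeSet θ x' := fun x => by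
      simp only [mem_agreeSet, eq_comm]
    simp only [h2]
    rw [← Finset.sum_filter, Finset.filter_mem_eq_inter, Finset.univ_inter, ← Finset.smul_sum,
      ← Finset.smul_sum]
    have h3 : ∀ (c : ℂ) (M : Matrix (Bits n) (Bits n) ℂ),
        c • (L θ b r x' * M * (L θ b r x')ᴴ) = L θ b r x' * (c • M) * (L θ b r x')ᴴ := by
      intro c M
      rw [Matrix.mul_smul, Matrix.smul_mul]
    simp only [vecMulVec_mulVec_mulVec, h3]
    rw [← Matrix.sum_mul, ← Matrix.mul_sum, ← Matrix.sum_mul, ← Matrix.mul_sum,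
      sum_sgn_bb84State]
  simp only [h1]
  rw [← Finset.sum_sub_distrib]
  simp only [← Finset.sum_sub_distrib]
  have h3 := sum_coins (n := n) (m := m) fun x θ r => ∑ x', ((if x' ∈ agreeSet θ x then
      vecMulVec (L θ (false ^^ maskBit x θ) r x' *ᵥ bb84State x θ)
        (star (L θ (false ^^ maskBit x θ) r x' *ᵥ bb84State x θ)) else 0) -
      (if x' ∈ agreeSet θ x then
      vecMulVec (L θ (true ^^ maskBit x θ) r x' *ᵥ bb84State x θ)
        (star (L θ (true ^^ maskBit x θ) r x' *ᵥ bb84State x θ)) else 0))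
  refine h3.trans ?_
  -- Reindexing by the encrypted bit instead of the message: the sign of the message is the sign of
  -- the encrypted bit times that of the mask.
  have h4 : ∀ x θ r x', ((if x' ∈ agreeSet θ x then
      vecMulVec (L θ (false ^^ maskBit x θ) r x' *ᵥ bb84State x θ)
        (star (L θ (false ^^ maskBit x θ) r x' *ᵥ bb84State x θ)) else 0) -
      (if x' ∈ agreeSet θ x then
      vecMulVec (L θ (true ^^ maskBit x θ) r x' *ᵥ bb84State x θ)
        (star (L θ (true ^^ maskBit x θ) r x' *ᵥ bb84State x θ)) else 0)) =
      ∑ b, if x' ∈ agreeSet θ x then ((sgn b : ℝ) : ℂ) • ((sgn (maskBit x θ) : ℝ) : ℂ) •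
        vecMulVec (L θ b r x' *ᵥ bb84State x θ) (star (L θ b r x' *ᵥ bb84State x θ)) else 0 := by
    intro x θ r x'
    split_ifs
    · cases maskBit x θ <;> simp [sgn, sub_eq_add_neg, add_comm]
    · simp
  simp only [h4]
  rw [Finset.sum_comm]
  simp only [Finset.sum_comm (s := (Finset.univ : Finset Bool))]
  refine Finset.sum_congr rfl fun θ _ => ?_
  rw [Finset.sum_comm]
  refine Finset.sum_congr rfl fun r _ => ?_
  rw [Finset.sum_comm]

/-- `M ↦ Tr (K M Kᴴ)`. -/
noncomputable def conjTrace {Z : Type} [Fintype Z] (K : Matrix Z (Bits ρ) ℂ) :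
    Matrix (Bits ρ) (Bits ρ) ℂ →ₗ[ℂ] ℂ where
  toFun M := trace (K * M * Kᴴ)
  map_add' M N := by rw [Matrix.mul_add, Matrix.add_mul, trace_add]
  map_smul' c M := by rw [Matrix.mul_smul, Matrix.smul_mul, trace_smul, RingHom.id_apply]

theorem conjTrace_vecMulVec {Z : Type} [Fintype Z] (K : Matrix Z (Bits ρ) ℂ)
    (φ ψ : Vec (Fin ρ)) :
    conjTrace K (vecMulVec φ (star ψ)) = ∑ z, (K *ᵥ φ) z * star ((K *ᵥ ψ) z) := by
  change trace (K * vecMulVec φ (star ψ) * Kᴴ) = _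
  rw [mul_vecMulVec, vecMulVec_mul, ← star_mulVec]
  simp [trace, vecMulVec_apply]

/-- Cauchy-Schwarz on the trace of a rank-one matrix; `hK` says that `K` is a contraction. -/
theorem norm_conjTrace_vecMulVec_le {Z : Type} [Fintype Z] {K : Matrix Z (Bits ρ) ℂ}
    (hK : ∀ φ : Vec (Fin ρ), ∑ z, ‖(K *ᵥ φ) z‖ ^ 2 ≤ normSq φ) (φ ψ : Vec (Fin ρ)) :
    ‖conjTrace K (vecMulVec φ (star ψ))‖ ≤ nrm φ * nrm ψ := by
  rw [conjTrace_vecMulVec]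
  refine (norm_sum_le _ _).trans ?_
  simp only [norm_mul, norm_star]
  refine (Real.sum_mul_le_sqrt_mul_sqrt _ _ _).trans ?_
  exact mul_le_mul (Real.sqrt_le_sqrt (hK φ)) (Real.sqrt_le_sqrt (hK ψ)) (Real.sqrt_nonneg _)
    (nrm_nonneg _)

/-- No contraction applied to the accepted residual states distinguishes the two bits with
advantage larger than `L.cross`. -/
theorem abs_accept_sub_le {Z : Type} [Fintype Z] {K : Matrix Z (Bits ρ) ℂ}
    (hK : ∀ φ : Vec (Fin ρ), ∑ z, ‖(K *ᵥ φ) z‖ ^ 2 ≤ normSq φ) :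
    |avg (fun r => ∑ x', if x' ∈ agreeSet (coinTheta r) (coinX r) then
        ∑ z, ‖(K *ᵥ L.state false r x') z‖ ^ 2 else 0) -
      avg (fun r => ∑ x', if x' ∈ agreeSet (coinTheta r) (coinX r) then
        ∑ z, ‖(K *ᵥ L.state true r x') z‖ ^ 2 else 0)| ≤ L.cross := by
  -- On a pure state this linear functional is the squared norm after `K`, so the operator identity
  -- becomes one about probabilities.
  have h := congrArg (conjTrace K) L.sum_accept_sub
  have hq : ∀ b r x', conjTrace K (vecMulVec (L.state b r x') (star (L.state b r x'))) =
      ((∑ z, ‖(K *ᵥ L.state b r x') z‖ ^ 2 : ℝ) : ℂ) := by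
    intro b r x'
    rw [conjTrace_vecMulVec, Complex.ofReal_sum]
    refine Finset.sum_congr rfl fun z _ => ?_
    rw [Complex.star_def, Complex.mul_conj, Complex.normSq_eq_norm_sq]
  have hite : ∀ (p : Prop) [Decidable p] (x : ℝ),
      (if p then (x : ℂ) else 0) = ((if p then x else 0 : ℝ) : ℂ) := by
    intro p _ x
    split_ifs <;> simp
  simp only [map_sub, map_sum, apply_ite (conjTrace K), map_zero, hq, map_smul, hite] at h
  simp only [← Complex.ofReal_sum, ← Complex.ofReal_sub] at h
  rw [avg, avg, ← sub_div, abs_div, abs_of_nonneg (by positivity : (0 : ℝ) ≤ 2 ^ (n + n + m)),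
    cross]
  refine div_le_div_of_nonneg_right ?_ (by positivity)
  rw [← Real.norm_eq_abs, ← Complex.norm_real, h]
  refine (norm_sum_le _ _).trans (Finset.sum_le_sum fun b _ => ?_)
  refine (norm_sum_le _ _).trans (Finset.sum_le_sum fun θ _ => ?_)
  refine (norm_sum_le _ _).trans (Finset.sum_le_sum fun r _ => ?_)
  refine (norm_sum_le _ _).trans (Finset.sum_le_sum fun x' _ => ?_)
  refine (norm_sum_le _ _).trans (Finset.sum_le_sum fun y _ => ?_)
  rw [norm_smul, Complex.norm_real, Real.norm_eq_abs, abs_sgn, one_mul]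
  exact norm_conjTrace_vecMulVec_le hK _ _

/-- The outcome of the everlasting experiment. -/
noncomputable def evMat (b : Bool) : Matrix (Option (Bits ρ)) (Option (Bits ρ)) ℂ
  | some u, some v =>
      (∑ r, ∑ x', if x' ∈ agreeSet (coinTheta r) (coinX r)
        then L.state b r x' u * star (L.state b r x' v) else 0) / 2 ^ (n + n + m)
  | none, none =>
      ((avg (fun r => ∑ x', if x' ∈ agreeSet (coinTheta r) (coinX r) then 0
        else normSq (L.state b r x')) : ℝ) : ℂ)
  | some _, none => 0
  | none, some _ => 0

/-- A vector as a vector of the space with an additional basis state. -/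
def liftVec (φ : Vec (Fin ρ)) : Option (Bits ρ) → ℂ := fun o => o.elim 0 φ

theorem norm_liftVec (φ : Vec (Fin ρ)) : ‖WithLp.toLp 2 (liftVec φ)‖ = nrm φ := by
  rw [norm_toLp, nrm, normSq]
  simp [liftVec, Fintype.sum_option]

/-- The operators preserve the norm: every outcome of the experiment has some certificate. -/
def Isometric : Prop :=
  ∀ θ b r (φ : Vec (Fin n)), ∑ x', normSq (L θ b r x' *ᵥ φ) = normSq φ

variable {L}

/-- Acceptance and rejection probabilities add up to one. This ties the entry at `⊥` to the accepted
part. -/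
theorem Isometric.avg_reject (hL : L.Isometric) (b : Bool) :
    avg (fun r => ∑ x', if x' ∈ agreeSet (coinTheta r) (coinX r) then 0
      else normSq (L.state b r x')) =
    1 - avg (fun r => ∑ x', if x' ∈ agreeSet (coinTheta r) (coinX r)
      then normSq (L.state b r x') else 0) := by
  rw [eq_sub_iff_add_eq, ← avg_add]
  refine Eq.trans (congrArg avg (funext fun r => ?_)) (avg_const 1)
  rw [← Finset.sum_add_distrib]
  have h : ∑ x', normSq (L.state b r x') = 1 :=
    (hL _ _ _ _).trans (bb84State_norm (coinX r) (coinTheta r))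
  rw [← h]
  refine Finset.sum_congr rfl fun x' _ => ?_
  split_ifs <;> simp

/-- The difference is block diagonal. The accepted block and the entry at `⊥` each contribute at
most `L.cross` to the trace norm, and the factor `1/2` in the trace distance compensates for the two
contributions. -/
theorem Isometric.traceDist_evMat_le (hL : L.Isometric) :
    traceDist (L.evMat false) (L.evMat true) ≤ L.cross := by
  set d : ℝ := avg (fun r => ∑ x', if x' ∈ agreeSet (coinTheta r) (coinX r) then 0
      else normSq (L.state false r x')) - avg (fun r => ∑ x',
      if x' ∈ agreeSet (coinTheta r) (coinX r) then 0 else normSq (L.state true r x')) with hd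
  -- With `K = 1` the contraction bound compares the acceptance probabilities themselves.
  have hd' : |d| ≤ L.cross := by
    have h := L.abs_accept_sub_le (K := 1) (fun φ => by rw [one_mulVec]; rfl)
    simp only [one_mulVec] at h
    rw [hd, hL.avg_reject, hL.avg_reject, sub_sub_sub_cancel_left, abs_sub_comm]
    exact h
  set N : ℝ := 2 ^ (n + n + m) with hN
  set s : Finset (Bool × Bits n × Bits m × Bits n × Bits n) :=
    Finset.univ.filter fun k => k.2.2.2.2 ∈ agreeSet k.2.1 k.2.2.2.1 with hs
  have hsum : ∀ {M : Type} [AddCommMonoid M] (f : Bool → Bits n → Bits m → Bits n → Bits n → M),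
      ∑ k ∈ s, f k.1 k.2.1 k.2.2.1 k.2.2.2.1 k.2.2.2.2 =
        ∑ b, ∑ θ, ∑ r, ∑ x', ∑ y ∈ agreeSet θ x', f b θ r x' y := by
    intro M _ f
    rw [hs, Finset.sum_filter]
    simp only [Fintype.sum_prod_type]
    refine Finset.sum_congr rfl fun b _ => Finset.sum_congr rfl fun θ _ =>
      Finset.sum_congr rfl fun r _ => Finset.sum_congr rfl fun x' _ => ?_
    rw [← Finset.sum_filter, Finset.filter_mem_eq_inter, Finset.univ_inter]
  -- The index `none` carries the entry at `⊥` as a rank-one term; the indices `some k` carry the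
  -- off-diagonal terms, with sign and normalisation placed in `u`.
  set u : Option (Bool × Bits n × Bits m × Bits n × Bits n) → Option (Bits ρ) → ℂ := fun k =>
    k.elim (Pi.single none (d : ℂ)) fun k => (((sgn k.1 / N : ℝ) : ℂ)) •
      liftVec (L k.2.1 k.1 k.2.2.1 k.2.2.2.1 *ᵥ hadState k.2.2.2.2) with hu
  set v : Option (Bool × Bits n × Bits m × Bits n × Bits n) → Option (Bits ρ) → ℂ := fun k =>
    k.elim (Pi.single none 1) fun k =>
      liftVec (L k.2.1 k.1 k.2.2.1 k.2.2.2.1 *ᵥ hadState (flipBits k.2.1 k.2.2.2.2)) with hv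
  have hM : L.evMat false - L.evMat true =
      ∑ k ∈ Finset.insertNone s, vecMulVec (u k) (star (v k)) := by
    rw [Finset.sum_insertNone]
    have key := L.sum_accept_sub
    ext o o'
    rw [Matrix.sub_apply, Matrix.add_apply, Matrix.sum_apply]
    simp only [vecMulVec_apply, hu, hv, Option.elim_none, Option.elim_some, Pi.star_apply,
      Pi.smul_apply, smul_eq_mul]
    cases o with
    | none =>
      cases o' with
      | none => simp [evMat, liftVec, hd]
      | some v => simp [evMat, liftVec]
    | some u =>
      cases o' with
      | none => simp [evMat, liftVec]
      | some v =>
        have key2 := congrFun (congrFun key u) v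
        simp only [Matrix.sub_apply, Matrix.sum_apply, Matrix.smul_apply, vecMulVec_apply,
          Pi.star_apply, apply_ite (fun M : Matrix (Bits ρ) (Bits ρ) ℂ => M u v),
          Matrix.zero_apply, smul_eq_mul] at key2
        have h2 := hsum fun b θ r x' y => ((sgn b : ℝ) : ℂ) *
          ((L θ b r x' *ᵥ hadState y) u * star ((L θ b r x' *ᵥ hadState (flipBits θ y)) v))
        rw [← h2] at key2
        simp only [evMat, ← sub_div, key2, liftVec, Option.elim_some]
        simp [Finset.sum_div, hN]
        refine Finset.sum_congr rfl fun k _ => ?_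
        ring
  have hle := traceNorm_sum_vecMulVec_le (Finset.insertNone s) u v
  rw [← hM, Finset.sum_insertNone] at hle
  have h0 : ‖WithLp.toLp 2 (u none)‖ * ‖WithLp.toLp 2 (v none)‖ = |d| := by
    simp [hu, hv]
  have h1 : ∑ k ∈ s, ‖WithLp.toLp 2 (u (some k))‖ * ‖WithLp.toLp 2 (v (some k))‖ = L.cross := by
    rw [cross, ← hsum, Finset.sum_div]
    refine Finset.sum_congr rfl fun k _ => ?_
    simp only [hu, hv, Option.elim_some, WithLp.toLp_smul, norm_smul, norm_liftVec,
      Complex.norm_real, Real.norm_eq_abs, abs_div, abs_sgn]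
    rw [abs_of_nonneg (by positivity : (0 : ℝ) ≤ N)]
    ring
  rw [h0, h1] at hle
  rw [traceDist]
  linarith

end ExpOps
end Experiment

/-- Hamming distance. -/
def distBits {n : ℕ} (y x' : Bits n) : ℕ := (Finset.univ.filter fun i => y i ≠ x' i).card

def zeros {n : ℕ} (θ : Bits n) : ℕ := (Finset.univ.filter fun i => θ i = false).card

/-- Where `θ` is zero exactly one of the two strings differs from `x'`; where it is one neither
does. -/
theorem distBits_add_distBits_flipBits {n : ℕ} {θ x' y : Bits n} (h : y ∈ agreeSet θ x') :
    distBits y x' + distBits (flipBits θ y) x' = zeros θ := by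
  rw [mem_agreeSet] at h
  simp only [distBits, zeros, Finset.card_filter]
  rw [← Finset.sum_add_distrib]
  refine Finset.sum_congr rfl fun i _ => ?_
  have hi := h i
  cases hθ : θ i <;> cases hy : y i <;> cases hx : x' i <;> simp_all [flipBits]

/-- The strings that agree with `x'` where `θ` is `1` but differ from it on at least half of the
other positions. -/
def badSet {n : ℕ} (θ x' : Bits n) : Finset (Bits n) :=
  (agreeSet θ x').filter fun y => zeros θ ≤ 2 * distBits y x'

section Experiment
variable {n m ρ : ℕ}

namespace ExpOps

/-- The probability that the certificate of a deletion of `|y⟩` in the Hadamard basis is bad. -/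
noncomputable def badProb (L : ExpOps n m ρ) : ℝ :=
  (∑ b, ∑ θ, ∑ r, ∑ x', ∑ y ∈ badSet θ x', normSq (L θ b r x' *ᵥ hadState y)) / 2 ^ (n + n + m)

/-- In every pair `y`, `flipBits θ y` at least one string is bad, so the products can be charged to
bad strings. Weighted AM-GM then puts the large weight `C` on the bad string and the small weight `1
/ C` on its partner, about which nothing is known. -/
theorem sum_agreeSet_le {θ x' : Bits n} {f : Bits n → ℝ} (hf : ∀ y, 0 ≤ f y) {C : ℝ}
    (hC : 0 < C) :
    ∑ y ∈ agreeSet θ x', f y * f (flipBits θ y) ≤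
      C * ∑ y ∈ badSet θ x', f y ^ 2 + (∑ y, f y ^ 2) / C := by
  set g : Bits n → ℝ := fun y => if zeros θ ≤ 2 * distBits y x' then f y * f (flipBits θ y) else 0
    with hg
  have hff : ∀ y, 0 ≤ f y * f (flipBits θ y) := fun y => mul_nonneg (hf _) (hf _)
  -- The two distances sum to `zeros θ`, so they cannot both be below half of it.
  have h1 : ∀ y ∈ agreeSet θ x', f y * f (flipBits θ y) ≤ g y + g (flipBits θ y) := by
    intro y hy
    have hd := distBits_add_distBits_flipBits hy
    have hc : f (flipBits θ y) * f y = f y * f (flipBits θ y) := mul_comm _ _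
    have := hff y
    simp only [hg, flipBits_flipBits, hc]
    split_ifs with ha hb hb
    · linarith
    · linarith
    · linarith
    · omega
  have h2 : ∀ y, 2 * (f y * f (flipBits θ y)) ≤ C * f y ^ 2 + f (flipBits θ y) ^ 2 / C := by
    intro y
    have h3 : 0 ≤ (C * f y - f (flipBits θ y)) ^ 2 / C := by positivity
    have h4 : (C * f y - f (flipBits θ y)) ^ 2 / C =
        C * f y ^ 2 + f (flipBits θ y) ^ 2 / C - 2 * (f y * f (flipBits θ y)) := by
      field_simp
      ring
    linarith
  calc ∑ y ∈ agreeSet θ x', f y * f (flipBits θ y)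
      ≤ ∑ y ∈ agreeSet θ x', (g y + g (flipBits θ y)) := Finset.sum_le_sum h1
    _ = ∑ y ∈ badSet θ x', 2 * (f y * f (flipBits θ y)) := by
        rw [Finset.sum_add_distrib, sum_agreeSet_flipBits, ← two_mul, badSet, Finset.sum_filter,
          Finset.mul_sum]
        refine Finset.sum_congr rfl fun y _ => ?_
        simp [hg]
    _ ≤ ∑ y ∈ badSet θ x', (C * f y ^ 2 + f (flipBits θ y) ^ 2 / C) :=
        Finset.sum_le_sum fun y _ => h2 y
    _ ≤ C * ∑ y ∈ badSet θ x', f y ^ 2 + (∑ y, f y ^ 2) / C := by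
        rw [Finset.sum_add_distrib, ← Finset.mul_sum, ← Finset.sum_div]
        refine add_le_add le_rfl (div_le_div_of_nonneg_right ?_ hC.le)
        calc ∑ y ∈ badSet θ x', f (flipBits θ y) ^ 2
            ≤ ∑ y ∈ agreeSet θ x', f (flipBits θ y) ^ 2 :=
              Finset.sum_le_sum_of_subset_of_nonneg (Finset.filter_subset _ _)
                fun _ _ _ => sq_nonneg _
          _ = ∑ y ∈ agreeSet θ x', f y ^ 2 := sum_agreeSet_flipBits θ x' fun y => f y ^ 2
          _ ≤ ∑ y, f y ^ 2 := Finset.sum_le_sum_of_subset_of_nonneg (Finset.subset_univ _)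
                fun _ _ _ => sq_nonneg _

/-- The partners of bad strings contribute at most the total weight of all outcomes, which after
normalisation is two, one for each encrypted bit. -/
theorem Isometric.cross_le {L : ExpOps n m ρ} (hL : L.Isometric) {C : ℝ} (hC : 0 < C) :
    L.cross ≤ C * L.badProb + 2 / C := by
  have hN : (0 : ℝ) < 2 ^ (n + n + m) := by positivity
  -- For each choice of `b`, `θ`, `r`, each of the `2 ^ n` unit vectors `hadState y` has total
  -- outcome probability one.
  have htot : ∑ b : Bool, ∑ θ, ∑ r, ∑ x', ∑ y, normSq (L θ b r x' *ᵥ hadState y) =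
      2 * 2 ^ (n + n + m) := by
    have h : ∀ b θ r, ∑ x', ∑ y, normSq (L θ b r x' *ᵥ hadState y) = 2 ^ n := by
      intro b θ r
      rw [Finset.sum_comm]
      simp [hL θ b r, normSq_hadState]
    simp only [h]
    simp
    ring
  rw [cross, badProb, ← mul_div_assoc]
  rw [show (2 : ℝ) / C = (2 * 2 ^ (n + n + m)) / C / 2 ^ (n + n + m) by field_simp,
    ← add_div, ← htot]
  refine div_le_div_of_nonneg_right ?_ hN.le
  simp only [Finset.mul_sum, Finset.sum_div]
  simp only [← Finset.sum_add_distrib]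
  refine Finset.sum_le_sum fun b _ => Finset.sum_le_sum fun θ _ => Finset.sum_le_sum fun r _ =>
    Finset.sum_le_sum fun x' _ => ?_
  have h := sum_agreeSet_le (θ := θ) (x' := x') (f := fun y => nrm (L θ b r x' *ᵥ hadState y))
    (fun _ => nrm_nonneg _) hC
  simpa only [nrm_sq, Finset.mul_sum, Finset.sum_div] using h

end ExpOps
end Experiment
end RevTRE

/-! ### Rarity of bad certificates: from parities to moments of the Hamming distance -/

namespace RevTRE

open Matrix

/-! ### Parities and conjunctions -/

/-- The character `x ↦ (-1)^(⊕_{i ∈ T} x i)`. -/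
noncomputable def chi {n : ℕ} (T : Finset (Fin n)) (x : Bits n) : ℝ := ∏ i ∈ T, sgn (x i)

theorem ite_eq_sgn (a b : Bool) : (if a = b then (1 : ℝ) else 0) = (1 + sgn a * sgn b) / 2 := by
  cases a <;> cases b <;> norm_num [sgn]

theorem abs_chi {n : ℕ} (T : Finset (Fin n)) (x : Bits n) : |chi T x| = 1 := by
  rw [chi, Finset.abs_prod]
  exact Finset.prod_eq_one fun i _ => abs_sgn _

/-- A signed measure with small correlation with all parities has small correlation with all
conjunctions. -/
theorem abs_sum_conj_le {n : ℕ} {q : Bits n → ℝ} {δ : ℝ}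
    (hq : ∀ T, |∑ x, q x * chi T x| ≤ δ) (S : Finset (Fin n)) (w : Bits n) :
    |∑ x, q x * if ∀ i ∈ S, x i = w i then 1 else 0| ≤ δ := by
  -- Fourier expansion of a conjunction: each factor is `(1 + sgn (x i) * sgn (w i)) / 2`, and
  -- multiplying out averages the characters over the subsets of `S`.
  have h : ∀ x : Bits n, (if ∀ i ∈ S, x i = w i then (1 : ℝ) else 0) =
      (∑ T ∈ S.powerset, chi T x * chi T w) / 2 ^ S.card := by
    intro x
    have h1 : ∏ i ∈ S, (if x i = w i then (1 : ℝ) else 0) =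
        if ∀ i ∈ S, x i = w i then 1 else 0 := by
      rw [Finset.prod_ite_zero, Finset.prod_const_one]
      congr
    rw [← h1]
    simp only [ite_eq_sgn]
    rw [Finset.prod_div_distrib, Finset.prod_const, Finset.prod_one_add]
    simp only [chi, Finset.prod_mul_distrib]
  have h2 : ∑ x, q x * (if ∀ i ∈ S, x i = w i then (1 : ℝ) else 0) =
      (∑ T ∈ S.powerset, chi T w * ∑ x, q x * chi T x) / 2 ^ S.card := by
    simp only [h, Finset.mul_sum, Finset.sum_div]
    rw [Finset.sum_comm]
    refine Finset.sum_congr rfl fun T _ => Finset.sum_congr rfl fun x _ => ?_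
    ring
  rw [h2, abs_div, abs_of_nonneg (by positivity : (0 : ℝ) ≤ 2 ^ S.card),
    div_le_iff₀ (by positivity)]
  refine (Finset.abs_sum_le_sum_abs _ _).trans ?_
  calc ∑ T ∈ S.powerset, |chi T w * ∑ x, q x * chi T x| ≤ ∑ T ∈ S.powerset, δ := by
        refine Finset.sum_le_sum fun T _ => ?_
        rw [abs_mul, abs_chi, one_mul]
        exact hq T
    _ = δ * 2 ^ S.card := by
        rw [Finset.sum_const, Finset.card_powerset, nsmul_eq_mul, mul_comm]
        norm_num

/-- Indicates that `x'` agrees with `y` where `θ` is `1` and differs from it at all positions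
of the tuple `J`. -/
noncomputable def tupleInd {n s : ℕ} (θ y : Bits n) (J : Fin s → Fin n) (x' : Bits n) : ℝ :=
  if (∀ i, θ i = true → y i = x' i) ∧ ∀ j, y (J j) ≠ x' (J j) then 1 else 0

/-- If the tuple meets a one of `θ`, the two requirements contradict each other. Otherwise they form
a single conjunction, on the ones of `θ` and the positions of the tuple. -/
theorem abs_sum_tupleInd_le {n s : ℕ} {q : Bits n → ℝ} {δ : ℝ}
    (hq : ∀ T, |∑ x, q x * chi T x| ≤ δ) (θ y : Bits n) (J : Fin s → Fin n) :
    |∑ x, q x * tupleInd θ y J x| ≤ δ := by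
  by_cases hJ : ∃ j, θ (J j) = true
  · obtain ⟨j, hj⟩ := hJ
    have h : ∀ x, tupleInd θ y J x = 0 := fun x => if_neg fun ⟨h1, h2⟩ => h2 j (h1 _ hj)
    simp only [h, mul_zero, Finset.sum_const_zero, abs_zero]
    -- The empty parity is used only to see that `δ` is nonnegative.
    exact (abs_nonneg _).trans (hq ∅)
  · push Not at hJ
    -- The prescribed string is `y`, negated at the positions of the tuple.
    have h := abs_sum_conj_le hq
      (Finset.univ.filter (fun i => θ i = true) ∪ Finset.univ.image J)
      (fun i => y i ^^ decide (∃ j, J j = i))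
    refine le_of_eq_of_le ?_ h
    congr 1
    refine Finset.sum_congr rfl fun x _ => ?_
    congr 1
    rw [tupleInd]
    refine if_congr ⟨fun ⟨h1, h2⟩ i hi => ?_, fun h1 => ⟨fun i hi => ?_, fun j hj => ?_⟩⟩ rfl rfl
    · by_cases hJi : ∃ j, J j = i
      · obtain ⟨j, rfl⟩ := hJi
        have := h2 j
        simp only [exists_apply_eq_apply, decide_true, Bool.xor_true]
        exact Bool.eq_not.mpr this.symm
      · simp only [hJi, decide_false, Bool.xor_false]
        simp only [Finset.mem_union, Finset.mem_filter, Finset.mem_univ, true_and,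
          Finset.mem_image] at hi
        exact (h1 i (hi.resolve_right hJi)).symm
    · have hJi : ¬ ∃ j, J j = i := by
        rintro ⟨j, rfl⟩
        exact hJ j hi
      have := h1 i (by simp [hi])
      simp only [hJi, decide_false, Bool.xor_false] at this
      exact this.symm
    · have := h1 (J j) (by simp)
      simp [← hj] at this

/-- The tuples of differing positions, repetitions allowed, number `distBits y x' ^ s`. -/
theorem sum_tupleInd {n : ℕ} (s : ℕ) (θ y x' : Bits n) :
    ∑ J : Fin s → Fin n, tupleInd θ y J x' =
      (if y ∈ agreeSet θ x' then 1 else 0) * (distBits y x' : ℝ) ^ s := by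
  have h : (distBits y x' : ℝ) = ∑ i, if y i ≠ x' i then 1 else 0 := by
    rw [distBits, Finset.card_filter]
    push_cast
    rfl
  rw [h, Fintype.sum_pow, Finset.mul_sum]
  refine Finset.sum_congr rfl fun J _ => ?_
  rw [Finset.prod_ite_zero, tupleInd]
  simp only [mem_agreeSet]
  split_ifs <;> simp_all

/-! ### Random bases -/

theorem avg_prod_bits {n : ℕ} (g : Fin n → Bool → ℝ) :
    avg (fun θ : Bits n => ∏ i, g i (θ i)) = ∏ i, (g i true + g i false) / 2 := by
  rw [avg, sum_prod_bits, Finset.prod_div_distrib]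
  simp

/-- Each position where `y` and `x'` differ must receive a zero of `θ`, which has probability one
half independently. -/
theorem avg_agree {n : ℕ} (y x' : Bits n) :
    avg (fun θ => if y ∈ agreeSet θ x' then (1 : ℝ) else 0) = (1 / 2) ^ distBits y x' := by
  have h : ∀ θ : Bits n, (if y ∈ agreeSet θ x' then (1 : ℝ) else 0) =
      ∏ i, if θ i = true → y i = x' i then 1 else 0 := by
    intro θ
    rw [Finset.prod_ite_zero]
    simp [mem_agreeSet]
  simp only [h]
  rw [avg_prod_bits (fun i a => if a = true → y i = x' i then (1 : ℝ) else 0), distBits,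
    ← Finset.prod_const, Finset.prod_filter]
  refine Finset.prod_congr rfl fun i _ => ?_
  by_cases hi : y i = x' i <;> norm_num [hi]

/-- A Chernoff bound: the indicator is at most `(3/2)^(n - 4 * zeros θ)`. Each zero thus has weight
`(2/3)^4 = 16/81`, and each position contributes `(3/2) * (1 + 16/81) / 2 = 97/108` on average. -/
theorem avg_few_zeros_le (n : ℕ) :
    avg (fun θ : Bits n => if 4 * zeros θ ≤ n then (1 : ℝ) else 0) ≤ (97 / 108) ^ n := by
  have h : ∀ θ : Bits n, (if 4 * zeros θ ≤ n then (1 : ℝ) else 0) ≤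
      (3 / 2) ^ n * ∏ i, if θ i = false then 16 / 81 else 1 := by
    intro θ
    rw [← Finset.prod_filter, Finset.prod_const]
    change _ ≤ (3 / 2 : ℝ) ^ n * (16 / 81) ^ zeros θ
    split_ifs with hz
    · have h1 : ((3 : ℝ) / 2) ^ (4 * zeros θ) ≤ (3 / 2) ^ n :=
        pow_le_pow_right₀ (by norm_num) hz
      calc (1 : ℝ) = (3 / 2) ^ (4 * zeros θ) * (16 / 81) ^ zeros θ := by
            rw [pow_mul, ← mul_pow]; norm_num
        _ ≤ _ := mul_le_mul_of_nonneg_right h1 (by positivity)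
    · positivity
  refine (avg_mono h).trans ?_
  rw [avg_mul_left, avg_prod_bits (fun _ a => if a = false then (16 / 81 : ℝ) else 1)]
  simp only [Bool.true_eq_false, if_false, if_true, Finset.prod_const, Finset.card_univ,
    Fintype.card_fin, ← mul_pow]
  norm_num

/-- If more than a quarter of `θ` is zero, a bad string has distance greater than `n / 8`, so `(8 *
distBits y x' / n) ^ s ≥ 1`, as in Markov's inequality for the `s`-th moment. -/
theorem bad_le {n : ℕ} (hn : 1 ≤ n) (s : ℕ) (θ y x' : Bits n) :
    (if y ∈ badSet θ x' then (1 : ℝ) else 0) ≤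
      (if 4 * zeros θ ≤ n then 1 else 0) +
        (8 / n) ^ s * ∑ J : Fin s → Fin n, tupleInd θ y J x' := by
  have hn0 : (0 : ℝ) < n := by exact_mod_cast hn
  have h0 : 0 ≤ (8 / (n : ℝ)) ^ s * ∑ J : Fin s → Fin n, tupleInd θ y J x' := by
    rw [sum_tupleInd]
    positivity
  by_cases hb : y ∈ badSet θ x'
  · rw [if_pos hb]
    by_cases hz : 4 * zeros θ ≤ n
    · rw [if_pos hz]
      linarith
    · obtain ⟨ha, hd⟩ := Finset.mem_filter.mp hb
      rw [if_neg hz, zero_add, sum_tupleInd, if_pos ha, one_mul, ← mul_pow]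
      refine one_le_pow₀ ?_
      rw [div_mul_eq_mul_div, one_le_div hn0]
      exact_mod_cast (by omega : n ≤ 8 * distBits y x')
  · rw [if_neg hb]
    split_ifs <;> linarith

namespace ExpOps
variable {n m ρ : ℕ}

/-- If the distribution of the certificate is nearly independent of the basis `θ`, as far as
parities are concerned, then bad certificates are rare. -/
theorem Isometric.badProb_le {L : ExpOps n m ρ} (hL : L.Isometric) (hn : 1 ≤ n)
    {p₀ : Bits n → Bits n → ℝ} (hp₀ : ∀ y x', 0 ≤ p₀ y x') (hp₁ : ∀ y, ∑ x', p₀ y x' = 1)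
    {δ : ℝ} (hδ : ∀ T b θ y, |∑ x', (avg (fun r => normSq (L θ b r x' *ᵥ hadState y)) -
      p₀ y x') * chi T x'| ≤ δ) {s : ℕ} {C : ℝ} (hC : ∀ d : ℕ, (d : ℝ) ^ s * (1 / 2) ^ d ≤ C) :
    L.badProb ≤ 2 * ((97 / 108) ^ n + 8 ^ s * δ + 8 ^ s * C * ((n : ℝ) ^ s)⁻¹) := by
  have hn0 : (0 : ℝ) < n := by exact_mod_cast hn
  set p : Bool → Bits n → Bits n → Bits n → ℝ :=
    fun b θ y x' => avg (fun r => normSq (L θ b r x' *ᵥ hadState y)) with hp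
  have hpn : ∀ b θ y x', 0 ≤ p b θ y x' := fun b θ y x' => avg_nonneg fun r => normSq_nonneg _
  have hps : ∀ b θ y, ∑ x', p b θ y x' = 1 := by
    intro b θ y
    simp only [hp]
    rw [← avg_sum]
    simp only [hL θ b, normSq_hadState, avg_const]
  -- The sum over `y`, together with the factor `2 ^ n` in the normalisation, is an average over a
  -- uniform Hadamard-basis string.
  have hbad : L.badProb = ∑ b, avg fun y => avg fun θ => ∑ x',
      p b θ y x' * if y ∈ badSet θ x' then 1 else 0 := by
    have h1 : ∀ (b : Bool) (θ y : Bits n),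
        ∑ x', p b θ y x' * (if y ∈ badSet θ x' then (1 : ℝ) else 0) =
        (∑ r, ∑ x', if y ∈ badSet θ x' then normSq (L θ b r x' *ᵥ hadState y) else 0) / 2 ^ m := by
      intro b θ y
      rw [Finset.sum_comm, Finset.sum_div]
      refine Finset.sum_congr rfl fun x' _ => ?_
      simp only [hp, avg]
      split_ifs <;> simp
    have h2 : ∀ (b : Bool) (θ : Bits n) (r : Bits m), ∑ x', ∑ y ∈ badSet θ x',
        normSq (L θ b r x' *ᵥ hadState y) =
        ∑ y, ∑ x', if y ∈ badSet θ x' then normSq (L θ b r x' *ᵥ hadState y) else 0 := by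
      intro b θ r
      rw [Finset.sum_comm]
      refine Finset.sum_congr rfl fun x' _ => ?_
      rw [← Finset.sum_filter, Finset.filter_mem_eq_inter, Finset.univ_inter]
    rw [badProb, Finset.sum_div]
    refine Finset.sum_congr rfl fun b _ => ?_
    simp only [h1, h2, avg, ← Finset.sum_div]
    rw [div_div, div_div, ← pow_add, ← pow_add]
    congr 1
    · exact (Finset.sum_congr rfl fun θ _ => Finset.sum_comm).trans Finset.sum_comm
    · congr 1
      ring
  -- Replaces the true certificate distribution by `p₀`. Each of the `n ^ s` tuples costs `δ`, and
  -- the prefactor `(8 / n) ^ s` turns the total into `8 ^ s * δ`.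
  have hstep : ∀ b θ y, ∑ x', p b θ y x' * (if y ∈ badSet θ x' then 1 else 0) ≤
      (if 4 * zeros θ ≤ n then 1 else 0) + 8 ^ s * δ + (8 / n) ^ s *
        ∑ x', p₀ y x' * ((if y ∈ agreeSet θ x' then 1 else 0) * (distBits y x' : ℝ) ^ s) := by
    intro b θ y
    have h1 : ∀ J : Fin s → Fin n, ∑ x', p b θ y x' * tupleInd θ y J x' ≤
        ∑ x', p₀ y x' * tupleInd θ y J x' + δ := by
      intro J
      have h := (abs_le.mp (abs_sum_tupleInd_le (fun T => hδ T b θ y) θ y J)).2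
      simp only [sub_mul, Finset.sum_sub_distrib] at h
      linarith
    have h8 : (0 : ℝ) ≤ (8 / n) ^ s := by positivity
    calc ∑ x', p b θ y x' * (if y ∈ badSet θ x' then (1 : ℝ) else 0)
        ≤ ∑ x', p b θ y x' * ((if 4 * zeros θ ≤ n then 1 else 0) +
          (8 / n) ^ s * ∑ J : Fin s → Fin n, tupleInd θ y J x') :=
          Finset.sum_le_sum fun x' _ => mul_le_mul_of_nonneg_left (bad_le hn s θ y x') (hpn _ _ _ _)
      _ = (if 4 * zeros θ ≤ n then 1 else 0) +
          (8 / n) ^ s * ∑ J : Fin s → Fin n, ∑ x', p b θ y x' * tupleInd θ y J x' := by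
          simp only [mul_add, Finset.sum_add_distrib, ← Finset.sum_mul, hps, one_mul]
          rw [Finset.sum_comm, Finset.mul_sum]
          congr 1
          refine Finset.sum_congr rfl fun x' _ => ?_
          rw [← Finset.mul_sum]
          ring
      _ ≤ (if 4 * zeros θ ≤ n then 1 else 0) +
          (8 / n) ^ s * ∑ J : Fin s → Fin n, (∑ x', p₀ y x' * tupleInd θ y J x' + δ) :=
          add_le_add le_rfl (mul_le_mul_of_nonneg_left (Finset.sum_le_sum fun J _ => h1 J) h8)
      _ = _ := by
          rw [Finset.sum_add_distrib, Finset.sum_comm]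
          simp only [← Finset.mul_sum, sum_tupleInd]
          simp only [Finset.sum_const, Finset.card_univ, Fintype.card_fun, Fintype.card_fin,
            nsmul_eq_mul]
          push_cast
          have : (8 / (n : ℝ)) ^ s * n ^ s = 8 ^ s := by
            rw [← mul_pow, div_mul_cancel₀ _ hn0.ne']
          rw [mul_add, ← mul_assoc, this]
          ring
  -- As `p₀` does not depend on `θ`, the average over `θ` acts on the agreement indicator alone. The
  -- resulting weight `(1/2) ^ d` dominates the moment `d ^ s`.
  have hrand : ∀ y, avg (fun θ => (8 / (n : ℝ)) ^ s *
      ∑ x', p₀ y x' * ((if y ∈ agreeSet θ x' then 1 else 0) * (distBits y x' : ℝ) ^ s)) ≤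
      8 ^ s * C * ((n : ℝ) ^ s)⁻¹ := by
    intro y
    rw [avg_mul_left, avg_sum]
    simp only [avg_mul_left, avg_mul_right, avg_agree]
    have h : ∑ x', p₀ y x' * ((1 / 2) ^ distBits y x' * (distBits y x' : ℝ) ^ s) ≤ C := by
      calc _ ≤ ∑ x', p₀ y x' * C := Finset.sum_le_sum fun x' _ =>
            mul_le_mul_of_nonneg_left (by rw [mul_comm]; exact hC _) (hp₀ _ _)
        _ = C := by rw [← Finset.sum_mul, hp₁, one_mul]
    calc _ ≤ (8 / (n : ℝ)) ^ s * C := mul_le_mul_of_nonneg_left h (by positivity)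
      _ = _ := by rw [div_pow]; ring
  rw [hbad]
  calc _ ≤ ∑ b : Bool, ((97 / 108) ^ n + 8 ^ s * δ + 8 ^ s * C * ((n : ℝ) ^ s)⁻¹) := by
        refine Finset.sum_le_sum fun b _ => ?_
        rw [← avg_const (n := n) ((97 / 108) ^ n + 8 ^ s * δ + 8 ^ s * C * ((n : ℝ) ^ s)⁻¹)]
        refine avg_mono fun y => (avg_mono fun θ => hstep b θ y).trans ?_
        rw [avg_add, avg_add, avg_const]
        exact add_le_add (add_le_add (avg_few_zeros_le n) le_rfl) (hrand y)
    _ = _ := by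
        rw [Finset.sum_const, Finset.card_univ, Fintype.card_bool, nsmul_eq_mul]
        norm_num

end ExpOps

theorem exists_pow_mul_half_pow_le (s : ℕ) :
    ∃ C : ℝ, ∀ d : ℕ, (d : ℝ) ^ s * (1 / 2) ^ d ≤ C := by
  have h := tendsto_pow_const_mul_const_pow_of_abs_lt_one s (r := (1 / 2 : ℝ))
    (by rw [abs_of_nonneg] <;> norm_num)
  obtain ⟨C, hC⟩ := h.bddAbove_range
  exact ⟨C, fun d => hC ⟨d, rfl⟩⟩

end RevTRE

/-! ### Distinguishers with general work registers, and plain hiding -/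

namespace RevTRE

open Matrix

/-! ### Distinguishers with arbitrary work registers -/

theorem normSq_relabel {K K' : Type} [Fintype K] [DecidableEq K] [Fintype K'] [DecidableEq K']
    (e : K ≃ K') (φ : Vec K) : normSq (fun z : K' → Bool => φ fun k => z (e k)) = normSq φ :=
  (e.symm.arrowCongr (Equiv.refl Bool)).sum_comp fun z => ‖φ z‖ ^ 2

section Work
variable {I : ℕ → Type} [∀ κ, Fintype (I κ)] [∀ κ, DecidableEq (I κ)]
  {K : ℕ → Type} [∀ κ, Fintype (K κ)] [∀ κ, DecidableEq (K κ)]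

/-- Numbers the wires of the work register. -/
noncomputable def workEquiv (I K : Type) [Fintype K] :
    (I ⊕ K) ⊕ Empty ≃ I ⊕ Fin (Fintype.card K) :=
  (Equiv.sumEmpty _ _).trans (Equiv.sumCongr (Equiv.refl I) (Fintype.equivFin K))

noncomputable def Distinguisher.ofWork (adv : ∀ κ, Vec (K κ)) (hadv : ∀ κ, normSq (adv κ) = 1)
    (C : ∀ κ, Circuit (I κ ⊕ K κ)) (o : ∀ κ, I κ ⊕ K κ) : Distinguisher I where
  adviceLen κ := Fintype.card (K κ)
  advice κ := fun z => adv κ fun k => z (Fintype.equivFin (K κ) k)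
  advice_norm κ := (normSq_relabel _ _).trans (hadv κ)
  circ κ := Circuit.map (workEquiv (I κ) (K κ)) (C κ)
  out κ := workEquiv (I κ) (K κ) (Sum.inl (o κ))

/-- Renumbering is an embedding with empty complement, so the sum over untouched wires has a single
term. -/
theorem Distinguisher.ofWork_prob (adv : ∀ κ, Vec (K κ)) (hadv : ∀ κ, normSq (adv κ) = 1)
    (C : ∀ κ, Circuit (I κ ⊕ K κ)) (o : ∀ κ, I κ ⊕ K κ) (κ : ℕ) (φ : Vec (I κ)) :
    (Distinguisher.ofWork adv hadv C o).prob κ φ = outProb (C κ) (o κ) (tensor φ (adv κ)) := by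
  refine (outProb_map (workEquiv (I κ) (K κ)) (C κ) (o κ) _).trans ?_
  rw [Fintype.sum_unique]
  congr 1
  funext u
  simp [tensor, splitBits, workEquiv, Distinguisher.ofWork]

theorem Distinguisher.ofWork_QPT {adv : ∀ κ, Vec (K κ)} {hadv : ∀ κ, normSq (adv κ) = 1}
    {C : ∀ κ, Circuit (I κ ⊕ K κ)} {o : ∀ κ, I κ ⊕ K κ}
    (h1 : PolyBounded fun κ => Fintype.card (K κ)) (h2 : PolyBounded fun κ => (C κ).size) :
    (Distinguisher.ofWork adv hadv C o).QPT := by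
  refine ⟨h1, h2.mono fun κ => ?_⟩
  exact (Circuit.size_map _ _).le

theorem Distinguisher.ofWork_inTime {adv : ∀ κ, Vec (K κ)} {hadv : ∀ κ, normSq (adv κ) = 1}
    {C : ∀ κ, Circuit (I κ ⊕ K κ)} {o : ∀ κ, I κ ⊕ K κ} {T : ℕ → ℕ}
    (h : ParallelTime T fun κ => (C κ).depth) :
    (Distinguisher.ofWork adv hadv C o).InTime T := by
  obtain ⟨c, hc⟩ := h
  exact ⟨c, fun κ => (Circuit.depth_map _ _).le.trans (hc κ)⟩

end Work

/-- Moves the classical part of a ciphertext to the front. -/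
def frontEquiv (Q C A V : Type) : ((Q ⊕ C) ⊕ A) ⊕ V ≃ C ⊕ ((Q ⊕ A) ⊕ V) where
  toFun
    | .inl (.inl (.inl q)) => .inr (.inl (.inl q))
    | .inl (.inl (.inr c)) => .inl c
    | .inl (.inr a) => .inr (.inl (.inr a))
    | .inr v => .inr (.inr v)
  invFun
    | .inr (.inl (.inl q)) => .inl (.inl (.inl q))
    | .inl c => .inl (.inl (.inr c))
    | .inr (.inl (.inr a)) => .inl (.inr a)
    | .inr (.inr v) => .inr v
  left_inv := by rintro (((q | c) | a) | v) <;> rfl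
  right_inv := by rintro (c | ((q | a) | v)) <;> rfl

theorem tensor_front {Q C A V : Type} [Fintype Q] [Fintype C] [Fintype A] [Fintype V]
    (φ : Vec Q) (χ : Vec C) (ψ : Vec A) (ξ : Vec V) (u : (Q ⊕ C) ⊕ A → Bool) (v : V → Bool) :
    tensor χ (tensor (tensor φ ψ) ξ) ((splitBits (frontEquiv Q C A V)).symm (u, v)) =
      ξ v * tensor (tensor φ χ) ψ u := by
  simp only [tensor, splitBits, frontEquiv, Equiv.coe_fn_symm_mk, Sum.elim_inl, Sum.elim_inr]
  ring

theorem abs_avg_sub_le {n : ℕ} {f g : Bits n → ℝ} {δ : ℝ} (h : ∀ r, |f r - g r| ≤ δ) :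
    |avg f - avg g| ≤ δ := by
  rw [← avg_sub]
  refine (abs_avg_le _).trans ((avg_mono h).trans (avg_const δ).le)

section Compile
variable {S : TRE (fun κ => κ + 1)} {T : ℕ → ℕ}

/-- The compiled scheme inherits hiding: the quantum part of the ciphertext can be part of the
advice. -/
theorem compile_hiding (hS : S.Hiding T) : (compile S).Hiding T := by
  intro A hQ hT
  -- For fixed `x` and `θ`, the two messages differ in their last bit only, and the state `|x⟩_θ` is
  -- advice.
  have key : ∀ ω : ∀ κ, Bits κ × Bits κ, Negl (fun κ =>
      |avg (fun r => A.prob κ (tensor (bb84State (ω κ).1 (ω κ).2) (ket (S.enc κ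
        (Fin.snoc (ω κ).2 (false ^^ maskBit (ω κ).1 (ω κ).2)) r)))) -
      avg (fun r => A.prob κ (tensor (bb84State (ω κ).1 (ω κ).2) (ket (S.enc κ
        (Fin.snoc (ω κ).2 (true ^^ maskBit (ω κ).1 (ω κ).2)) r))))|) := by
    intro ω
    set D : Distinguisher (fun κ => Fin (S.ctLen κ)) := Distinguisher.ofWork
      (K := fun κ => (Fin κ ⊕ Fin (A.adviceLen κ)) ⊕ Empty)
      (fun κ => tensor (tensor (bb84State (ω κ).1 (ω κ).2) (A.advice κ)) (fun _ => 1))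
      (fun κ => by
        rw [normSq_tensor, normSq_tensor, bb84State_norm, A.advice_norm]
        simp [normSq])
      (fun κ => Circuit.map (frontEquiv _ _ _ _) (A.circ κ))
      (fun κ => frontEquiv _ _ _ _ (Sum.inl (A.out κ))) with hD
    have hprob : ∀ κ (c : Bits (S.ctLen κ)), D.prob κ (ket c) =
        A.prob κ (tensor (bb84State (ω κ).1 (ω κ).2) (ket c)) := by
      intro κ c
      rw [hD, Distinguisher.ofWork_prob]
      refine (outProb_map (frontEquiv (Fin κ) (Fin (S.ctLen κ)) (Fin (A.adviceLen κ)) Empty)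
        (A.circ κ) (A.out κ) _).trans ?_
      rw [Fintype.sum_unique]
      simp only [tensor_front, one_mul]
      rfl
    have h := hS (fun κ => Fin.snoc (ω κ).2 (false ^^ maskBit (ω κ).1 (ω κ).2))
      (fun κ => Fin.snoc (ω κ).2 (true ^^ maskBit (ω κ).1 (ω κ).2)) D ?_ ?_
    · simpa only [hprob] using h
    · refine Distinguisher.ofWork_QPT ?_ (hQ.2.mono fun κ => (Circuit.size_map _ _).le)
      refine (polyBounded_id.add hQ.1).mono fun κ => ?_
      simp
    · refine Distinguisher.ofWork_inTime ?_
      obtain ⟨c, hc⟩ := hT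
      exact ⟨c, fun κ => (Circuit.depth_map _ _).le.trans (hc κ)⟩
  obtain ⟨g, hg, hle⟩ := negl_uniform (Ω := fun κ => Bits κ × Bits κ) (fun κ ω =>
    |avg (fun r => A.prob κ (tensor (bb84State ω.1 ω.2) (ket (S.enc κ
        (Fin.snoc ω.2 (false ^^ maskBit ω.1 ω.2)) r)))) -
      avg (fun r => A.prob κ (tensor (bb84State ω.1 ω.2) (ket (S.enc κ
        (Fin.snoc ω.2 (true ^^ maskBit ω.1 ω.2)) r))))|) key
  refine hg.mono fun κ _ => ?_
  have havg : ∀ b, avg (fun r => A.prob κ ((compile S).ct κ b r)) =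
      avg (fun x => avg (fun θ => avg (fun r => A.prob κ (tensor (bb84State x θ) (ket (S.enc κ
        (Fin.snoc θ (b ^^ maskBit x θ)) r)))))) := fun b =>
    avg_coins fun x θ r => A.prob κ (tensor (bb84State x θ) (ket (S.enc κ
        (Fin.snoc θ (b ^^ maskBit x θ)) r)))
  rw [havg, havg]
  exact abs_avg_sub_le fun x => abs_avg_sub_le fun θ => hle κ (x, θ)

end Compile

end RevTRE

/-! ### Residual operators, and testing parities of the certificate -/

namespace RevTRE

open Matrix

/-! ### Residual states -/

section Residual
variable {n l a ρ : ℕ}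

/-- The operator that maps the quantum part of the ciphertext to the residual state. -/
noncomputable def residMat (U : Matrix ((Fin n ⊕ Fin l) ⊕ Fin a → Bool)
    ((Fin n ⊕ Fin l) ⊕ Fin a → Bool) ℂ) (adv : Vec (Fin a))
    (split : (Fin n ⊕ Fin l) ⊕ Fin a ≃ Fin n ⊕ Fin ρ) (c : Bits l) (x' : Bits n) :
    Matrix (Bits ρ) (Bits n) ℂ := fun u z =>
  (U *ᵥ tensor (tensor (ket z) (ket c)) adv) ((splitBits split.symm).symm (x', u))

variable {U : Matrix ((Fin n ⊕ Fin l) ⊕ Fin a → Bool) ((Fin n ⊕ Fin l) ⊕ Fin a → Bool) ℂ}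
  {adv : Vec (Fin a)} {split : (Fin n ⊕ Fin l) ⊕ Fin a ≃ Fin n ⊕ Fin ρ}

/-- The matrix is given by its columns on basis states; linearity extends this to all states. -/
theorem residMat_mulVec (c : Bits l) (x' : Bits n) (φ : Vec (Fin n)) (u : Bits ρ) :
    (residMat U adv split c x' *ᵥ φ) u =
      (U *ᵥ tensor (tensor φ (ket c)) adv) ((splitBits split.symm).symm (x', u)) := by
  simp only [residMat, mulVec, dotProduct, Finset.sum_mul]
  rw [Finset.sum_comm]
  refine Finset.sum_congr rfl fun w _ => ?_
  have h : ∀ z, U ((splitBits split.symm).symm (x', u)) w *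
      tensor (tensor (ket z) (ket c)) adv w * φ z =
      if (fun q => w (Sum.inl (Sum.inl q))) = z then U ((splitBits split.symm).symm (x', u)) w *
        tensor (tensor φ (ket c)) adv w else 0 := by
    intro z
    by_cases hz : (fun q => w (Sum.inl (Sum.inl q))) = z
    · simp only [tensor, ket, if_pos hz]
      rw [hz]
      ring
    · simp only [tensor, ket, if_neg hz]
      ring
  simp only [h, Finset.sum_ite_eq, Finset.mem_univ, if_true]

/-- The circuit is unitary and the ancillary states are unit vectors, so splitting the output by
certificate preserves the total norm. -/
theorem sum_normSq_residMat (hU : U ∈ unitaryGroup ((Fin n ⊕ Fin l) ⊕ Fin a → Bool) ℂ)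
    (hadv : normSq adv = 1) (c : Bits l) (φ : Vec (Fin n)) :
    ∑ x', normSq (residMat U adv split c x' *ᵥ φ) = normSq φ := by
  have h : normSq (U *ᵥ tensor (tensor φ (ket c)) adv) = normSq φ := by
    rw [normSq_mulVec hU, normSq_tensor, normSq_tensor, normSq_ket, hadv, mul_one, mul_one]
  rw [← h, normSq, ← (splitBits split.symm).symm.sum_comp, Fintype.sum_prod_type]
  refine Finset.sum_congr rfl fun x' _ => Finset.sum_congr rfl fun u _ => ?_
  rw [residMat_mulVec]

end Residual

theorem chi_eq_listParity {n : ℕ} (T : Finset (Fin n)) (x : Bits n) :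
    chi T x = if listParity x T.toList = true then -1 else 1 := by
  have h : ∀ l : List (Fin n), (l.map fun i => sgn (x i)).prod = sgn (listParity x l) := by
    intro l
    induction l with
    | nil => simp [listParity, sgn]
    | cons i l ih =>
      rw [List.map_cons, List.prod_cons, ih, ← sgn_xor]
      rfl
  rw [chi, ← Finset.prod_map_toList, h]
  rfl

theorem listParity_map {W W' : Type} (z : W' → Bool) (f : W → W') (l : List W) :
    listParity z (l.map f) = listParity (fun w => z (f w)) l := by
  induction l with
  | nil => rfl
  | cons w l ih =>
    rw [List.map_cons]
    change (z (f w) ^^ listParity z (l.map f)) = (z (f w) ^^ listParity (fun w => z (f w)) l)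
    rw [ih]

section ParityTest

section General
variable {W W' : Type} [Fintype W] [DecidableEq W] [Fintype W'] [DecidableEq W']

theorem splitBits_symm_inl {V : Type} (e : W ⊕ V ≃ W') (u : W → Bool) (v : V → Bool) (w : W) :
    (splitBits e).symm (u, v) (e (Sum.inl w)) = u w := by
  simp [splitBits]

theorem splitBits_symm_inr {V : Type} (e : W ⊕ V ≃ W') (u : W → Bool) (v : V → Bool) (w : V) :
    (splitBits e).symm (u, v) (e (Sum.inr w)) = v w := by
  simp [splitBits]

theorem update_splitBits_symm (e : W ⊕ Unit ≃ W') (u : W → Bool) (v : Unit → Bool) (b : Bool) :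
    Function.update ((splitBits e).symm (u, v)) (e (Sum.inr ())) b =
      (splitBits e).symm (u, fun _ => b) := by
  funext w'
  obtain ⟨w | w, rfl⟩ := e.surjective w'
  · rw [Function.update_of_ne (by simp), splitBits_symm_inl, splitBits_symm_inl]
  · rw [Function.update_self, splitBits_symm_inr]

/-- Runs `C` and adds the parity of a list of wires to an additional wire. -/
noncomputable def parityTest (e : W ⊕ Unit ≃ W') (C : Circuit W) (ws : List W) : Circuit W' :=
  Circuit.map e C ++ parityCircuit (e (Sum.inr ()))
    (ws.map fun w => ⟨e (Sum.inl w), by simp⟩)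

theorem parityTest_mulVec (e : W ⊕ Unit ≃ W') (C : Circuit W) (ws : List W) (Φ : Vec W')
    (u : W → Bool) (v : Unit → Bool) :
    (Circuit.op (parityTest e C ws) *ᵥ Φ) ((splitBits e).symm (u, v)) =
      (Circuit.op C *ᵥ fun u' => Φ ((splitBits e).symm (u', fun _ => v () ^^ listParity u ws)))
        u := by
  rw [parityTest, Circuit.op_append, ← mulVec_mulVec, parityCircuit_mulVec,
    update_splitBits_symm, Circuit.op_map, extend_mulVec, List.map_map, listParity_map,
    splitBits_symm_inr]
  simp only [Function.comp_apply, splitBits_symm_inl]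

theorem parityTest_size (e : W ⊕ Unit ≃ W') (C : Circuit W) (ws : List W) :
    (parityTest e C ws).size = C.size + ws.length := by
  rw [parityTest, Circuit.size_append, Circuit.size_map, parityCircuit_size, List.length_map]

theorem parityTest_depth (e : W ⊕ Unit ≃ W') (C : Circuit W) (ws : List W) :
    (parityTest e C ws).depth = C.depth + ws.length := by
  rw [parityTest, Circuit.depth_append, Circuit.depth_map, parityCircuit_depth, List.length_map]

end General

variable {n l a ρ : ℕ}

/-- The additional wire starts at zero and ends with the parity of the certificate, so its output
probability is that of an odd parity. -/
theorem outProb_parityTest (C : Circuit ((Fin n ⊕ Fin l) ⊕ Fin a)) (adv : Vec (Fin a))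
    (split : (Fin n ⊕ Fin l) ⊕ Fin a ≃ Fin n ⊕ Fin ρ) (T : Finset (Fin n)) (c : Bits l)
    (φ : Vec (Fin n)) :
    outProb (parityTest (frontEquiv _ _ _ _) C (T.toList.map fun i => split.symm (Sum.inl i)))
      (frontEquiv _ _ _ _ (Sum.inr ()))
      (tensor (ket c) (tensor (tensor φ adv) (ket fun _ => false))) =
    ∑ x', if listParity x' T.toList = true
      then normSq (residMat (Circuit.op C) adv split c x' *ᵥ φ) else 0 := by
  set e := frontEquiv (Fin n) (Fin l) (Fin a) Unit with he
  rw [outProb, ← (splitBits e).symm.sum_comp, Fintype.sum_prod_type,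
    ← (splitBits split.symm).symm.sum_comp, Fintype.sum_prod_type]
  refine Finset.sum_congr rfl fun x' _ => ?_
  have h1 : ∀ u : Bits ρ, listParity ((splitBits split.symm).symm (x', u))
      (T.toList.map fun i => split.symm (Sum.inl i)) = listParity x' T.toList := by
    intro u
    rw [listParity_map]
    simp only [splitBits_symm_inl]
  -- The initial state of the additional wire kills every slice but one.
  have h2 : ∀ (b : Bool) (u : (Fin n ⊕ Fin l) ⊕ Fin a → Bool),
      (Circuit.op C *ᵥ fun u' => ket (fun _ : Unit => false) (fun _ => b) *
        tensor (tensor φ (ket c)) adv u') u =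
      if b = false then (Circuit.op C *ᵥ tensor (tensor φ (ket c)) adv) u else 0 := by
    intro b u
    cases b <;> simp [ket, mulVec, dotProduct, funext_iff]
  rw [normSq, Finset.ite_sum_zero]
  refine Finset.sum_congr rfl fun u _ => ?_
  rw [← (Equiv.funUnique Unit Bool).symm.sum_comp, Fintype.sum_bool]
  simp only [splitBits_symm_inr, parityTest_mulVec, h1, he, tensor_front, h2, residMat_mulVec]
  cases listParity x' T.toList <;> simp

end ParityTest

/-! ### The certificate is nearly independent of the basis -/

section Revocable
variable {S : TRE (fun κ => κ + 1)} {T : ℕ → ℕ}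

/-- The operators of the deletion experiment of an adversary. -/
noncomputable def expOps (A : RTRE.Adversary (compile S)) (κ : ℕ) :
    ExpOps κ (S.coinLen κ) (A.restLen κ) := fun θ b r x' =>
  residMat (n := κ) (l := S.ctLen κ) (Circuit.op (A.circ₁ κ)) (A.advice κ) (A.split κ)
    (S.enc κ (Fin.snoc θ b) r) x'

theorem expOps_isometric (A : RTRE.Adversary (compile S)) (κ : ℕ) : (expOps A κ).Isometric :=
  fun _ _ _ φ => sum_normSq_residMat (Circuit.op_mem_unitaryGroup (A.circ₁ κ)) (A.advice_norm κ)
    _ φ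

/-- The distribution of the certificate for the state `|y⟩` in the Hadamard basis and an
encryption of `m`. -/
noncomputable def certProb (A : RTRE.Adversary (compile S)) (κ : ℕ) (m : Bits (κ + 1))
    (y x' : Bits κ) : ℝ :=
  avg fun r => normSq (residMat (n := κ) (l := S.ctLen κ) (Circuit.op (A.circ₁ κ)) (A.advice κ)
    (A.split κ) (S.enc κ m r) x' *ᵥ hadState y)

theorem certProb_nonneg (A : RTRE.Adversary (compile S)) (κ : ℕ) (m : Bits (κ + 1))
    (y x' : Bits κ) : 0 ≤ certProb A κ m y x' := avg_nonneg fun _ => normSq_nonneg _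

theorem sum_certProb (A : RTRE.Adversary (compile S)) (κ : ℕ) (m : Bits (κ + 1)) (y : Bits κ) :
    ∑ x', certProb A κ m y x' = 1 := by
  simp only [certProb]
  rw [← avg_sum]
  refine Eq.trans (congrArg avg (funext fun r => ?_)) (avg_const 1)
  exact (sum_normSq_residMat (Circuit.op_mem_unitaryGroup (A.circ₁ κ)) (A.advice_norm κ) _
    _).trans (normSq_hadState y)

/-- No parity of the certificate depends noticeably on the encrypted message. -/
theorem exists_negl_parity (hS : S.Hiding T) {A : RTRE.Adversary (compile S)} (hQ : A.QPT)
    (hT : A.InTime T) : ∃ δ : ℕ → ℝ, Negl δ ∧ ∀ κ (Tc : Finset (Fin κ)) m y,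
      |∑ x', (certProb A κ m y x' - certProb A κ (fun _ => false) y x') * chi Tc x'| ≤ δ κ := by
  have key : ∀ ω : ∀ κ, Finset (Fin κ) × Bits (κ + 1) × Bits κ, Negl (fun κ =>
      |∑ x', (certProb A κ (ω κ).2.1 (ω κ).2.2 x' - certProb A κ (fun _ => false) (ω κ).2.2 x') *
        chi (ω κ).1 x'|) := by
    intro ω
    set D : Distinguisher (fun κ => Fin (S.ctLen κ)) := Distinguisher.ofWork
      (K := fun κ => (Fin κ ⊕ Fin (A.adviceLen κ)) ⊕ Unit)
      (fun κ => tensor (tensor (hadState (ω κ).2.2) (A.advice κ)) (ket fun _ => false))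
      (fun κ => by
        rw [normSq_tensor, normSq_tensor, normSq_hadState, A.advice_norm, normSq_ket]
        norm_num)
      (fun κ => parityTest (frontEquiv _ _ _ _) (A.circ₁ κ)
        ((ω κ).1.toList.map fun i => (A.split κ).symm (Sum.inl i)))
      (fun κ => frontEquiv _ _ _ _ (Sum.inr ())) with hD
    have hprob : ∀ κ (c : Bits (S.ctLen κ)), D.prob κ (ket c) =
        ∑ x', if listParity x' (ω κ).1.toList = true then
          normSq (residMat (n := κ) (l := S.ctLen κ) (Circuit.op (A.circ₁ κ)) (A.advice κ)
            (A.split κ) c x' *ᵥ hadState (ω κ).2.2) else 0 := by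
      intro κ c
      rw [hD, Distinguisher.ofWork_prob]
      exact outProb_parityTest (n := κ) (l := S.ctLen κ) (A.circ₁ κ) (A.advice κ) (A.split κ)
        (ω κ).1 c (hadState (ω κ).2.2)
    -- The expectation of a sign is one minus twice the probability that it is negative.
    have havg : ∀ κ (m : Bits (κ + 1)), ∑ x', certProb A κ m (ω κ).2.2 x' * chi (ω κ).1 x' =
        1 - 2 * avg (fun r => D.prob κ (ket (S.enc κ m r))) := by
      intro κ m
      have h1 : ∀ x', certProb A κ m (ω κ).2.2 x' * chi (ω κ).1 x' =
          certProb A κ m (ω κ).2.2 x' - 2 * if listParity x' (ω κ).1.toList = true then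
            certProb A κ m (ω κ).2.2 x' else 0 := by
        intro x'
        rw [chi_eq_listParity]
        split_ifs <;> ring
      simp only [h1, Finset.sum_sub_distrib, sum_certProb, ← Finset.mul_sum, hprob]
      rw [avg_sum]
      congr 2
      refine Finset.sum_congr rfl fun x' _ => ?_
      split_ifs
      · rfl
      · exact (avg_const 0).symm
    have hlen : ∀ κ, ((ω κ).1.toList.map fun i => (A.split κ).symm (Sum.inl i)).length ≤ κ :=
      fun κ => (List.length_map _).trans_le ((Finset.length_toList _).trans_le
        ((ω κ).1.card_le_univ.trans_eq (Fintype.card_fin κ)))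
    have hDQ : D.QPT := by
      refine Distinguisher.ofWork_QPT ?_ ?_
      · refine ((polyBounded_id.add hQ.1).add (polyBounded_const 1)).mono fun κ => ?_
        simp
      · refine (hQ.2.add polyBounded_id).mono fun κ => ?_
        refine (parityTest_size _ _ _).le.trans ((add_le_add le_rfl (hlen κ)).trans ?_)
        exact Nat.add_le_add_right (Nat.le_add_right _ _) κ
    have hDT : D.InTime T := by
      refine Distinguisher.ofWork_inTime ?_
      obtain ⟨c, hc⟩ := hT
      -- The parity adds at most `κ` layers, which the linear allowance absorbs.
      refine ⟨c + 1, fun κ => ?_⟩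
      refine (parityTest_depth _ _ _).le.trans ((add_le_add le_rfl (hlen κ)).trans ?_)
      refine (Nat.add_le_add_right ((Nat.le_add_right _ _).trans (hc κ)) κ).trans ?_
      rw [add_mul]
      omega
    -- Neither `y` nor the parity set is part of the message, so both belong to the distinguisher,
    -- and the message can be exchanged for the zero string. The factor two comes from passing from
    -- probabilities to signs.
    have h := (hS (fun κ => (ω κ).2.1) (fun κ _ => false) D hDQ hDT).const_mul zero_le_two
    refine h.mono fun κ _ => ?_
    simp only [sub_mul, Finset.sum_sub_distrib, havg]
    rw [sub_sub_sub_cancel_left, ← mul_sub, abs_mul, abs_two, abs_sub_comm]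
  obtain ⟨g, hg, hle⟩ := negl_uniform (Ω := fun κ => Finset (Fin κ) × Bits (κ + 1) × Bits κ)
    (fun κ ω => |∑ x', (certProb A κ ω.2.1 ω.2.2 x' - certProb A κ (fun _ => false) ω.2.2 x') *
        chi ω.1 x'|) key
  exact ⟨g, hg, fun κ Tc m y => hle κ (Tc, m, y)⟩

/-- The reference distribution is that of the certificate when the zero string is encrypted: it does
not depend on `θ`. Every moment order `s` gives a bound of order `κ^{-s}` up to a negligible
function. -/
theorem negl_badProb (hS : S.Hiding T) {A : RTRE.Adversary (compile S)} (hQ : A.QPT)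
    (hT : A.InTime T) : Negl (fun κ => (expOps A κ).badProb) := by
  obtain ⟨δ, hδ, hle⟩ := exists_negl_parity hS hQ hT
  refine negl_of_forall_pow fun s => ?_
  obtain ⟨C, hC⟩ := exists_pow_mul_half_pow_le s
  refine ⟨2 * (8 ^ s * C), _, ((negl_geometric (a := 97 / 108) (by norm_num) (by norm_num)).add
    (hδ.const_mul (C := 8 ^ s) (by positivity))).const_mul zero_le_two, fun κ hκ => ?_⟩
  have h := (expOps_isometric A κ).badProb_le hκ (certProb_nonneg A κ fun _ => false)
    (sum_certProb A κ _) (δ := δ κ) (fun Tc b θ y => hle κ Tc (Fin.snoc θ b) y) hC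
  linarith

theorem negl_cross (hS : S.Hiding T) {A : RTRE.Adversary (compile S)} (hQ : A.QPT)
    (hT : A.InTime T) : Negl (fun κ => (expOps A κ).cross) :=
  negl_of_amgm (D := 2) (negl_badProb hS hQ hT) zero_le_one fun κ C hC => by
    rw [one_mul]
    exact (expOps_isometric A κ).cross_le hC

end Revocable

end RevTRE

/-! ### The two deletion experiments of the compiled scheme -/

namespace RevTRE

open Matrix

/-! ### Revocable hiding -/

section Revocable
variable {S : TRE (fun κ => κ + 1)} {T : ℕ → ℕ}

theorem compile_ver (κ : ℕ) (b : Bool) (r : Bits (κ + κ + S.coinLen κ)) (x' : Bits κ) :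
    (compile S).ver κ ((compile S).encVk κ b r) x' =
      decide (x' ∈ agreeSet (coinTheta r) (coinX r)) := by
  simp only [compile, mem_agreeSet]
  refine decide_eq_decide.mpr (forall_congr' fun i => ?_)
  rw [Fin.append_left, Fin.append_right]
  exact imp_congr_right fun _ => eq_comm

theorem residual_eq (A : RTRE.Adversary (compile S)) (κ : ℕ) (b : Bool)
    (r : Bits (κ + κ + S.coinLen κ)) (x' : Bits κ) :
    A.residual κ b r x' = (expOps A κ).state b r x' := by
  funext u
  exact (residMat_mulVec (n := κ) (l := S.ctLen κ) _ x' (bb84State (coinX r) (coinTheta r))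
    u).symm

theorem evExp_eq (A : RTRE.Adversary (compile S)) (κ : ℕ) (b : Bool) :
    A.evExp κ b = (expOps A κ).evMat b := by
  have hv := compile_ver (S := S) κ b
  have hr := residual_eq A κ b
  ext o o'
  cases o with
  | none =>
    cases o' with
    | none =>
      simp only [RTRE.Adversary.evExp, ExpOps.evMat]
      congr 2
      funext r
      change Bits (κ + κ + S.coinLen κ) at r
      refine Finset.sum_congr rfl fun x' _ => ?_
      change Bits κ at x'
      refine if_congr ?_ rfl (congrArg normSq (hr r x'))
      rw [hv]
      exact decide_eq_true_iff
    | some v => rfl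
  | some u =>
    cases o' with
    | none => rfl
    | some v =>
      simp only [RTRE.Adversary.evExp, ExpOps.evMat]
      congr 1
      refine Finset.sum_congr rfl fun r _ => Finset.sum_congr rfl fun x' _ => ?_
      change Bits (κ + κ + S.coinLen κ) at r
      change Bits κ at x'
      refine if_congr ?_ ?_ rfl
      · rw [hv]
        exact decide_eq_true_iff
      · rw [hr r x']

/-- The operator of a circuit with an additional input bit, followed by the projection to the
outputs in which wire `o` is `1`. -/
noncomputable def acceptOp {ρ : ℕ} (C : Circuit (Fin ρ ⊕ Unit)) (o : Fin ρ ⊕ Unit) (ν : Bool) :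
    Matrix (Fin ρ ⊕ Unit → Bool) (Bits ρ) ℂ := fun z u =>
  if z o = true then (Circuit.op C *ᵥ tensor (ket u) (ket fun _ => ν)) z else 0

theorem acceptOp_mulVec {ρ : ℕ} (C : Circuit (Fin ρ ⊕ Unit)) (o : Fin ρ ⊕ Unit) (ν : Bool)
    (φ : Vec (Fin ρ)) (z : Fin ρ ⊕ Unit → Bool) :
    (acceptOp C o ν *ᵥ φ) z =
      if z o = true then (Circuit.op C *ᵥ tensor φ (ket fun _ => ν)) z else 0 := by
  have h : tensor φ (ket fun _ => ν) = ∑ u, φ u • tensor (ket u) (ket fun _ : Unit => ν) := by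
    funext w
    simp [tensor, ket, Finset.sum_apply]
  rw [h, mulVec_sum, mulVec, dotProduct, Finset.sum_apply, Finset.ite_sum_zero]
  refine Finset.sum_congr rfl fun u _ => ?_
  rw [acceptOp, mulVec_smul, Pi.smul_apply, smul_eq_mul, mul_comm]
  split_ifs <;> simp

theorem sum_norm_acceptOp {ρ : ℕ} (C : Circuit (Fin ρ ⊕ Unit)) (o : Fin ρ ⊕ Unit) (ν : Bool)
    (φ : Vec (Fin ρ)) :
    ∑ z, ‖(acceptOp C o ν *ᵥ φ) z‖ ^ 2 = outProb C o (tensor φ (ket fun _ => ν)) := by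
  refine Finset.sum_congr rfl fun z _ => ?_
  rw [acceptOp_mulVec]
  split_ifs <;> simp

theorem outProb_le {W : Type} [Fintype W] [DecidableEq W] (C : Circuit W) (o : W) (φ : Vec W) :
    outProb C o φ ≤ normSq φ := by
  rw [← normSq_mulVec (Circuit.op_mem_unitaryGroup C) φ]
  refine Finset.sum_le_sum fun z _ => ?_
  split_ifs
  · exact le_rfl
  · positivity

/-- A unitary followed by a projection is a contraction, so the bound by `cross` covers the second
stage of the adversary for either verdict. -/
theorem sum_norm_acceptOp_le {ρ : ℕ} (C : Circuit (Fin ρ ⊕ Unit)) (o : Fin ρ ⊕ Unit) (ν : Bool)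
    (φ : Vec (Fin ρ)) : ∑ z, ‖(acceptOp C o ν *ᵥ φ) z‖ ^ 2 ≤ normSq φ := by
  rw [sum_norm_acceptOp]
  refine (outProb_le C o _).trans_eq ?_
  rw [normSq_tensor, normSq_ket, mul_one]

/-- Places the residual register and the verification bit in the register of a distinguisher. -/
def secondEquiv {W a ρ n : Type} (split : W ⊕ a ≃ n ⊕ ρ) : (ρ ⊕ Unit) ⊕ n ≃ W ⊕ (a ⊕ Unit) :=
  ((Equiv.sumComm _ _).trans ((Equiv.sumAssoc _ _ _).symm.trans
    (Equiv.sumCongr split.symm (Equiv.refl Unit)))).trans (Equiv.sumAssoc _ _ _)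

/-- The second circuit never touches the certificate wires. Measuring them between the two circuits
therefore has the same effect as leaving them alone. -/
theorem outProb_second {W : Type} [Fintype W] [DecidableEq W] {a ρ n : ℕ}
    (split : W ⊕ Fin a ≃ Fin n ⊕ Fin ρ) (C : Circuit (W ⊕ Fin a)) (C₂ : Circuit (Fin ρ ⊕ Unit))
    (o : Fin ρ ⊕ Unit) (φ : Vec W) (adv : Vec (Fin a)) :
    outProb (Circuit.map (Equiv.sumAssoc W (Fin a) Unit) C ++ Circuit.map (secondEquiv split) C₂)
      (secondEquiv split (Sum.inl o)) (tensor φ (tensor adv (ket fun _ => false))) =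
    ∑ x', outProb C₂ o (tensor (fun u => (Circuit.op C *ᵥ tensor φ adv)
      fun w => Sum.elim x' u (split w)) (ket fun _ => false)) := by
  have h : outProb (Circuit.map (Equiv.sumAssoc W (Fin a) Unit) C ++
      Circuit.map (secondEquiv split) C₂) (secondEquiv split (Sum.inl o))
      (tensor φ (tensor adv (ket fun _ => false))) =
      outProb (Circuit.map (secondEquiv split) C₂) (secondEquiv split (Sum.inl o))
      (extend (Equiv.sumAssoc W (Fin a) Unit) (Circuit.op C) *ᵥ
        tensor φ (tensor adv (ket fun _ => false))) := by
    simp only [outProb, Circuit.op_append, Circuit.op_map (Equiv.sumAssoc W (Fin a) Unit),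
      mulVec_mulVec]
  rw [h, outProb_map]
  refine Finset.sum_congr rfl fun x' _ => ?_
  congr 1
  funext u
  -- The two ways of dividing the register, by certificate and residue or by ciphertext, advice and
  -- verdict, describe the same basis states.
  have h2 : (splitBits (secondEquiv split)).symm (u, x') =
      (splitBits (Equiv.sumAssoc W (Fin a) Unit)).symm
        (fun w => Sum.elim x' (fun i => u (Sum.inl i)) (split w), fun i => u (Sum.inr i)) := by
    funext w
    obtain ⟨w | w, rfl⟩ := (Equiv.sumAssoc W (Fin a) Unit).surjective w
    · rw [splitBits_symm_inl]
      obtain ⟨w, rfl⟩ := split.symm.surjective w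
      cases w <;> simp [splitBits, secondEquiv]
    · rw [splitBits_symm_inr]
      simp [splitBits, secondEquiv]
  rw [h2, extend_mulVec]
  simp only [tensor, mulVec, dotProduct, Finset.sum_mul]
  refine Finset.sum_congr rfl fun w _ => ?_
  simp [splitBits]
  ring

/-- Acceptance is not computable by the adversary, so rejected runs are not reduced to hiding
directly. They are written as all runs with verdict false minus the accepted runs with that verdict.
-/
theorem cExp_eq (A : RTRE.Adversary (compile S)) (κ : ℕ) (b : Bool) :
    A.cExp κ b =
      avg (n := κ + κ + S.coinLen κ) (fun r => ∑ x', if x' ∈ agreeSet (coinTheta r) (coinX r) then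
        ∑ z, ‖(acceptOp (A.circ₂ κ) (A.out κ) true *ᵥ (expOps A κ).state b r x') z‖ ^ 2 else 0) +
      (avg (n := κ + κ + S.coinLen κ) (fun r => ∑ x', ∑ z,
        ‖(acceptOp (A.circ₂ κ) (A.out κ) false *ᵥ (expOps A κ).state b r x') z‖ ^ 2) -
      avg (n := κ + κ + S.coinLen κ) (fun r => ∑ x', if x' ∈ agreeSet (coinTheta r) (coinX r) then
        ∑ z, ‖(acceptOp (A.circ₂ κ) (A.out κ) false *ᵥ (expOps A κ).state b r x') z‖ ^ 2
        else 0)) := by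
  rw [← avg_sub, ← avg_add]
  refine congrArg avg (funext fun r => ?_)
  rw [← Finset.sum_sub_distrib, ← Finset.sum_add_distrib]
  refine Finset.sum_congr rfl fun x' _ => ?_
  change Bits (κ + κ + S.coinLen κ) at r
  change Bits κ at x'
  have hr := residual_eq A κ b r x'
  have hv := compile_ver (S := S) κ b r x'
  simp only [sum_norm_acceptOp, ← hr]
  by_cases h : x' ∈ agreeSet (coinTheta r) (coinX r)
  · rw [if_pos h, if_pos h, sub_self, add_zero, outProb]
    have hv' : (compile S).ver κ ((compile S).encVk κ b r) x' = true := by simpa [h] using hv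
    simp only [hv']
  · rw [if_neg h, if_neg h, sub_zero, zero_add, outProb]
    have hv' : (compile S).ver κ ((compile S).encVk κ b r) x' = false := by simpa [h] using hv
    simp only [hv']

/-- The everlasting part is the bound by `cross`. For the other part, two accepted terms cost
`cross` each, and the middle term is an instance of plain hiding. -/
theorem compile_revocablyHiding (hS : S.Hiding T) : (compile S).RevocablyHiding T := by
  intro A hQ hT
  have hcross := negl_cross hS hQ hT
  refine ⟨hcross.mono fun κ _ => ?_, ?_⟩
  · rw [evExp_eq, evExp_eq]
    exact (expOps_isometric A κ).traceDist_evMat_le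
  -- Both stages of the adversary with the verdict bit hardwired to false; no verification key is
  -- needed, and the depth is unchanged.
  · set D : Distinguisher (compile S).CtWires := Distinguisher.ofWork
      (K := fun κ => Fin (A.adviceLen κ) ⊕ Unit)
      (fun κ => tensor (A.advice κ) (ket fun _ => false))
      (fun κ => by rw [normSq_tensor, A.advice_norm, normSq_ket, mul_one])
      (fun κ => Circuit.map (Equiv.sumAssoc _ _ _) (A.circ₁ κ) ++
        Circuit.map (secondEquiv (A.split κ)) (A.circ₂ κ))
      (fun κ => secondEquiv (A.split κ) (Sum.inl (A.out κ))) with hD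
    have hprob : ∀ κ b r, D.prob κ ((compile S).ct κ b r) = ∑ x', ∑ z,
        ‖(acceptOp (A.circ₂ κ) (A.out κ) false *ᵥ (expOps A κ).state b r x') z‖ ^ 2 := by
      intro κ b r
      rw [hD, Distinguisher.ofWork_prob, outProb_second]
      refine Finset.sum_congr rfl fun x' _ => ?_
      rw [sum_norm_acceptOp, ← residual_eq A κ b r x']
      rfl
    have hDQ : D.QPT := by
      refine Distinguisher.ofWork_QPT ?_ (hQ.2.mono fun κ => ?_)
      · exact (hQ.1.add (polyBounded_const 1)).mono fun κ => by simp
      · rw [Circuit.size_append, Circuit.size_map, Circuit.size_map]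
    have hDT : D.InTime T := by
      refine Distinguisher.ofWork_inTime ?_
      obtain ⟨c, hc⟩ := hT
      refine ⟨c, fun κ => ?_⟩
      dsimp only
      rw [Circuit.depth_append, Circuit.depth_map, Circuit.depth_map]
      exact hc κ
    refine ((hcross.add (compile_hiding hS D hDQ hDT)).add hcross).mono fun κ _ => ?_
    rw [cExp_eq, cExp_eq]
    simp only [hprob]
    have h1 := (expOps A κ).abs_accept_sub_le
      (sum_norm_acceptOp_le (A.circ₂ κ) (A.out κ) true)
    have h2 := (expOps A κ).abs_accept_sub_le
      (sum_norm_acceptOp_le (A.circ₂ κ) (A.out κ) false)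
    have tri : ∀ a b c a' b' c' X Y : ℝ, |a - a'| ≤ X → |c - c'| ≤ X → |b - b'| = Y →
        |a + (b - c) - (a' + (b' - c'))| ≤ X + Y + X := by
      intro a b c a' b' c' X Y h1 h2 h3
      rw [abs_le] at h1 h2 ⊢
      have h4 := abs_le.mp h3.le
      constructor <;> linarith
    exact tri _ _ _ _ _ _ _ _ h1 h2 rfl

end Revocable

end RevTRE

/-! ### Correctness of decryption and deletion -/

namespace RevTRE

open Matrix

/-! ### Correctness -/

theorem measProb_nonneg {q : ℕ} (U : unitaryGroup (Bits q) ℂ) (φ : Vec (Fin q)) (y : Bits q) :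
    0 ≤ measProb U φ y := sq_nonneg _

theorem sum_measProb {q : ℕ} (U : unitaryGroup (Bits q) ℂ) (φ : Vec (Fin q)) :
    ∑ y, measProb U φ y = normSq φ := by
  rw [← normSq_mulVec (star U).2 φ]
  rfl

/-- Measuring `|x⟩_θ` in its own basis yields `x`. -/
theorem measProb_bb84State {n : ℕ} (x θ y : Bits n) :
    measProb ⟨bb84 θ, bb84_mem θ⟩ (bb84State x θ) y = if y = x then 1 else 0 := by
  have h := congrFun (congrFun (mem_unitaryGroup_iff'.mp (bb84_mem θ)) y) x
  rw [mul_apply, one_apply] at h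
  simp only [star_apply] at h
  rw [measProb]
  simp only [bb84State]
  rw [h]
  split_ifs <;> simp

/-- If `|x⟩_θ` is measured in the Hadamard basis, then `x` is obtained where `θ` is `1`. -/
theorem measProb_hadamard {n : ℕ} {x θ y : Bits n} (h : y ∉ agreeSet θ x) :
    measProb ⟨bb84 fun _ => true, bb84_mem _⟩ (bb84State x θ) y = 0 := by
  have hex : ∃ i, θ i = true ∧ y i ≠ x i := by
    by_contra hc
    push Not at hc
    exact h (mem_agreeSet.mpr hc)
  obtain ⟨i, hi, hne⟩ := hex
  have hz : ∑ z : Bits n, star (bb84 (fun _ => true) z y) * bb84 θ z x = 0 := by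
    simp only [bb84, star_prod, if_true, ← Finset.prod_mul_distrib]
    rw [sum_prod_bits (fun i a => star (hadamard a (y i)) *
      (if θ i = true then hadamard else 1) a (x i))]
    refine Finset.prod_eq_zero (Finset.mem_univ i) ?_
    have hq := bb84_qubit true (y i) (x i)
    simpa [hi, hne] using hq
  rw [measProb]
  simp only [bb84State]
  rw [hz, norm_zero]
  norm_num

section Compile
variable {S : TRE (fun κ => κ + 1)}

theorem compile_deletionCorrect : (compile S).DeletionCorrect := by
  intro b
  refine negl_zero.mono fun κ _ => le_of_eq ?_
  refine Eq.trans (congrArg avg (funext fun r => ?_)) (avg_const 0)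
  refine Finset.sum_eq_zero fun y _ => ?_
  change Bits (κ + κ + S.coinLen κ) at r
  change Bits κ at y
  have hv := compile_ver (S := S) κ b r y
  by_cases h : y ∈ agreeSet (coinTheta r) (coinX r)
  · refine if_pos ?_
    exact hv.trans (decide_eq_true h)
  · refine (if_neg ?_).trans (measProb_hadamard h)
    intro h'
    exact h (of_decide_eq_true (hv.symm.trans h'))

/-- The error is at most the probability that the inner decryption fails, uniformly over messages,
since the message `(θ, b')` is random here. -/
theorem compile_correct (hS : S.Correct) : (compile S).Correct := by
  intro b
  obtain ⟨g, hg, hle⟩ := negl_uniform (Ω := fun κ => Bits (κ + 1)) (fun κ m =>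
    avg (fun r => avg (fun r' => if S.dec κ (S.enc κ m r) r' = m then 0 else 1))) hS
  refine hg.mono fun κ _ => ?_
  set msg : Bits κ → Bits κ → Bits (κ + 1) := fun x θ => Fin.snoc θ (b ^^ maskBit x θ) with hmsg
  have havg := avg_coins (n := κ) (m := S.coinLen κ) fun x θ r =>
    avg fun r' => if S.dec κ (S.enc κ (msg x θ) r) r' = msg x θ then 0 else 1
  refine le_trans (avg_mono (g := fun r : Bits (κ + κ + S.coinLen κ) =>
    avg fun r' => if S.dec κ (S.enc κ (msg (coinX r) (coinTheta r)) (coinRest r)) r' =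
      msg (coinX r) (coinTheta r) then 0 else 1) fun r => avg_mono fun r' => ?_)
    (havg.trans_le ?_)
  · change Bits (κ + κ + S.coinLen κ) at r
    change Bits (S.decCoinLen κ) at r'
    set m := S.dec κ (S.enc κ (msg (coinX r) (coinTheta r)) (coinRest r)) r' with hm
    have hterm : ∀ y : Bits κ, 0 ≤ measProb ⟨bb84 fun i => m (Fin.castSucc i), bb84_mem _⟩
        (bb84State (coinX r) (coinTheta r)) y := fun y => measProb_nonneg _ _ _
    change (∑ y : Bits κ, if (m (Fin.last κ) ^^ maskBit y fun i => m (Fin.castSucc i)) = b then 0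
      else measProb ⟨bb84 fun i => m (Fin.castSucc i), bb84_mem _⟩
        (bb84State (coinX r) (coinTheta r)) y) ≤ _
    -- If the inner message is recovered, the measurement basis is right and the outcome is `x` with
    -- certainty; if not, the total probability one is a sufficient bound.
    split_ifs with h
    · refine le_of_eq (Finset.sum_eq_zero fun y _ => ?_)
      have h1 : (fun i => m (Fin.castSucc i)) = coinTheta r := by
        rw [h]
        funext i
        exact Fin.snoc_castSucc _ _ _
      have h2 : m (Fin.last κ) = (b ^^ maskBit (coinX r) (coinTheta r)) := by
        rw [h]
        exact Fin.snoc_last _ _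
      simp only [h1, h2, measProb_bb84State]
      split_ifs with h3 h4
      · rfl
      · rw [h4] at h3
        simp at h3
      · rfl
    · refine le_trans (b := ∑ y, measProb ⟨bb84 fun i => m (Fin.castSucc i), bb84_mem _⟩
        (bb84State (coinX r) (coinTheta r)) y) (Finset.sum_le_sum fun y _ => ?_)
        ((sum_measProb _ _).trans (bb84State_norm (coinX r) (coinTheta r))).le
      split_ifs
      · exact hterm y
      · exact le_rfl
  · refine (avg_mono fun x => (avg_mono fun θ => hle κ (msg x θ)).trans (avg_const _).le).trans
      (avg_const _).le

end Compile

end RevTRE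

/-! ### Preparation and measurement as one sweep over the qubits -/

namespace RevTRE

open Matrix

/-! ### Instruction lists for products of one-qubit operators -/

/-- The tensor product of one-qubit matrices. -/
def tensorMat {n : ℕ} (M : Fin n → Matrix Bool Bool ℂ) : Matrix (Bits n) (Bits n) ℂ :=
  fun y z => ∏ i, M i (y i) (z i)

theorem tensorMat_mul {n : ℕ} (M N : Fin n → Matrix Bool Bool ℂ) :
    tensorMat M * tensorMat N = tensorMat fun i => M i * N i := by
  ext y z
  simp only [mul_apply, tensorMat, ← Finset.prod_mul_distrib]
  exact sum_prod_bits fun i a => M i (y i) a * N i a (z i)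

theorem oneQubit_eq_tensorMat {n : ℕ} (p : Fin n) (M : Matrix Bool Bool ℂ) :
    oneQubit n p M = tensorMat fun i => if i = p then M else 1 := by
  ext y z
  have h0 : oneQubit n p M =
      fun y z => if ∀ j, j ≠ p → y j = z j then M (y p) (z p) else 0 := dif_pos p.2
  refine (congrFun (congrFun h0 y) z).trans ?_
  rw [tensorMat, ← Finset.mul_prod_erase _ _ (Finset.mem_univ p), if_pos rfl]
  have h : ∏ i ∈ Finset.univ.erase p, (if i = p then M else 1) (y i) (z i) =
      if ∀ j, j ≠ p → y j = z j then 1 else 0 := by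
    rw [Finset.prod_congr rfl fun i hi => by
      rw [if_neg (Finset.ne_of_mem_erase hi), one_apply], Finset.prod_ite_zero,
      Finset.prod_const_one]
    simp
  rw [h, mul_ite, mul_one, mul_zero]

/-- Negation of a qubit. -/
def notMat : Matrix Bool Bool ℂ := fun a b => if a = b then 0 else 1

/-- The one-qubit operator `H^h X^a`. -/
noncomputable def cellMat (c : Bool × Bool) : Matrix Bool Bool ℂ :=
  (if c.2 = true then hadamard else 1) * if c.1 = true then notMat else 1

/-- Instructions that apply `H^h X^a` and move on. -/
def cellInstr (c : Bool × Bool) : List QInstr :=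
  (if c.1 = true then [QInstr.x] else []) ++ ((if c.2 = true then [QInstr.h] else []) ++
    [QInstr.right])

theorem runInstr_cell {q : ℕ} (p : Fin q) (c : Bool × Bool) (l : List QInstr) :
    runInstr q p (cellInstr c ++ l) = runInstr q (p + 1) l * oneQubit q p (cellMat c) := by
  have h1 : oneQubit q p 1 = 1 := by
    ext y z
    rw [oneQubit_eq_tensorMat, tensorMat]
    simp only [ite_self, one_apply]
    rw [Finset.prod_ite_zero]
    simp [funext_iff]
  have h2 : ∀ M N, oneQubit q p M * oneQubit q p N = oneQubit q p (M * N) := by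
    intro M N
    simp only [oneQubit_eq_tensorMat, tensorMat_mul]
    congr 1
    funext i
    split_ifs <;> simp
  obtain ⟨a, h⟩ := c
  have h3 : (fun a b => if a = b then 0 else 1 : Matrix Bool Bool ℂ) = notMat := rfl
  cases a <;> cases h <;> simp [cellInstr, cellMat, runInstr, h1, mul_assoc, h2, h3]

/-- Induction on the number of qubits still to be visited: the instructions for the last `k` qubits
implement the factors at positions from `p` on. -/
theorem runInstr_drop {q : ℕ} (g : Fin q → Bool × Bool) (k : ℕ) :
    ∀ p, p + k = q → runInstr q p (((List.ofFn g).drop p).flatMap cellInstr) =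
      tensorMat fun i => if p ≤ i then cellMat (g i) else 1 := by
  induction k with
  | zero =>
    intro p hp
    rw [List.drop_eq_nil_of_le (by simp; omega)]
    ext y z
    simp only [List.flatMap_nil, runInstr, tensorMat]
    have h : ∀ i : Fin q, ¬ p ≤ i := fun i => by omega
    simp only [h, if_false, one_apply]
    rw [Finset.prod_ite_zero]
    simp [funext_iff]
  | succ k ih =>
    intro p hp
    have hpq : p < q := by omega
    rw [List.drop_eq_getElem_cons (by simpa using hpq), List.flatMap_cons,
      runInstr_cell ⟨p, hpq⟩, ih (p + 1) (by omega), oneQubit_eq_tensorMat, tensorMat_mul]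
    congr 1
    funext i
    rw [List.getElem_ofFn]
    by_cases h : i = ⟨p, hpq⟩
    · subst h
      simp
    · have h' : (i : ℕ) ≠ p := fun h' => h (Fin.ext h')
      rw [if_neg h, mul_one]
      exact if_congr ⟨fun h => by omega, fun h => by omega⟩ rfl rfl

theorem runInstr_sweep {q : ℕ} (g : Fin q → Bool × Bool) :
    runInstr q 0 ((List.ofFn g).flatMap cellInstr) = tensorMat fun i => cellMat (g i) := by
  have h := runInstr_drop g q 0 (by omega)
  simpa using h

theorem prep_mulVec {q : ℕ} (x θ : Bits q) :
    runInstr q 0 ((List.ofFn fun i => (x i, θ i)).flatMap cellInstr) *ᵥ ket (fun _ => false) =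
      bb84State x θ := by
  rw [runInstr_sweep]
  funext y
  simp only [mulVec, dotProduct, ket, mul_ite, mul_one, mul_zero, Finset.sum_ite_eq',
    Finset.mem_univ, if_true, tensorMat, bb84State, bb84]
  refine Finset.prod_congr rfl fun i _ => ?_
  cases x i <;> simp [cellMat, mul_apply, notMat]

/-- The Hadamard matrix is real and symmetric, so undoing the basis change uses the same gates. -/
theorem runInstr_rot {q : ℕ} (θ : Bits q) :
    runInstr q 0 ((List.ofFn fun i => (false, θ i)).flatMap cellInstr) = (bb84 θ)ᴴ := by
  rw [runInstr_sweep]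
  ext y z
  rw [conjTranspose_apply, tensorMat, bb84, star_prod]
  refine Finset.prod_congr rfl fun i _ => ?_
  simp only [cellMat, Bool.false_eq_true, if_false, mul_one]
  cases θ i
  · simp [one_apply, eq_comm]
  · simp only [if_true, hadamard, Complex.star_def, map_div₀, Complex.conj_ofReal]
    cases y i <;> cases z i <;> simp

end RevTRE

/-! ### Stack programs: execution and running time -/

namespace RevTRE

/-! ### A small program logic for stack programs -/

/-- `p` takes `s` to `s'` in at most `T` steps. -/
def Exec (p : Cmd) (s : Store) (T : ℕ) (s' : Store) : Prop := ∃ t, t ≤ T ∧ Runs p s t s'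

theorem Exec.mono {p : Cmd} {s s' : Store} {T T' : ℕ} (h : Exec p s T s') (hT : T ≤ T') :
    Exec p s T' s' := by
  obtain ⟨t, ht, hr⟩ := h
  exact ⟨t, ht.trans hT, hr⟩

theorem Exec.seq {p q : Cmd} {s s' s'' : Store} {T T' : ℕ} (h : Exec p s T s')
    (h' : Exec q s' T' s'') : Exec (Cmd.seq p q) s (T + T') s'' := by
  obtain ⟨t, ht, hr⟩ := h
  obtain ⟨t', ht', hr'⟩ := h'
  exact ⟨t + t', add_le_add ht ht', hr.seq hr'⟩

def Cmd.LoopFree : Cmd → Prop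
  | .skip => True
  | .push _ _ => True
  | .pop _ => True
  | .seq p q => p.LoopFree ∧ q.LoopFree
  | .cond _ p q e => p.LoopFree ∧ q.LoopFree ∧ e.LoopFree
  | .loop _ _ => False

/-- The effect of a loop-free program. -/
def Cmd.eval : Cmd → Store → Store
  | .skip, s => s
  | .push r b, s => Function.update s r (b :: s r)
  | .pop r, s => Function.update s r (s r).tail
  | .seq p q, s => q.eval (p.eval s)
  | .cond r p q e, s =>
    match s r with
    | [] => e.eval s
    | true :: _ => p.eval s
    | false :: _ => q.eval s
  | .loop _ _, s => s

/-- A bound for the running time of a loop-free program. -/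
def Cmd.cost : Cmd → ℕ
  | .skip => 1
  | .push _ _ => 1
  | .pop _ => 1
  | .seq p q => p.cost + q.cost
  | .cond _ p q e => p.cost + q.cost + e.cost + 1
  | .loop _ _ => 0

theorem exec_eval {p : Cmd} (hp : p.LoopFree) (s : Store) : Exec p s p.cost (p.eval s) := by
  induction p generalizing s with
  | skip => exact ⟨1, le_rfl, Runs.skip s⟩
  | push r b => exact ⟨1, le_rfl, Runs.push r b s⟩
  | pop r => exact ⟨1, le_rfl, Runs.pop r s⟩
  | seq p q ihp ihq => exact (ihp hp.1 s).seq (ihq hp.2 _)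
  | cond r p q e ihp ihq ihe =>
    rcases hs : s r with _ | ⟨b, l⟩
    · obtain ⟨t, ht, hr⟩ := ihe hp.2.2 s
      refine ⟨t + 1, by simp only [Cmd.cost]; omega, ?_⟩
      simp only [Cmd.eval, hs]
      exact Runs.cond_empty hs hr
    · cases b
      · obtain ⟨t, ht, hr⟩ := ihq hp.2.1 s
        refine ⟨t + 1, by simp only [Cmd.cost]; omega, ?_⟩
        simp only [Cmd.eval, hs]
        exact Runs.cond_false (by simp [hs]) hr
      · obtain ⟨t, ht, hr⟩ := ihp hp.1 s
        refine ⟨t + 1, by simp only [Cmd.cost]; omega, ?_⟩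
        simp only [Cmd.eval, hs]
        exact Runs.cond_true (by simp [hs]) hr
  | loop r p _ => exact hp.elim

theorem exec_loop_nil {r : ℕ} {p : Cmd} {s : Store} (h : s r = []) {T : ℕ} (hT : 1 ≤ T) :
    Exec (Cmd.loop r p) s T s := ⟨1, hT, Runs.loop_empty h⟩

/-- The strict inequality `p.cost < K` pays for the one step of the loop test in each round. -/
theorem exec_loop_cons {r : ℕ} {p : Cmd} (hp : p.LoopFree) {K : ℕ} (hK : p.cost < K)
    {s s₁ s' : Store} (h : s r ≠ []) (he : p.eval s = s₁) {n : ℕ}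
    (hrest : Exec (Cmd.loop r p) s₁ (K * n + 1) s') :
    Exec (Cmd.loop r p) s (K * (n + 1) + 1) s' := by
  obtain ⟨t, ht, hr⟩ := exec_eval hp s
  rw [he] at hr
  obtain ⟨t', ht', hr'⟩ := hrest
  refine ⟨t + t' + 1, ?_, Runs.loop_step h hr hr'⟩
  rw [mul_add]
  omega

/-- Pops a bit from stack `a` and branches. -/
def popBit (a : ℕ) (p q : Cmd) : Cmd := .cond a (.seq (.pop a) p) (.seq (.pop a) q) .skip

theorem popBit_eval {a : ℕ} (p q : Cmd) {s : Store} {b : Bool} {l : List Bool}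
    (h : s a = b :: l) :
    (popBit a p q).eval s = (if b = true then p else q).eval (Function.update s a l) := by
  cases b <;> simp [popBit, Cmd.eval, h]

theorem popBit_eval_nil {a : ℕ} (p q : Cmd) {s : Store} (h : s a = []) :
    (popBit a p q).eval s = s := by
  simp [popBit, Cmd.eval, h]

/-- Empties stack `a` onto `b` and onto `c`. -/
def dup (a b c : ℕ) : Cmd :=
  .loop a (popBit a (.seq (.push b true) (.push c true)) (.seq (.push b false) (.push c false)))

/-- Emptying a stack reverses it; a second copy restores the order. -/
theorem exec_dup {a b c : ℕ} (hab : a ≠ b) (hac : a ≠ c) (hbc : b ≠ c) (l : List Bool) :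
    ∀ s : Store, s a = l → Exec (dup a b c) s (20 * l.length + 1)
      (Function.update (Function.update (Function.update s a []) b (l.reverse ++ s b)) c
        (l.reverse ++ s c)) := by
  induction l with
  | nil =>
    intro s hs
    have h : Function.update (Function.update (Function.update s a []) b ([].reverse ++ s b)) c
        ([].reverse ++ s c) = s := by
      funext j
      simp only [Function.update_apply]
      split_ifs <;> simp_all
    rw [h]
    exact exec_loop_nil hs (by simp)
  | cons x l ih =>
    intro s hs
    set s₁ : Store := Function.update (Function.update (Function.update s a l) b (x :: s b)) c
      (x :: s c) with hs₁
    have he : (popBit a (.seq (.push b true) (.push c true))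
        (.seq (.push b false) (.push c false))).eval s = s₁ := by
      rw [popBit_eval _ _ hs]
      funext j
      cases x <;> simp [Cmd.eval, hs₁, Function.update_apply, hab.symm, hac.symm, hbc.symm]
    have h := ih s₁ (by simp [hs₁, hab, hac])
    have hfin : Function.update (Function.update (Function.update s₁ a []) b
        (l.reverse ++ s₁ b)) c (l.reverse ++ s₁ c) =
        Function.update (Function.update (Function.update s a []) b ((x :: l).reverse ++ s b)) c
        ((x :: l).reverse ++ s c) := by
      funext j
      simp only [Function.update_apply, hs₁]
      split_ifs <;> simp_all
    rw [hfin] at h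
    exact exec_loop_cons (by simp [popBit, Cmd.LoopFree]) (by simp [popBit, Cmd.cost])
      (by simp [hs]) he h

/-- Moves as many bits from `a` to `b` as stack `u` has, and empties `u` onto `c` in unary. -/
def moveN (u a b c : ℕ) : Cmd :=
  .loop u (.seq (.pop u) (.seq (.push c true) (popBit a (.push b true) (.push b false))))

theorem exec_moveN {u a b c : ℕ} (hua : u ≠ a) (hub : u ≠ b) (huc : u ≠ c) (hab : a ≠ b)
    (hac : a ≠ c) (hbc : b ≠ c) (l l' : List Bool) :
    ∀ s : Store, (s u).length = l.length → s a = l ++ l' →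
      Exec (moveN u a b c) s (20 * l.length + 1)
        (Function.update (Function.update (Function.update (Function.update s u []) a l') b
          (l.reverse ++ s b)) c (unary l.length ++ s c)) := by
  induction l with
  | nil =>
    intro s hu hs
    have hu' : s u = [] := by simpa using hu
    have h : Function.update (Function.update (Function.update (Function.update s u []) a l') b
        ([].reverse ++ s b)) c (unary ([] : List Bool).length ++ s c) = s := by
      funext j
      simp only [Function.update_apply]
      split_ifs <;> simp_all [unary]
    rw [h]
    exact exec_loop_nil hu' (by simp)
  | cons x l ih =>
    intro s hu hs
    obtain ⟨y, k, huk⟩ : ∃ y k, s u = y :: k := List.exists_cons_of_length_eq_add_one hu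
    have hk : k.length = l.length := by
      rw [huk] at hu
      simpa using hu
    set s₁ : Store := Function.update (Function.update (Function.update (Function.update s u k) a
      (l ++ l')) b (x :: s b)) c (true :: s c) with hs₁
    have he : (Cmd.seq (.pop u) (.seq (.push c true)
        (popBit a (.push b true) (.push b false)))).eval s = s₁ := by
      simp only [Cmd.eval]
      rw [popBit_eval (b := x) (l := l ++ l') _ _ (by simp [hua.symm, hac, hs])]
      funext j
      cases x <;> simp [Cmd.eval, hs₁, Function.update_apply, hab.symm, hbc,
        huk, hub.symm, huc.symm] <;> split_ifs <;> simp_all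
    have h := ih s₁ (by simp [hs₁, hua, hub, huc, hk]) (by simp [hs₁, hab, hac])
    have hfin : Function.update (Function.update (Function.update (Function.update s₁ u []) a l')
        b (l.reverse ++ s₁ b)) c (unary l.length ++ s₁ c) =
        Function.update (Function.update (Function.update (Function.update s u []) a l') b
          ((x :: l).reverse ++ s b)) c (unary (x :: l).length ++ s c) := by
      funext j
      simp only [Function.update_apply, hs₁, unary, List.length_cons, List.replicate_succ']
      split_ifs <;> simp_all
    rw [hfin] at h
    exact exec_loop_cons (by simp [popBit, Cmd.LoopFree]) (by simp [popBit, Cmd.cost])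
      (by simp [huk]) he h

/-- Pushes a string. -/
def pushAll (o : ℕ) : List Bool → Cmd
  | [] => .skip
  | b :: l => .seq (pushAll o l) (.push o b)

theorem pushAll_loopFree (o : ℕ) (l : List Bool) : (pushAll o l).LoopFree := by
  induction l with
  | nil => trivial
  | cons b l ih => exact ⟨ih, trivial⟩

theorem pushAll_eval (o : ℕ) (l : List Bool) (s : Store) :
    (pushAll o l).eval s = Function.update s o (l ++ s o) := by
  induction l with
  | nil => simp [pushAll, Cmd.eval]
  | cons b l ih => simp [pushAll, Cmd.eval, ih]

/-- The code of the instructions `cellInstr p`. -/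
def cellCode (p : Bool × Bool) : List Bool := (cellInstr p).flatMap QInstr.code

/-- The output grows at its front. The code for `h` and the move is therefore pushed before that for
`x`, which must act first. On an empty stack `x` the second branch does nothing, as for a zero bit.
-/
def emitBody (t x o : ℕ) : Cmd :=
  .seq (popBit t (pushAll o (cellCode (false, true))) (pushAll o (cellCode (false, false))))
    (popBit x (pushAll o QInstr.x.code) .skip)

/-- Writes the code of the instructions for a product of one-qubit operators, last qubit first.
If the stack `x` is empty, it is taken to contain zeros. -/
def emit (t x o : ℕ) : Cmd := .loop t (emitBody t x o)

theorem exec_emit {t x o : ℕ} (htx : t ≠ x) (hto : t ≠ o) (hxo : x ≠ o)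
    (l : List (Bool × Bool)) :
    ∀ s : Store, s t = l.map Prod.snd → (s x = l.map Prod.fst ∨ s x = [] ∧ ∀ p ∈ l, p.1 = false) →
      Exec (emit t x o) s (50 * l.length + 1) (Function.update (Function.update
        (Function.update s t []) x []) o (l.reverse.flatMap cellCode ++ s o)) := by
  induction l with
  | nil =>
    intro s ht hx
    have hx' : s x = [] := by
      rcases hx with hx | hx
      · simpa using hx
      · exact hx.1
    have h : Function.update (Function.update (Function.update s t []) x []) o
        (([] : List (Bool × Bool)).reverse.flatMap cellCode ++ s o) = s := by
      funext j
      simp only [Function.update_apply]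
      split_ifs <;> simp_all
    rw [h]
    exact exec_loop_nil (by simpa using ht) (by simp)
  | cons p l ih =>
    intro s ht hx
    obtain ⟨a, h⟩ := p
    set s₁ : Store := Function.update (Function.update (Function.update s t (l.map Prod.snd)) x
      (s x).tail) o (cellCode (a, h) ++ s o) with hs₁
    have he : (emitBody t x o).eval s = s₁ := by
      rw [emitBody, Cmd.eval, popBit_eval (a := t) (b := h) (l := l.map Prod.snd) _ _
        (by simpa using ht)]
      have h1 : ((if h = true then pushAll o (cellCode (false, true)) else
          pushAll o (cellCode (false, false))).eval (Function.update s t (l.map Prod.snd))) =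
          Function.update (Function.update s t (l.map Prod.snd)) o
            (cellCode (false, h) ++ s o) := by
        cases h <;> simp [pushAll_eval, hto.symm]
      rw [h1]
      rcases hx with hx | ⟨hx, hz⟩
      · rw [popBit_eval (b := a) (l := l.map Prod.fst) _ _ (by simpa [htx.symm, hxo] using hx)]
        funext j
        cases a <;> cases h <;> simp [pushAll_eval, Cmd.eval, hs₁, Function.update_apply, hx,
          hxo.symm, cellCode, cellInstr] <;> split_ifs <;> simp_all
      · have ha : a = false := hz (a, h) (by simp)
        rw [popBit_eval_nil _ _ (by simpa [htx.symm, hxo] using hx)]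
        funext j
        simp only [hs₁, Function.update_apply, hx, ha]
        split_ifs <;> simp_all
    have hih := ih s₁ (by simp [hs₁, htx, hto]) (by
      rcases hx with hx | ⟨hx, hz⟩
      · exact Or.inl (by simp [hs₁, hxo, hx])
      · exact Or.inr ⟨by simp [hs₁, hxo, hx], fun p hp => hz p (List.mem_cons_of_mem _ hp)⟩)
    have hfin : Function.update (Function.update (Function.update s₁ t []) x []) o
        (l.reverse.flatMap cellCode ++ s₁ o) = Function.update (Function.update
        (Function.update s t []) x []) o (((a, h) :: l).reverse.flatMap cellCode ++ s o) := by
      funext j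
      simp only [Function.update_apply, hs₁]
      split_ifs <;> simp_all
    rw [hfin] at hih
    refine exec_loop_cons ?_ ?_ (by simp [ht]) he hih
    · simp [emitBody, popBit, Cmd.LoopFree, pushAll_loopFree]
    · simp [emitBody, popBit, Cmd.cost, pushAll, cellCode, cellInstr, QInstr.code]

/-- Negates the top of a stack. -/
def negTop (o : ℕ) : Cmd := popBit o (.push o false) (.push o true)

def maskBody (t x o : ℕ) : Cmd := popBit t (.pop x) (popBit x (negTop o) .skip)

/-- Adds to the bit on stack `o` the parity of the bits of `x` at the positions where `t` is
zero. -/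
def mask (t x o : ℕ) : Cmd := .loop t (maskBody t x o)

def maskCount (l : List (Bool × Bool)) : ℕ := l.countP fun p => p.1 && !p.2

theorem odd_maskCount_cons (a h : Bool) (l : List (Bool × Bool)) :
    decide (Odd (maskCount ((a, h) :: l))) = ((a && !h) ^^ decide (Odd (maskCount l))) := by
  have h1 : maskCount ((a, h) :: l) = maskCount l + if (a && !h) = true then 1 else 0 := by
    simp [maskCount, List.countP_cons]
  rw [h1]
  cases a && !h
  · simp
  · rw [if_pos rfl, Bool.true_xor, ← decide_not]
    exact decide_eq_decide.mpr Nat.odd_add_one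

theorem exec_mask {t x o : ℕ} (htx : t ≠ x) (hto : t ≠ o) (hxo : x ≠ o)
    (l : List (Bool × Bool)) :
    ∀ (s : Store) (b : Bool), s t = l.map Prod.snd → s x = l.map Prod.fst → s o = [b] →
      Exec (mask t x o) s (30 * l.length + 1) (Function.update (Function.update
        (Function.update s t []) x []) o [b ^^ decide (Odd (maskCount l))]) := by
  induction l with
  | nil =>
    intro s b ht hx ho
    have h : Function.update (Function.update (Function.update s t []) x []) o
        [b ^^ decide (Odd (maskCount []))] = s := by
      funext j
      simp only [Function.update_apply, maskCount]
      split_ifs <;> simp_all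
    rw [h]
    exact exec_loop_nil (by simpa using ht) (by simp)
  | cons p l ih =>
    intro s b ht hx ho
    obtain ⟨a, h⟩ := p
    set s₁ : Store := Function.update (Function.update (Function.update s t (l.map Prod.snd)) x
      (l.map Prod.fst)) o [b ^^ (a && !h)] with hs₁
    have he : (maskBody t x o).eval s = s₁ := by
      rw [maskBody, popBit_eval (b := h) (l := l.map Prod.snd) _ _ (by simpa using ht)]
      cases h
      · rw [if_neg (by simp), popBit_eval (b := a) (l := l.map Prod.fst) _ _
          (by simpa [htx.symm] using hx)]
        clear ih
        cases a
        · rw [if_neg (by simp)]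
          funext j
          simp only [Cmd.eval, hs₁, Function.update_apply]
          split_ifs <;> simp_all
        · rw [if_pos rfl, negTop, popBit_eval (b := b) (l := []) _ _
            (by simpa [hxo.symm, hto.symm] using ho)]
          funext j
          cases b <;> simp [Cmd.eval, hs₁, Function.update_apply] <;> split_ifs <;> simp_all
      · funext j
        simp only [if_true, Cmd.eval, hs₁, Function.update_apply]
        split_ifs <;> simp_all
    have hih := ih s₁ (b ^^ (a && !h)) (by simp [hs₁, htx, hto]) (by simp [hs₁, hxo])
      (by simp [hs₁])
    have hodd : ((b ^^ (a && !h)) ^^ decide (Odd (maskCount l))) =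
        (b ^^ decide (Odd (maskCount ((a, h) :: l)))) := by
      rw [Bool.xor_assoc, odd_maskCount_cons]
    rw [hodd] at hih
    have hfin : Function.update (Function.update (Function.update s₁ t []) x []) o
        [b ^^ decide (Odd (maskCount ((a, h) :: l)))] = Function.update (Function.update
        (Function.update s t []) x []) o [b ^^ decide (Odd (maskCount ((a, h) :: l)))] := by
      funext j
      simp only [Function.update_apply, hs₁]
      split_ifs <;> simp_all
    rw [hfin] at hih
    refine exec_loop_cons ?_ ?_ (by simp [ht]) he hih
    · simp [maskBody, negTop, popBit, Cmd.LoopFree]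
    · simp [maskBody, negTop, popBit, Cmd.cost]

/-- Overwrites the top of a stack by zero. -/
def clearTop (o : ℕ) : Cmd := .seq (.pop o) (.push o false)

def compareBody (t x y o : ℕ) : Cmd :=
  popBit t (popBit x (popBit y .skip (clearTop o)) (popBit y (clearTop o) .skip))
    (.seq (.pop x) (.pop y))

/-- Clears the bit on stack `o` unless `x` and `y` agree where `t` is one. -/
def compare (t x y o : ℕ) : Cmd := .loop t (compareBody t x y o)

def agreeTest (p : Bool × Bool × Bool) : Bool := !p.1 || (p.2.1 == p.2.2)

theorem exec_compare {t x y o : ℕ} (htx : t ≠ x) (hty : t ≠ y) (hto : t ≠ o) (hxy : x ≠ y)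
    (hxo : x ≠ o) (hyo : y ≠ o) (l : List (Bool × Bool × Bool)) :
    ∀ (s : Store) (b : Bool), s t = l.map (fun p => p.1) → s x = l.map (fun p => p.2.1) →
      s y = l.map (fun p => p.2.2) → s o = [b] →
      Exec (compare t x y o) s (40 * l.length + 1) (Function.update (Function.update
        (Function.update (Function.update s t []) x []) y []) o [b && l.all agreeTest]) := by
  induction l with
  | nil =>
    intro s b ht hx hy ho
    have h : Function.update (Function.update (Function.update (Function.update s t []) x []) y
        []) o [b && ([] : List (Bool × Bool × Bool)).all agreeTest] = s := by
      funext j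
      simp only [Function.update_apply]
      split_ifs <;> simp_all
    rw [h]
    exact exec_loop_nil (by simpa using ht) (by simp)
  | cons p l ih =>
    intro s b ht hx hy ho
    obtain ⟨h, a, c⟩ := p
    set s₁ : Store := Function.update (Function.update (Function.update (Function.update s t
      (l.map fun p => p.1)) x (l.map fun p => p.2.1)) y (l.map fun p => p.2.2)) o
      [b && agreeTest (h, a, c)] with hs₁
    have he : (compareBody t x y o).eval s = s₁ := by
      clear ih
      rw [compareBody, popBit_eval (b := h) (l := l.map fun p => p.1) _ _ (by simpa using ht)]
      cases h
      · funext j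
        simp only [Bool.false_eq_true, if_false, Cmd.eval, hs₁, Function.update_apply]
        split_ifs <;> simp_all [agreeTest]
      · rw [if_pos rfl, popBit_eval (b := a) (l := l.map fun p => p.2.1) _ _
          (by simpa [htx.symm] using hx)]
        cases a
        · rw [if_neg (by simp), popBit_eval (b := c) (l := l.map fun p => p.2.2) _ _
            (by simpa [hty.symm, hxy.symm] using hy)]
          cases c <;> funext j <;>
            simp [clearTop, Cmd.eval, hs₁, Function.update_apply, agreeTest] <;>
            split_ifs <;> simp_all
        · rw [if_pos rfl, popBit_eval (b := c) (l := l.map fun p => p.2.2) _ _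
            (by simpa [hty.symm, hxy.symm] using hy)]
          cases c <;> funext j <;>
            simp [clearTop, Cmd.eval, hs₁, Function.update_apply, agreeTest] <;>
            split_ifs <;> simp_all
    have hih := ih s₁ (b && agreeTest (h, a, c)) (by simp [hs₁, htx, hty, hto])
      (by simp [hs₁, hxy, hxo]) (by simp [hs₁, hyo]) (by simp [hs₁])
    have hfin : Function.update (Function.update (Function.update (Function.update s₁ t []) x [])
        y []) o [(b && agreeTest (h, a, c)) && l.all agreeTest] = Function.update
        (Function.update (Function.update (Function.update s t []) x []) y []) o
        [b && ((h, a, c) :: l).all agreeTest] := by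
      funext j
      simp only [Function.update_apply, hs₁, List.all_cons, Bool.and_assoc]
      split_ifs <;> simp_all
    rw [hfin] at hih
    refine exec_loop_cons ?_ ?_ (by simp [ht]) he hih
    · simp [compareBody, clearTop, popBit, Cmd.LoopFree]
    · simp [compareBody, clearTop, popBit, Cmd.cost]

end RevTRE

/-! ### Subroutine calls, and the encryption program -/

namespace RevTRE

open Matrix

/-! ### Renaming of stacks, explicit memories -/

theorem Exec.of_eq {p : Cmd} {s s' s'' : Store} {T : ℕ} (h : Exec p s T s') (e : s' = s'') :
    Exec p s T s'' := e ▸ h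

/-- A step lengthens a stack by at most one bit. This bounds the output of a subroutine, hence the
time to copy it. -/
theorem Runs.length_le {p : Cmd} {s s' : Store} {t : ℕ} (h : Runs p s t s') (j : ℕ) :
    (s' j).length ≤ (s j).length + t := by
  induction h with
  | skip s => omega
  | push r b s =>
    rw [Function.update_apply]
    split_ifs with hj
    · simp [hj]
    · omega
  | pop r s =>
    rw [Function.update_apply]
    split_ifs with hj
    · simp only [List.length_tail, hj]
      omega
    · omega
  | seq _ _ ih ih' => omega
  | cond_true _ _ ih => omega
  | cond_false _ _ ih => omega
  | cond_empty _ _ ih => omega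
  | loop_empty _ => omega
  | loop_step _ _ _ ih ih' => omega

/-- The program that uses stack `r + 10` in place of stack `r`. -/
def Cmd.shift : Cmd → Cmd
  | .skip => .skip
  | .push r b => .push (r + 10) b
  | .pop r => .pop (r + 10)
  | .seq p q => .seq p.shift q.shift
  | .cond r p q e => .cond (r + 10) p.shift q.shift e.shift
  | .loop r p => .loop (r + 10) p.shift

/-- The shifted program runs in the same number of steps and leaves the ten lowest stacks to the
caller. -/
theorem Runs.shift {p : Cmd} {s s' : Store} {t : ℕ} (h : Runs p s t s') :
    ∀ m : Store, (∀ j, m (j + 10) = s j) →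
      ∃ m', Runs p.shift m t m' ∧ (∀ j, m' (j + 10) = s' j) ∧ ∀ j, j < 10 → m' j = m j := by
  induction h with
  | skip s => exact fun m hm => ⟨m, Runs.skip m, hm, fun _ _ => rfl⟩
  | push r b s =>
    refine fun m hm => ⟨_, Runs.push (r + 10) b m, fun j => ?_, fun j hj => ?_⟩
    · simp [Function.update_apply, hm]
    · exact Function.update_of_ne (by omega) _ _
  | pop r s =>
    refine fun m hm => ⟨_, Runs.pop (r + 10) m, fun j => ?_, fun j hj => ?_⟩
    · simp [Function.update_apply, hm]
    · exact Function.update_of_ne (by omega) _ _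
  | seq _ _ ih ih' =>
    intro m hm
    obtain ⟨m₁, h₁, e₁, f₁⟩ := ih m hm
    obtain ⟨m₂, h₂, e₂, f₂⟩ := ih' m₁ e₁
    exact ⟨m₂, h₁.seq h₂, e₂, fun j hj => (f₂ j hj).trans (f₁ j hj)⟩
  | cond_true h _ ih =>
    intro m hm
    obtain ⟨m₁, h₁, e₁, f₁⟩ := ih m hm
    exact ⟨m₁, Runs.cond_true (by rwa [hm]) h₁, e₁, f₁⟩
  | cond_false h _ ih =>
    intro m hm
    obtain ⟨m₁, h₁, e₁, f₁⟩ := ih m hm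
    exact ⟨m₁, Runs.cond_false (by rwa [hm]) h₁, e₁, f₁⟩
  | cond_empty h _ ih =>
    intro m hm
    obtain ⟨m₁, h₁, e₁, f₁⟩ := ih m hm
    exact ⟨m₁, Runs.cond_empty (by rwa [hm]) h₁, e₁, f₁⟩
  | loop_empty h => exact fun m hm => ⟨m, Runs.loop_empty (by rwa [hm]), hm, fun _ _ => rfl⟩
  | loop_step h _ _ ih ih' =>
    intro m hm
    obtain ⟨m₁, h₁, e₁, f₁⟩ := ih m hm
    obtain ⟨m₂, h₂, e₂, f₂⟩ := ih' m₁ e₁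
    exact ⟨m₂, Runs.loop_step (by rwa [hm]) h₁ h₂, e₂, fun j hj => (f₂ j hj).trans (f₁ j hj)⟩

/-- The memory with the stacks in `L`, followed by those of `m`. -/
def mem (L : List (List Bool)) (m : Store) : Store := fun j => (L[j]?).getD (m j)

theorem update_mem {L : List (List Bool)} (m : Store) {a : ℕ} (ha : a < L.length)
    (v : List Bool) : Function.update (mem L m) a v = mem (L.set a v) m := by
  funext j
  rw [Function.update_apply, mem, mem, List.getElem?_set]
  by_cases hj : j = a
  · subst hj
    simp [ha]
  · simp [hj, Ne.symm hj]

/-- Running a subroutine with three inputs and one output on the stacks `10, 11, …`. -/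
theorem exec_shift {p : Cmd} {i₀ i₁ i₂ out : List Bool} {T : ℕ}
    (h : ∃ (t : ℕ) (s : Store), Runs p (fun j => [i₀, i₁, i₂].getD j []) t s ∧ t ≤ T ∧
      ∀ j, j < [out].length → s j = [out].getD j [])
    (a₀ a₁ a₂ a₃ a₄ a₅ a₆ a₇ a₈ a₉ : List Bool) :
    out.length ≤ i₀.length + T ∧ ∃ (b₁ b₂ : List Bool) (m : Store),
      Exec p.shift (mem [a₀, a₁, a₂, a₃, a₄, a₅, a₆, a₇, a₈, a₉, i₀, i₁, i₂] fun _ => []) T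
        (mem [a₀, a₁, a₂, a₃, a₄, a₅, a₆, a₇, a₈, a₉, out, b₁, b₂] m) := by
  obtain ⟨t, s, hr, ht, hs⟩ := h
  have h0 : s 0 = out := hs 0 (by simp)
  refine ⟨?_, ?_⟩
  · have := hr.length_le 0
    rw [h0] at this
    simp only [List.getD_cons_zero] at this
    omega
  obtain ⟨m, hm, e, f⟩ := hr.shift
    (mem [a₀, a₁, a₂, a₃, a₄, a₅, a₆, a₇, a₈, a₉, i₀, i₁, i₂] fun _ => []) (by
      intro j
      simp [mem, List.getD_eq_getElem?_getD])
  refine ⟨m 11, m 12, m, t, ht, ?_⟩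
  have hfin : m = mem [a₀, a₁, a₂, a₃, a₄, a₅, a₆, a₇, a₈, a₉, out, m 11, m 12] m := by
    funext j
    rcases lt_or_ge j 13 with hj | hj
    · rcases lt_or_ge j 10 with hj' | hj'
      · rw [f j hj']
        interval_cases j <;> rfl
      · interval_cases j
        · exact (e 0).trans h0
        · rfl
        · rfl
    · rw [mem, List.getElem?_eq_none (by simpa using hj)]
      rfl
  rw [← hfin]
  exact hm

theorem eval_mono (q : Polynomial ℕ) {a b : ℕ} (h : a ≤ b) : q.eval a ≤ q.eval b := by
  rw [Polynomial.eval_eq_sum_range, Polynomial.eval_eq_sum_range]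
  exact Finset.sum_le_sum fun i _ => Nat.mul_le_mul_left _ (Nat.pow_le_pow_left h i)

theorem polyTime_of_exec {ι : Type} {input output : ι → List (List Bool)} (p : Cmd) (A : ℕ)
    (q : Polynomial ℕ)
    (h : ∀ i, ∃ (T : ℕ) (s : Store), Exec p (mem (input i) fun _ => []) T s ∧
      T ≤ A * (((input i).map List.length).sum + 1 + q.eval ((input i).map List.length).sum) ∧
      ∀ j, j < (output i).length → s j = (output i).getD j []) :
    PolyTime input output := by
  refine ⟨p, Polynomial.C A * (Polynomial.X + 1 + q), fun i => ?_⟩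
  obtain ⟨T, s, ⟨t, ht, hr⟩, hT, hs⟩ := h i
  refine ⟨t, s, ?_, ?_, hs⟩
  · have : (fun j => (input i).getD j []) = mem (input i) fun _ => [] := by
      funext j
      simp [mem, List.getD_eq_getElem?_getD]
    rw [this]
    exact hr
  · simpa using ht.trans hT

/-- Padding by empty stacks. -/
theorem mem_pad (L : List (List Bool)) (k : ℕ) :
    mem L (fun _ => []) = mem (L ++ List.replicate k []) fun _ => [] := by
  funext j
  simp only [mem, List.getElem?_append, List.getElem?_replicate]
  split_ifs with h1 h2
  · rfl
  · simp [List.getElem?_eq_none (not_lt.mp h1)]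
  · simp [List.getElem?_eq_none (not_lt.mp h1)]

/-- The programs of the list, one after another. -/
def seqs (l : List Cmd) : Cmd := l.foldl Cmd.seq .skip

theorem exec_start (s : Store) : Exec .skip s 1 s := ⟨1, le_rfl, Runs.skip s⟩

section Steps
variable {p : Cmd} {s m : Store} {T : ℕ} {L : List (List Bool)}

theorem mem_eq {a : ℕ} {l : List Bool} (h : L[a]? = some l) (m : Store) : mem L m a = l := by
  rw [mem, h, Option.getD_some]

theorem mem_eq_getD {a : ℕ} (h : a < L.length) (m : Store) : mem L m a = L.getD a [] := by
  rw [mem, List.getD_eq_getElem?_getD, List.getElem?_eq_getElem h]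
  rfl

theorem Exec.dup (e : Exec p s T (mem L m)) (a b c : ℕ) (l : List Bool) (hl : L[a]? = some l)
    (h : [a, b, c].Nodup) (hlt : ∀ j ∈ [a, b, c], j < L.length) :
    Exec (Cmd.seq p (dup a b c)) s (T + (20 * l.length + 1))
      (mem (((L.set a []).set b (l.reverse ++ L.getD b [])).set c
        (l.reverse ++ L.getD c [])) m) := by
  simp only [List.nodup_cons, List.mem_cons, List.not_mem_nil, or_false, not_or] at h
  simp only [List.forall_mem_cons, List.not_mem_nil, false_imp_iff, implies_true, and_true] at hlt
  obtain ⟨⟨hab, hac⟩, hbc, -⟩ := h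
  obtain ⟨ha, hb, hc⟩ := hlt
  refine e.seq ((exec_dup hab hac hbc l _ (mem_eq hl m)).of_eq ?_)
  rw [update_mem m ha, mem_eq_getD hb, mem_eq_getD hc, update_mem m (by simpa using hb),
    update_mem m (by simpa using hc)]

theorem Exec.moveN (e : Exec p s T (mem L m)) (u a b c : ℕ) (k l l' : List Bool)
    (hk : L[u]? = some k) (hkl : k.length = l.length) (hl : L[a]? = some (l ++ l'))
    (h : [u, a, b, c].Nodup) (hlt : ∀ j ∈ [u, a, b, c], j < L.length) :
    Exec (Cmd.seq p (moveN u a b c)) s (T + (20 * l.length + 1))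
      (mem ((((L.set u []).set a l').set b (l.reverse ++ L.getD b [])).set c
        (unary l.length ++ L.getD c [])) m) := by
  simp only [List.nodup_cons, List.mem_cons, List.not_mem_nil, or_false, not_or] at h
  simp only [List.forall_mem_cons, List.not_mem_nil, false_imp_iff, implies_true, and_true] at hlt
  obtain ⟨⟨hua, hub, huc⟩, ⟨hab, hac⟩, hbc, -⟩ := h
  obtain ⟨hu, ha, hb, hc⟩ := hlt
  refine e.seq ((exec_moveN hua hub huc hab hac hbc l l' _ (by rw [mem_eq hk, hkl])
    (mem_eq hl m)).of_eq ?_)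
  rw [update_mem m hu, update_mem m (by simpa using ha), mem_eq_getD hb, mem_eq_getD hc,
    update_mem m (by simpa using hb), update_mem m (by simpa using hc)]

theorem Exec.mask (e : Exec p s T (mem L m)) (t x o : ℕ) (l : List (Bool × Bool)) (b : Bool)
    (ht : L[t]? = some (l.map Prod.snd)) (hx : L[x]? = some (l.map Prod.fst))
    (ho : L[o]? = some [b]) (h : [t, x, o].Nodup) (hlt : ∀ j ∈ [t, x, o], j < L.length) :
    Exec (Cmd.seq p (mask t x o)) s (T + (30 * l.length + 1))
      (mem (((L.set t []).set x []).set o [b ^^ decide (Odd (maskCount l))]) m) := by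
  simp only [List.nodup_cons, List.mem_cons, List.not_mem_nil, or_false, not_or] at h
  simp only [List.forall_mem_cons, List.not_mem_nil, false_imp_iff, implies_true, and_true] at hlt
  obtain ⟨⟨htx, hto⟩, hxo, -⟩ := h
  obtain ⟨h1, h2, h3⟩ := hlt
  refine e.seq ((exec_mask htx hto hxo l _ b (mem_eq ht m) (mem_eq hx m)
    (mem_eq ho m)).of_eq ?_)
  rw [update_mem m h1, update_mem m (by simpa using h2), update_mem m (by simpa using h3)]

theorem Exec.emit (e : Exec p s T (mem L m)) (t x o : ℕ) (l : List (Bool × Bool))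
    (ht : L[t]? = some (l.map Prod.snd))
    (hx : L[x]? = some (l.map Prod.fst) ∨ L[x]? = some [] ∧ ∀ p ∈ l, p.1 = false)
    (h : [t, x, o].Nodup) (hlt : ∀ j ∈ [t, x, o], j < L.length) :
    Exec (Cmd.seq p (emit t x o)) s (T + (50 * l.length + 1))
      (mem (((L.set t []).set x []).set o (l.reverse.flatMap cellCode ++ L.getD o [])) m) := by
  simp only [List.nodup_cons, List.mem_cons, List.not_mem_nil, or_false, not_or] at h
  simp only [List.forall_mem_cons, List.not_mem_nil, false_imp_iff, implies_true, and_true] at hlt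
  obtain ⟨⟨htx, hto⟩, hxo, -⟩ := h
  obtain ⟨h1, h2, h3⟩ := hlt
  refine e.seq ((exec_emit htx hto hxo l _ (mem_eq ht m)
    (hx.imp (fun hx => mem_eq hx m) fun hx => ⟨mem_eq hx.1 m, hx.2⟩)).of_eq ?_)
  rw [update_mem m h1, update_mem m (by simpa using h2), mem_eq_getD h3,
    update_mem m (by simpa using h3)]

theorem Exec.compare (e : Exec p s T (mem L m)) (t x y o : ℕ) (l : List (Bool × Bool × Bool))
    (b : Bool) (ht : L[t]? = some (l.map fun p => p.1)) (hx : L[x]? = some (l.map fun p => p.2.1))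
    (hy : L[y]? = some (l.map fun p => p.2.2)) (ho : L[o]? = some [b])
    (h : [t, x, y, o].Nodup) (hlt : ∀ j ∈ [t, x, y, o], j < L.length) :
    Exec (Cmd.seq p (compare t x y o)) s (T + (40 * l.length + 1))
      (mem ((((L.set t []).set x []).set y []).set o [b && l.all agreeTest]) m) := by
  simp only [List.nodup_cons, List.mem_cons, List.not_mem_nil, or_false, not_or] at h
  simp only [List.forall_mem_cons, List.not_mem_nil, false_imp_iff, implies_true, and_true] at hlt
  obtain ⟨⟨htx, hty, hto⟩, ⟨hxy, hxo⟩, hyo, -⟩ := h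
  obtain ⟨h1, h2, h3, h4⟩ := hlt
  refine e.seq ((exec_compare htx hty hto hxy hxo hyo l _ b (mem_eq ht m) (mem_eq hx m)
    (mem_eq hy m) (mem_eq ho m)).of_eq ?_)
  rw [update_mem m h1, update_mem m (by simpa using h2), update_mem m (by simpa using h3),
    update_mem m (by simpa using h4)]

theorem Exec.push (e : Exec p s T (mem L m)) (a : ℕ) (b : Bool) (ha : a < L.length) :
    Exec (Cmd.seq p (Cmd.push a b)) s (T + 1) (mem (L.set a (b :: L.getD a [])) m) := by
  refine e.seq ⟨1, le_rfl, ?_⟩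
  rw [← update_mem m ha, ← mem_eq_getD ha m]
  exact Runs.push a b _

end Steps

/-! ### Lists of bits -/

theorem unary_reverse (n : ℕ) : (unary n).reverse = unary n := List.reverse_replicate

theorem unary_length (n : ℕ) : (unary n).length = n := List.length_replicate

theorem maskBit_eq {n : ℕ} (x θ : Bits n) :
    maskBit x θ = decide (Odd (maskCount (List.ofFn fun i => (x i, θ i)))) := by
  have h : maskCount (List.ofFn fun i => (x i, θ i)) =
      (Finset.univ.filter fun i => θ i = false ∧ x i = true).card := by
    rw [maskCount, List.ofFn_eq_map, List.countP_map, List.countP_eq_length_filter,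
      Finset.card_def, Finset.filter_val]
    change _ = Multiset.card (Multiset.filter _ (List.finRange n : Multiset (Fin n)))
    rw [Multiset.filter_coe, Multiset.coe_card]
    congr 2
    funext i
    rw [Bool.eq_iff_iff]
    simp [and_comm]
  rw [h, maskBit]

theorem ofFn_coins {n m : ℕ} (r : Bits (n + n + m)) :
    List.ofFn r = List.ofFn (coinX r) ++ (List.ofFn (coinTheta r) ++ List.ofFn (coinRest r)) := by
  rw [List.ofFn_add, List.ofFn_add, List.append_assoc]
  rfl

theorem ofFn_snoc {n : ℕ} (x : Bits n) (b : Bool) :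
    List.ofFn (Fin.snoc x b : Bits (n + 1)) = List.ofFn x ++ [b] := by
  rw [List.ofFn_succ_last]
  simp

theorem ofFn_last {n : ℕ} (x : Bits (n + 1)) :
    List.ofFn x = List.ofFn (fun i => x (Fin.castSucc i)) ++ [x (Fin.last n)] := by
  rw [List.ofFn_succ_last]

theorem ofFn_append {n m : ℕ} (x : Bits n) (y : Bits m) :
    List.ofFn (Fin.append x y) = List.ofFn x ++ List.ofFn y := List.ofFn_fin_append x y

/-! ### The programs of the compiled scheme -/

/-- State preparation and the call of the encryption algorithm `p`. -/
def prepProg (p : Cmd) : Cmd :=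
  seqs [moveN 0 2 3 4, moveN 4 2 5 6, dup 2 4 9, dup 4 12 9, dup 6 10 9, dup 3 4 7, dup 5 6 8,
    mask 8 7 1, dup 4 7 8, dup 6 3 4, emit 3 7 0, dup 1 11 9, dup 4 2 11, dup 8 2 9, p.shift,
    dup 10 3 9, dup 3 1 9]

theorem exec_prepProg {p : Cmd} {κ : ℕ} (x θ : Bits κ) (w : List Bool) (b : Bool)
    {ct : List Bool} {T : ℕ}
    (hp : ∃ (t : ℕ) (s : Store), Runs p (fun j => [unary κ, List.ofFn θ ++ [b ^^ maskBit x θ],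
      w].getD j []) t s ∧ t ≤ T ∧ ∀ j, j < [ct].length → s j = [ct].getD j []) :
    ∃ (L : List (List Bool)) (m : Store), Exec (prepProg p)
      (mem [unary κ, [b], List.ofFn x ++ (List.ofFn θ ++ w)] fun _ => [])
      (1000 * (κ + 1 + w.length + T))
      (mem ((List.ofFn fun i => (x i, θ i)).flatMap cellCode :: ct ::
        (List.ofFn x ++ List.ofFn θ) :: L) m) := by
  have e := exec_start (mem [unary κ, [b], List.ofFn x ++ (List.ofFn θ ++ w)] fun _ => [])
  -- Thirteen stacks in all: ten for local use and three for the arguments of the subroutine.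
  nth_rw 2 [mem_pad _ 10] at e
  simp only [List.replicate, List.cons_append, List.nil_append] at e
  have e := e.moveN 0 2 3 4 (unary κ) (List.ofFn x) (List.ofFn θ ++ w) rfl
    (by simp [unary_length]) rfl (by decide) (by simp)
  simp at e
  have e := e.moveN 4 2 5 6 (unary κ) (List.ofFn θ) w rfl
    (by simp [unary_length]) rfl (by decide) (by simp)
  simp at e
  -- Together with the next copy this moves the inner coins to stack `12` in their original order;
  -- stack `9` only collects unwanted copies.
  have e := e.dup 2 4 9 _ rfl (by decide) (by simp)
  simp at e
  have e := e.dup 4 12 9 _ rfl (by decide) (by simp)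
  simp at e
  have e := e.dup 6 10 9 _ rfl (by decide) (by simp)
  simp [unary_reverse, unary_length] at e
  have e := e.dup 3 4 7 _ rfl (by decide) (by simp)
  simp at e
  have e := e.dup 5 6 8 _ rfl (by decide) (by simp)
  simp at e
  have e := e.mask 8 7 1 (List.ofFn fun i => (x i, θ i)) b (by simp [List.map_ofFn]; rfl)
    (by simp [List.map_ofFn]; rfl) rfl (by decide) (by simp)
  rw [← maskBit_eq] at e
  simp at e
  have e := e.dup 4 7 8 _ rfl (by decide) (by simp)
  simp at e
  have e := e.dup 6 3 4 _ rfl (by decide) (by simp)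
  simp at e
  -- Both strings are presented reversed because the code is written from the last qubit to the
  -- first.
  have e := e.emit 3 7 0 (List.ofFn fun i => (x i, θ i)).reverse
    (by simp [List.map_ofFn, List.map_reverse]; rfl)
    (Or.inl (by simp [List.map_ofFn, List.map_reverse]; rfl)) (by decide) (by simp)
  simp at e
  have e := e.dup 1 11 9 _ rfl (by decide) (by simp)
  simp at e
  -- Places `θ` in front of the masked bit, completing the inner message, and also on stack `2` for
  -- the verification key.
  have e := e.dup 4 2 11 _ rfl (by decide) (by simp)
  simp at e
  have e := e.dup 8 2 9 _ rfl (by decide) (by simp)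
  simp at e
  -- The length bound for the ciphertext limits the cost of the two copies that follow.
  obtain ⟨hct, b₁, b₂, m, h⟩ := exec_shift hp _ _ _ _ _ _ _ _ _ _
  have e := e.seq h
  have e := e.dup 10 3 9 _ rfl (by decide) (by simp)
  simp at e
  have e := e.dup 3 1 9 _ rfl (by decide) (by simp)
  simp at e
  refine ⟨_, m, e.mono ?_⟩
  rw [unary_length] at hct
  omega

end RevTRE

/-! ### Programs for decryption, deletion and verification; efficiency -/

namespace RevTRE

open Matrix

/-- The call of the decryption algorithm `p`, with the result on stacks `7` and `10`. -/
def decList (p : Cmd) : List Cmd :=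
  [dup 0 4 10, dup 1 5 9, dup 5 11 9, dup 2 5 9, dup 5 12 9, p.shift, moveN 4 10 7 9]

theorem exec_decList {p : Cmd} {κ : ℕ} (θ : Bits κ) (b : Bool) (c r y : List Bool) {T : ℕ}
    (hp : ∃ (t : ℕ) (s : Store), Runs p (fun j => [unary κ, c, r].getD j []) t s ∧ t ≤ T ∧
      ∀ j, j < [List.ofFn θ ++ [b]].length → s j = [List.ofFn θ ++ [b]].getD j []) :
    ∃ (d e f : List Bool) (m : Store), Exec (seqs (decList p))
      (mem [unary κ, c, r, y] fun _ => [])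
      (50 * (κ + c.length + r.length + T + 1))
      (mem [[], [], [], y, [], [], [], (List.ofFn θ).reverse, [], d, [b], e, f] m) := by
  have e := exec_start (mem [unary κ, c, r, y] fun _ => [])
  nth_rw 2 [mem_pad _ 9] at e
  simp only [List.replicate, List.cons_append, List.nil_append] at e
  have e := e.dup 0 4 10 _ rfl (by decide) (by simp)
  simp [unary_reverse, unary_length] at e
  have e := e.dup 1 5 9 _ rfl (by decide) (by simp)
  simp at e
  have e := e.dup 5 11 9 _ rfl (by decide) (by simp)
  simp at e
  have e := e.dup 2 5 9 _ rfl (by decide) (by simp)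
  simp at e
  have e := e.dup 5 12 9 _ rfl (by decide) (by simp)
  simp at e
  obtain ⟨-, b₁, b₂, m, h⟩ := exec_shift hp _ _ _ _ _ _ _ _ _ _
  have e := e.seq h
  have e := e.moveN 4 10 7 9 (unary κ) (List.ofFn θ) [b] rfl (by simp [unary_length]) rfl
    (by decide) (by simp)
  simp at e
  refine ⟨_, _, _, m, e.mono ?_⟩
  omega

theorem exec_decRot {p : Cmd} {κ : ℕ} (θ : Bits κ) (b : Bool) (c r : List Bool) {T : ℕ}
    (hp : ∃ (t : ℕ) (s : Store), Runs p (fun j => [unary κ, c, r].getD j []) t s ∧ t ≤ T ∧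
      ∀ j, j < [List.ofFn θ ++ [b]].length → s j = [List.ofFn θ ++ [b]].getD j []) :
    ∃ (L : List (List Bool)) (m : Store), Exec (Cmd.seq (seqs (decList p)) (emit 7 6 0))
      (mem [unary κ, c, r] fun _ => []) (100 * (κ + c.length + r.length + T + 1))
      (mem ((List.ofFn fun i => (false, θ i)).flatMap cellCode :: L) m) := by
  obtain ⟨d, f, g, m, e⟩ := exec_decList θ b c r [] hp
  -- Stack `6` is empty and stands for a string of zeros: a rotation uses no negations.
  have e := e.emit 7 6 0 (List.ofFn fun i => (false, θ i)).reverse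
    (by simp [List.map_ofFn, List.map_reverse]; rfl)
    (Or.inr ⟨rfl, by simp⟩) (by decide) (by simp)
  simp at e
  have h0 : mem [unary κ, c, r] (fun _ => []) = mem [unary κ, c, r, []] fun _ => [] :=
    mem_pad _ 1
  rw [h0]
  refine ⟨_, m, e.mono ?_⟩
  omega

theorem exec_decOut {p : Cmd} {κ : ℕ} (θ y : Bits κ) (b : Bool) (c r : List Bool) {T : ℕ}
    (hp : ∃ (t : ℕ) (s : Store), Runs p (fun j => [unary κ, c, r].getD j []) t s ∧ t ≤ T ∧
      ∀ j, j < [List.ofFn θ ++ [b]].length → s j = [List.ofFn θ ++ [b]].getD j []) :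
    ∃ (L : List (List Bool)) (m : Store),
      Exec (Cmd.seq (Cmd.seq (Cmd.seq (seqs (decList p)) (dup 3 8 9)) (mask 7 8 10)) (dup 10 0 9))
      (mem [unary κ, c, r, List.ofFn y] fun _ => [])
      (200 * (κ + c.length + r.length + T + 1)) (mem ([b ^^ maskBit y θ] :: L) m) := by
  obtain ⟨d, f, g, m, e⟩ := exec_decList θ b c r (List.ofFn y) hp
  have e := e.dup 3 8 9 _ rfl (by decide) (by simp)
  simp at e
  have e := e.mask 7 8 10 (List.ofFn fun i => (y i, θ i)).reverse b
    (by simp [List.map_ofFn, List.map_reverse]; rfl)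
    (by simp [List.map_ofFn, List.map_reverse]; rfl) rfl (by decide) (by simp)
  -- Both strings are reversed, which does not affect the parity.
  rw [maskCount, List.countP_reverse, ← maskCount, ← maskBit_eq] at e
  simp at e
  have e := e.dup 10 0 9 _ rfl (by decide) (by simp)
  simp at e
  refine ⟨_, m, e.mono ?_⟩
  omega

theorem exec_delRot (κ : ℕ) (c : List Bool) :
    ∃ (L : List (List Bool)) (m : Store), Exec (seqs [dup 0 3 9, emit 3 6 0])
      (mem [unary κ, c] fun _ => []) (100 * (κ + 1))
      (mem ((List.ofFn fun _ : Fin κ => (false, true)).flatMap cellCode :: L) m) := by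
  have e := exec_start (mem [unary κ, c] fun _ => [])
  nth_rw 2 [mem_pad _ 8] at e
  simp only [List.replicate, List.cons_append, List.nil_append] at e
  -- The unary input doubles as the all-ones basis string, i.e. the Hadamard basis on every qubit.
  have e := e.dup 0 3 9 _ rfl (by decide) (by simp)
  simp [unary_reverse, unary_length] at e
  have e := e.emit 3 6 0 (List.ofFn fun _ : Fin κ => (false, true)).reverse
    (by simp [unary]) (Or.inr ⟨rfl, by simp⟩) (by decide) (by simp)
  rw [List.reverse_reverse] at e
  simp only [List.length_reverse, List.length_ofFn, List.set_cons_succ, List.set_cons_zero,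
    List.getD_cons_zero, List.append_nil] at e
  refine ⟨_, _, e.mono ?_⟩
  omega

theorem exec_delOut (u c y : List Bool) :
    ∃ (L : List (List Bool)) (m : Store), Exec (seqs [dup 0 9 8, dup 2 3 9, dup 3 0 9])
      (mem [u, c, y] fun _ => []) (100 * (u.length + y.length + 1)) (mem (y :: L) m) := by
  have e := exec_start (mem [u, c, y] fun _ => [])
  nth_rw 2 [mem_pad _ 7] at e
  simp only [List.replicate, List.cons_append, List.nil_append] at e
  -- Serves only to clear stack `0` for the output.
  have e := e.dup 0 9 8 _ rfl (by decide) (by simp)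
  simp at e
  have e := e.dup 2 3 9 _ rfl (by decide) (by simp)
  simp at e
  have e := e.dup 3 0 9 _ rfl (by decide) (by simp)
  simp at e
  refine ⟨_, _, e.mono ?_⟩
  omega

theorem exec_ver {κ : ℕ} (x θ y : Bits κ) :
    ∃ (L : List (List Bool)) (m : Store),
      Exec (seqs [moveN 0 1 3 4, dup 3 5 9, Cmd.push 0 true, compare 1 5 2 0])
      (mem [unary κ, List.ofFn x ++ List.ofFn θ, List.ofFn y] fun _ => []) (100 * (κ + 1))
      (mem ([decide (∀ i, θ i = true → x i = y i)] :: L) m) := by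
  have e := exec_start (mem [unary κ, List.ofFn x ++ List.ofFn θ, List.ofFn y] fun _ => [])
  nth_rw 2 [mem_pad _ 7] at e
  simp only [List.replicate, List.cons_append, List.nil_append] at e
  have e := e.moveN 0 1 3 4 (unary κ) (List.ofFn x) (List.ofFn θ) rfl
    (by simp [unary_length]) rfl (by decide) (by simp)
  simp at e
  have e := e.dup 3 5 9 _ rfl (by decide) (by simp)
  simp at e
  have e := e.push 0 true (by simp)
  simp at e
  have e := e.compare 1 5 2 0 (List.ofFn fun i => (θ i, x i, y i)) true
    (by simp [List.map_ofFn]; rfl) (by simp [List.map_ofFn]; rfl)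
    (by simp [List.map_ofFn]; rfl) rfl (by decide) (by simp)
  have h : (true && (List.ofFn fun i => (θ i, x i, y i)).all agreeTest) =
      decide (∀ i, θ i = true → x i = y i) := by
    rw [Bool.eq_iff_iff]
    simp only [Bool.true_and, List.all_eq_true, List.forall_mem_ofFn_iff, agreeTest,
      decide_eq_true_eq]
    refine forall_congr' fun i => ?_
    cases θ i <;> simp
  rw [h] at e
  simp only [List.length_ofFn, List.set_cons_succ, List.set_cons_zero] at e
  refine ⟨_, _, e.mono ?_⟩
  omega

theorem compile_efficient {S : TRE (fun κ => κ + 1)} (hS : S.Efficient) :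
    (compile S).Efficient := by
  obtain ⟨hc, hd, ⟨p, q, hp⟩, p', q', hp'⟩ := hS
  have hcode : ∀ {n : ℕ} (f : Fin n → Bool × Bool),
      ((List.ofFn f).flatMap cellInstr).flatMap QInstr.code = (List.ofFn f).flatMap cellCode :=
    fun f => List.flatMap_assoc
  have hdec : ∀ κ (c : Bits (S.ctLen κ)) (r : Bits (S.decCoinLen κ)), ∃ (t : ℕ) (s : Store),
      Runs p' (fun j => [unary κ, List.ofFn c, List.ofFn r].getD j []) t s ∧
      t ≤ q'.eval (κ + (S.ctLen κ + S.decCoinLen κ)) ∧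
      ∀ j, j < [List.ofFn (fun i => S.dec κ c r (Fin.castSucc i)) ++
        [S.dec κ c r (Fin.last κ)]].length → s j = [List.ofFn (fun i =>
          S.dec κ c r (Fin.castSucc i)) ++ [S.dec κ c r (Fin.last κ)]].getD j [] := by
    intro κ c r
    have h := hp' ⟨κ, c, r⟩
    rw [← ofFn_last]
    simpa [unary_length] using h
  refine ⟨polyBounded_id, (polyBounded_id.add polyBounded_id).add hc, hd,
    ⟨fun κ _ r => (List.ofFn fun i => (coinX (n := κ) (m := S.coinLen κ) r i,
      coinTheta (n := κ) (m := S.coinLen κ) r i)).flatMap cellInstr,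
      fun κ b r => prep_mulVec _ _, ?_⟩,
    ⟨fun κ c r => (List.ofFn fun i : Fin κ =>
      (false, S.dec κ c r (Fin.castSucc i))).flatMap cellInstr,
      fun κ c r => runInstr_rot _, ?_⟩, ?_,
    ⟨fun κ _ => (List.ofFn fun _ : Fin κ => (false, true)).flatMap cellInstr,
      fun κ c => runInstr_rot _, ?_⟩, ?_, ?_⟩
  · refine polyTime_of_exec (prepProg p) 1000 q ?_
    rintro ⟨κ, b, r⟩
    change Bits (κ + κ + S.coinLen κ) at r
    have h := hp ⟨κ, Fin.snoc (coinTheta r) (b ^^ maskBit (coinX r) (coinTheta r)), coinRest r⟩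
    simp only [ofFn_snoc] at h
    obtain ⟨L, m, e⟩ := exec_prepProg (coinX r) (coinTheta r) (List.ofFn (coinRest r)) b h
    rw [← ofFn_coins] at e
    refine ⟨_, _, e, ?_, ?_⟩
    -- The inner encryption is called on an input no longer than that of the compiled one, so
    -- monotonicity of `q` bounds its time.
    · refine Nat.mul_le_mul_left _ (add_le_add ?_ (eval_mono q ?_)) <;>
        simp [unary_length, compile] <;> omega
    · intro j hj
      have hj : j < 3 := hj
      interval_cases j
      · exact (hcode _).symm
      · rfl
      · exact (ofFn_append _ _).symm
  · refine polyTime_of_exec (Cmd.seq (seqs (decList p')) (emit 7 6 0)) 100 q' ?_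
    rintro ⟨κ, c, r⟩
    change Bits (S.ctLen κ) at c
    change Bits (S.decCoinLen κ) at r
    obtain ⟨L, m, e⟩ := exec_decRot _ _ _ _ (hdec κ c r)
    refine ⟨_, _, e, ?_, ?_⟩
    · simp [unary_length, compile, add_assoc, add_comm, add_left_comm]
    · intro j hj
      have hj : j < 1 := hj
      interval_cases j
      exact (hcode _).symm
  · refine polyTime_of_exec (Cmd.seq (Cmd.seq (Cmd.seq (seqs (decList p')) (dup 3 8 9))
      (mask 7 8 10)) (dup 10 0 9)) 200 q' ?_
    rintro ⟨κ, c, r, y⟩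
    change Bits (S.ctLen κ) at c
    change Bits (S.decCoinLen κ) at r
    change Bits κ at y
    obtain ⟨L, m, e⟩ := exec_decOut _ y _ _ _ (hdec κ c r)
    refine ⟨_, _, e, ?_, ?_⟩
    -- The input also contains the measurement outcome, which the inner decryption does not receive.
    · have := eval_mono q' (show κ + (S.ctLen κ + S.decCoinLen κ) ≤
        κ + (S.ctLen κ + (S.decCoinLen κ + κ)) by omega)
      refine Nat.mul_le_mul_left _ ?_
      simp [unary_length, compile]
      omega
    · intro j hj
      have hj : j < 1 := hj
      interval_cases j
      rfl
  · refine polyTime_of_exec (seqs [dup 0 3 9, emit 3 6 0]) 100 0 ?_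
    rintro ⟨κ, c⟩
    obtain ⟨L, m, e⟩ := exec_delRot κ (List.ofFn c)
    refine ⟨_, _, e, ?_, ?_⟩
    · simp [unary_length]
    · intro j hj
      have hj : j < 1 := hj
      interval_cases j
      exact (hcode _).symm
  · refine polyTime_of_exec (seqs [dup 0 9 8, dup 2 3 9, dup 3 0 9]) 100 0 ?_
    rintro ⟨κ, c, y⟩
    obtain ⟨L, m, e⟩ := exec_delOut (unary κ) (List.ofFn c) (List.ofFn y)
    refine ⟨_, _, e, ?_, ?_⟩
    · simp [unary_length]
    · intro j hj
      have hj : j < 1 := hj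
      interval_cases j
      rfl
  · refine polyTime_of_exec
      (seqs [moveN 0 1 3 4, dup 3 5 9, Cmd.push 0 true, compare 1 5 2 0]) 100 0 ?_
    rintro ⟨κ, v, y⟩
    change Bits (κ + κ) at v
    change Bits κ at y
    obtain ⟨L, m, e⟩ := exec_ver (fun i => v (Fin.castAdd κ i)) (fun i => v (Fin.natAdd κ i)) y
    have hv : List.ofFn v = (List.ofFn fun i => v (Fin.castAdd κ i)) ++
        List.ofFn fun i => v (Fin.natAdd κ i) := List.ofFn_add
    rw [← hv] at e
    refine ⟨_, _, e, ?_, ?_⟩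
    · simp [unary_length]
    · intro j hj
      have hj : j < 1 := hj
      interval_cases j
      rfl

end RevTRE
theorem mainTheorem6 (T : ℕ → ℕ) (S : RevTRE.TRE (fun κ => κ + 1))
    (hEff : S.Efficient) (hHid : S.Hiding T) :
    (RevTRE.compile S).Efficient ∧
    (S.Correct → (RevTRE.compile S).Correct) ∧
    (RevTRE.compile S).Hiding T ∧
    (RevTRE.compile S).DeletionCorrect ∧
    (RevTRE.compile S).RevocablyHiding T := by
  exact ⟨RevTRE.compile_efficient hEff, RevTRE.compile_correct, RevTRE.compile_hiding hHid,
    RevTRE.compile_deletionCorrect, RevTRE.compile_revocablyHiding hHid⟩
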